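/- Let $\mathbb F_4=\{0,1,\omega,\overline\omega\}$, with trace inner product $e*f=e\cdot\overline f+\overline e\cdot f$ on $\mathbb F_4^n$. An $[[n,k]]$ stabilizer code is given by an additive code $C\subseteq\mathbb F_4^n$ with $|C|=2^{n-k}$ that is self-orthogonal, i.e. $C\subseteq C^{\perp}$ where $C^\perp=\{e: e*f=0\ \forall f\in C\}$; for $k\ge 1$ its distance $d$ is the minimum Hamming weight of the vectors in $C^{\perp}\setminus C$, and $\delta=d/n$ is its relative distance. Let $h_4(x)=x\log_4 3-x\log_4x-(1-x)\log_4(1-x)$ (with $0\log 0=0$) and $$F_{\mathrm{PB}}(R,\delta)=\frac{2(1+R)}{3+R}\,h_4(\delta).$$ Complexity is the running time on a random access machine with logarithmic cost. There is a single deterministic program which receives $n$, $k$ and any $n-k$ generators of $C$ and which, whenever it halts on an $[[n,k]]$ stabilizer code with $k\ge1$, outputs its distance $d$, such that the following holds. Let $0<R<1$, let $k=k(n)$ be integers with $k(n)/n\to R$ (for example $k=\lfloor Rn\rfloor$), let $\varepsilon>0$, and choose the $[[n,k]]$ stabilizer code uniformly at random. 1. With probability tending to $1$ as $n\to\infty$,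 for every choice of the $n-k$ generators the program halts with output $d$ after time at most $2^{n(F_{\mathrm{PB}}(R,\delta)+\varepsilon)}$. 2. With probability tending to $1$ as $n\to\infty$, the code meets the quantum Gilbert–Varshamov bound $R=1-2h_4(\delta)$ up to $\varepsilon$, i.e. $|R-(1-2h_4(\delta))|\le\varepsilon$, and for every choice of the $n-k$ generators the program halts with output $d$ after time at most $2^{n(F^*_{\mathrm{PB}}+\varepsilon)}$, where $F^*_{\mathrm{PB}}=\frac{1-R^2}{3+R}$. Moreover, if $0<R<1$, $0\le\delta\le1$ and $R=1-2h_4(\delta)$ holds exactly, then $F_{\mathrm{PB}}(R,\delta)=F^*_{\mathrm{PB}}$. -/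

import Mathlib

open Filter Topology

/-! ### The field with four elements and additive quaternary codes -/

/-- The field `𝔽₄ = {u + ω v}`; the pair `(u, v)` stands for `u + ω v`, where `ω ^ 2 = ω + 1`.
Addition is the componentwise one; field multiplication is `F4.mul` (not the product ring's). -/
abbrev F4 : Type := ZMod 2 × ZMod 2

/-- Multiplication in `𝔽₄`: `(a + ω b) (c + ω d) = (a c + b d) + ω (a d + b c + b d)`. -/
def F4.mul (x y : F4) : F4 :=
  (x.1 * y.1 + x.2 * y.2, x.1 * y.2 + x.2 * y.1 + x.2 * y.2)

/-- Conjugation `u + ω v ↦ u + ω² v = (u + v) + ω v`. -/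
def F4.conj (x : F4) : F4 := (x.1 + x.2, x.2)

/-- Conjugation is the Frobenius map `x ↦ x ^ 2`. -/
theorem F4.conj_eq_sq : ∀ x : F4, F4.conj x = F4.mul x x := by decide

/-- The trace inner product `e * f = e · f̄ + ē · f` on `𝔽₄ⁿ`.  The Pauli operators
`X^v Z^u` and `X^v' Z^u'` commute iff the trace inner product of `u + ω v`, `u' + ω v'` is `0`. -/
def traceInner {n : ℕ} (e f : Fin n → F4) : F4 :=
  ∑ i, (F4.mul (e i) (F4.conj (f i)) + F4.mul (F4.conj (e i)) (f i))

/-- Coordinatewise, the trace inner product is the symplectic form. -/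
theorem F4.trace_eq : ∀ x y : F4,
    F4.mul x (F4.conj y) + F4.mul (F4.conj x) y = (x.1 * y.2 + x.2 * y.1, 0) := by decide

/-- The dual `C^⊥` of an additive code with respect to the trace inner product. -/
def dualCode {n : ℕ} (C : AddSubgroup (Fin n → F4)) : Set (Fin n → F4) :=
  {e | ∀ f ∈ C, traceInner e f = 0}

/-- The `[[n, k]]` stabilizer codes, each given by its additive self-orthogonal code `C` over `𝔽₄`
of size `2 ^ (n - k)` (there are none if `n < k`). -/
def stabCodes (n k : ℕ) : Set (AddSubgroup (Fin n → F4)) :=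
  {C | Nat.card C * 2 ^ k = 2 ^ n ∧ ∀ e ∈ C, ∀ f ∈ C, traceInner e f = 0}

/-- The distance of the stabilizer code given by `C`: the minimum weight in `C^⊥ \ C`
(a nonempty set if `k ≥ 1`). -/
noncomputable def stabDist {n : ℕ} (C : AddSubgroup (Fin n → F4)) : ℕ :=
  sInf {w | ∃ e ∈ dualCode C, e ∉ C ∧ hammingNorm e = w}

/-- The probability that a uniformly random `[[n, k]]` stabilizer code has the property `A`. -/
noncomputable def stabProb (n k : ℕ) (A : AddSubgroup (Fin n → F4) → Prop) : ℝ :=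
  ({C ∈ stabCodes n k | A C}.ncard : ℝ) / ((stabCodes n k).ncard : ℝ)

/-! ### Random access machine with logarithmic cost -/

/-- A configuration: registers and an unbounded memory, both holding natural numbers. -/
structure RamState where
  reg : ℕ → ℕ
  mem : ℕ → ℕ

/-- Arithmetic instructions (truncated subtraction, division rounding down with `x / 0 = 0`). -/
inductive RamOp
  | add | sub | mul | div

def RamOp.eval : RamOp → ℕ → ℕ → ℕ
  | add, x, y => x + y
  | sub, x, y => x - y
  | mul, x, y => x * y
  | div, x, y => x / y

/-- Expressions; `load a` reads the memory cell whose address is the value of `a`. -/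
inductive RamExpr
  | const (c : ℕ)
  | reg (i : ℕ)
  | load (a : RamExpr)
  | op (o : RamOp) (a b : RamExpr)

def RamExpr.eval (σ : RamState) : RamExpr → ℕ
  | const c => c
  | reg i => σ.reg i
  | load a => σ.mem (a.eval σ)
  | op o a b => o.eval (a.eval σ) (b.eval σ)

/-- Logarithmic cost of touching the number `x`: its binary length plus one. -/
def logCost (x : ℕ) : ℕ := Nat.size x + 1

/-- Cost of evaluating an expression: the lengths of all numbers (operands and addresses) used. -/
def RamExpr.cost (σ : RamState) : RamExpr → ℕ
  | const c => logCost c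
  | reg i => logCost (σ.reg i)
  | load a => a.cost σ + logCost (a.eval σ) + logCost (σ.mem (a.eval σ))
  | op _ a b => a.cost σ + b.cost σ + logCost (a.eval σ) + logCost (b.eval σ)

/-- Programs.  Tests ask whether the value of an expression is nonzero. -/
inductive RamProg
  | skip
  | assign (i : ℕ) (e : RamExpr)
  | store (a e : RamExpr)
  | seq (p q : RamProg)
  | ite (e : RamExpr) (p q : RamProg)
  | while (e : RamExpr) (p : RamProg)

/-- `Exec p σ t τ`: started in `σ`, the program `p` halts in `τ` after time exactly `t`. -/
inductive RamProg.Exec : RamProg → RamState → ℕ → RamState → Prop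
  | skip (σ : RamState) : Exec .skip σ 1 σ
  | assign (i : ℕ) (e : RamExpr) (σ : RamState) :
      Exec (.assign i e) σ (e.cost σ + logCost (e.eval σ))
        ⟨Function.update σ.reg i (e.eval σ), σ.mem⟩
  | store (a e : RamExpr) (σ : RamState) :
      Exec (.store a e) σ (a.cost σ + e.cost σ + logCost (a.eval σ) + logCost (e.eval σ))
        ⟨σ.reg, Function.update σ.mem (a.eval σ) (e.eval σ)⟩
  | seq {p q : RamProg} {σ τ υ : RamState} {s t : ℕ} :
      Exec p σ s τ → Exec q τ t υ → Exec (.seq p q) σ (s + t) υ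
  | ite_true {e : RamExpr} {p q : RamProg} {σ τ : RamState} {t : ℕ} :
      e.eval σ ≠ 0 → Exec p σ t τ → Exec (.ite e p q) σ (e.cost σ + 1 + t) τ
  | ite_false {e : RamExpr} {p q : RamProg} {σ τ : RamState} {t : ℕ} :
      e.eval σ = 0 → Exec q σ t τ → Exec (.ite e p q) σ (e.cost σ + 1 + t) τ
  | while_true {e : RamExpr} {p : RamProg} {σ τ υ : RamState} {s t : ℕ} :
      e.eval σ ≠ 0 → Exec p σ s τ → Exec (.while e p) τ t υ →
      Exec (.while e p) σ (e.cost σ + 1 + s + t) υ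
  | while_false {e : RamExpr} {p : RamProg} {σ : RamState} :
      e.eval σ = 0 → Exec (.while e p) σ (e.cost σ + 1) σ

/-! ### Distance finding -/

/-- The symbols `0, 1, ω, ω + 1` are written as `0, 1, 2, 3`. -/
def F4.code (x : F4) : ℕ := x.1.val + 2 * x.2.val

/-- The input word `n, k, g₁, …, g_{n-k}`: the generators are written one after another,
one symbol per memory cell. -/
def inputWord (n k : ℕ) (g : Fin (n - k) → Fin n → F4) : List ℕ :=
  n :: k :: (List.finRange (n - k)).flatMap fun i =>
    (List.finRange n).map fun j => (g i j).code

/-- Initial configuration: the input stands in the memory cells `0, 1, 2, …`; every other cell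
and every register is `0`. -/
def initState (n k : ℕ) (g : Fin (n - k) → Fin n → F4) : RamState where
  reg := fun _ => 0
  mem := fun a => (inputWord n k g).getD a 0

/-- The `n - k` vectors `g i` generate the additive code `C`. -/
def IsGenerating {n k : ℕ} (g : Fin (n - k) → Fin n → F4) (C : AddSubgroup (Fin n → F4)) : Prop :=
  AddSubgroup.closure (Set.range g) = C

/-- On every system of `n - k` generators of `C`, the program `P` halts in time at most `T` with
the distance of the stabilizer code in register `0`. -/
def FindsDistWithin (P : RamProg) (n k : ℕ) (C : AddSubgroup (Fin n → F4)) (T : ℝ) : Prop :=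
  ∀ g : Fin (n - k) → Fin n → F4, IsGenerating g C →
    ∃ (t : ℕ) (τ : RamState),
      P.Exec (initState n k g) t τ ∧ τ.reg 0 = stabDist C ∧ (t : ℝ) ≤ T

/-! ### Exponents -/

/-- The `q`-ary entropy function. -/
noncomputable def entropyQ (q : ℕ) (x : ℝ) : ℝ :=
  x * Real.logb q (q - 1) - x * Real.logb q x - (1 - x) * Real.logb q (1 - x)

/-- The exponent `F_PB` as a function of the rate `R` and of the relative distance `δ`. -/
noncomputable def expPB (R δ : ℝ) : ℝ := 2 * (1 + R) / (3 + R) * entropyQ 4 δ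

/-- The relative distance of the stabilizer code given by `C`. -/
noncomputable def relDist {n : ℕ} (C : AddSubgroup (Fin n → F4)) : ℝ := (stabDist C : ℝ) / (n : ℝ)

/-! ### Verification of random access programs -/

/-! The algorithm punctures the dual code and matches two halves. Put `m ≈ μn` with `μ =
(1+R)/(3+R)` and look at a window of `2m` cyclically consecutive positions. Suppose that no nonzero
element of `C^⊥` vanishes on the window. Then an element of `C^⊥` is determined by its restriction
to the window. For a vector of weight `w`, averaging over the cyclic shifts gives a window with at
most `2mw/n` nonzero entries. Sliding a block of length `m` through this window changes its weight
by at most one at a time, so some position splits the window into two halves of weight at most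
`⌊wm/n⌋ + 1` each (`exists_halvesLight`).

For every weight, window and split, Gaussian elimination against the generators produces a linear
map `Φ` (`IsReduction`). It fixes `C^⊥`, does not change entries in the window, and sends vectors
vanishing on the window into `C^⊥`. The program lists the light vectors `a`, `b` on the two halves,
sorts the first list into buckets by the syndrome of `Φ a`, and looks up the syndrome of `Φ b`. A
match yields the element `Φ (b + a)` of `C^⊥`. If the window determines the elements of `C^⊥`, every
balanced element arises in this way (`IsReduction.exists_pair`), and in any case a match can be read
off from the element it yields (`IsReduction.sum_bucket_le`). The element is tested for its weight
and for membership in `C`. Weights are tried in increasing order, so the first success is the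
distance. If a window fails to determine the elements of `C^⊥`, a flag is raised and the program
ends in an infinite loop. Hence it never returns a wrong value.

The time is, up to a polynomial, the length of the lists plus the number of matches. At relative
weight `δ` the lists have length about `2^(2m h₄(δ))`. The expected number of matches is about
`2^(4m h₄(δ)) · 4^(n-2m) · 2^(k-n)`. On the Gilbert–Varshamov bound the choice of `μ` makes both
equal to `2^(nF)` with `F = μ(1-R) = (1-R²)/(3+R)`. The expected number of nonzero dual vectors
vanishing on a given window is about `4^(n-2m) · 2^(k-n) = 2^(-nF)`, so almost no code is defective.

The probabilities come from the symplectic group. It permutes the stabilizer codes and is transitive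
on nonzero vectors (`exists_isSymplectic`), and the stabilizer of `e` is transitive on the vectors
other than `0`, `e` with given product with `e` (`exists_isSymplectic_fixing`). Double counting
turns this into first and second moments (`stabProb_le_hits`, `le_stabProb_logical`), so the
distance concentrates on the Gilbert–Varshamov bound. Sets of light vectors are counted by
evaluating weight enumerators at the optimal point `tilt` (`card_mul_pow_le`,
`one_add_tilt_pow_le`). The union bound `one_sub_le_stabProb` combines these estimates, and near the
bound the first claim follows from the second.

On the machine, a vector is one integer with `2n` digits in a huge even radix. Digits are never
reduced modulo two, so addition of vectors is addition of integers. The second coordinates are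
stored in reverse order, so that one digit of the product of two such integers is the symplectic
product (`Packs.symp`). All numbers have polynomially many binary digits. Therefore every
instruction costs at most a polynomial `unitCost`, and `Wp` counts instructions in these units. -/

instance : Add RamExpr := ⟨.op .add⟩
instance : Sub RamExpr := ⟨.op .sub⟩
instance : Mul RamExpr := ⟨.op .mul⟩
instance : Div RamExpr := ⟨.op .div⟩
instance (c : ℕ) : OfNat RamExpr c := ⟨.const c⟩

/-! ### Expressions: notation and size -/

namespace RamExpr

@[simp] theorem eval_add (σ : RamState) (a b : RamExpr) : (a + b).eval σ = a.eval σ + b.eval σ := rfl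
@[simp] theorem eval_sub (σ : RamState) (a b : RamExpr) : (a - b).eval σ = a.eval σ - b.eval σ := rfl
@[simp] theorem eval_mul (σ : RamState) (a b : RamExpr) : (a * b).eval σ = a.eval σ * b.eval σ := rfl
@[simp] theorem eval_div (σ : RamState) (a b : RamExpr) : (a / b).eval σ = a.eval σ / b.eval σ := rfl
@[simp] theorem eval_two (σ : RamState) : (2 : RamExpr).eval σ = 2 := rfl
@[simp] theorem eval_three (σ : RamState) : (3 : RamExpr).eval σ = 3 := rfl
@[simp] theorem eval_four (σ : RamState) : (4 : RamExpr).eval σ = 4 := rfl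
@[simp] theorem eval_256 (σ : RamState) : (256 : RamExpr).eval σ = 256 := rfl
@[simp] theorem eval_one (σ : RamState) : (1 : RamExpr).eval σ = 1 := rfl
@[simp] theorem eval_reg (σ : RamState) (i : ℕ) : (reg i).eval σ = σ.reg i := rfl

/-- The number of nodes of an expression. -/
def size : RamExpr → ℕ
  | const _ => 1
  | reg _ => 1
  | load a => a.size + 1
  | op _ a b => a.size + b.size + 1

/-- All constants are at most `256`. -/
def small : RamExpr → Bool
  | const c => decide (c ≤ 256)
  | reg _ => true
  | load a => a.small
  | op _ a b => a.small && b.small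

/-- At most one hundred nodes and only small constants. -/
def fits (e : RamExpr) : Bool := e.small && decide (e.size ≤ 100)

/-- Remainder of the division by an expression. -/
def mod (a b : RamExpr) : RamExpr := a - b * (a / b)

@[simp] theorem eval_mod (σ : RamState) (a b : RamExpr) :
    (a.mod b).eval σ = a.eval σ % b.eval σ := by
  simp only [mod, eval_sub, eval_mul, eval_div]
  have := Nat.div_add_mod (a.eval σ) (b.eval σ)
  omega

/-- Entry `a` of array number `q`; register `1` holds the offset of the array area. -/
def ld (q : ℕ) (a : RamExpr) : RamExpr := load (8 * (a + reg 1) + const q)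

end RamExpr

/-! ### Interleaved arrays and frame conditions -/

namespace RamState

/-- Change of a register. -/
def set (σ : RamState) (i v : ℕ) : RamState := ⟨Function.update σ.reg i v, σ.mem⟩

/-- Entry `a` of array number `q`. -/
def arr (σ : RamState) (q a : ℕ) : ℕ := σ.mem (8 * (a + σ.reg 1) + q)

/-- Change of an array entry. -/
def put (σ : RamState) (q a v : ℕ) : RamState :=
  ⟨σ.reg, Function.update σ.mem (8 * (a + σ.reg 1) + q) v⟩

@[simp] theorem reg_set (σ : RamState) (i v j : ℕ) :
    (σ.set i v).reg j = if j = i then v else σ.reg j := by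
  simp [set, Function.update_apply]

@[simp] theorem mem_set (σ : RamState) (i v : ℕ) : (σ.set i v).mem = σ.mem := rfl

@[simp] theorem reg_put (σ : RamState) (q a v : ℕ) : (σ.put q a v).reg = σ.reg := rfl

/-- Register `1` is the base address of all arrays, so it is the only register whose change would
move the entries. -/
theorem arr_set (σ : RamState) {i : ℕ} (h : 1 ≠ i) (v q a : ℕ) :
    (σ.set i v).arr q a = σ.arr q a := by
  simp [arr, h]

/-- An address modulo `8` is the number of the array and its quotient determines the entry, so
different entries never share a cell. -/
theorem arr_put (σ : RamState) {q q' : ℕ} (hq : q < 8) (hq' : q' < 8) (a v a' : ℕ) :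
    (σ.put q a v).arr q' a' = if q' = q ∧ a' = a then v else σ.arr q' a' := by
  simp only [arr, put, Function.update_apply]
  congr 1
  simp only [eq_iff_iff]
  omega

/-- All numbers in the configuration have at most `z` binary digits. -/
def Bounded (z : ℕ) (σ : RamState) : Prop := (∀ r, σ.reg r < 2 ^ z) ∧ ∀ a, σ.mem a < 2 ^ z

/-- Only the listed registers and arrays have changed from `σ` to `τ`. -/
structure Frame (rs qs : List ℕ) (σ τ : RamState) : Prop where
  reg : ∀ r, r ∉ rs → τ.reg r = σ.reg r
  arr : ∀ q, q ∉ qs → q < 8 → ∀ a, τ.arr q a = σ.arr q a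

theorem Frame.refl (rs qs : List ℕ) (σ : RamState) : Frame rs qs σ σ :=
  ⟨fun _ _ => rfl, fun _ _ _ _ => rfl⟩

theorem Frame.trans {rs qs : List ℕ} {σ τ υ : RamState} (h : Frame rs qs σ τ)
    (h' : Frame rs qs τ υ) : Frame rs qs σ υ :=
  ⟨fun r hr => (h'.reg r hr).trans (h.reg r hr),
    fun q hq h8 a => (h'.arr q hq h8 a).trans (h.arr q hq h8 a)⟩

theorem Frame.mono {rs qs rs' qs' : List ℕ} {σ τ : RamState} (h : Frame rs qs σ τ)
    (hr : rs ⊆ rs') (hq : qs ⊆ qs') : Frame rs' qs' σ τ :=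
  ⟨fun r h' => h.reg r fun h'' => h' (hr h''), fun q h' => h.arr q fun h'' => h' (hq h'')⟩

theorem Frame.set {rs qs : List ℕ} {σ τ : RamState} (h : Frame rs qs σ τ) {i : ℕ}
    (hi : i ∈ rs) (h1 : 1 ≠ i) (v : ℕ) : Frame rs qs σ (τ.set i v) := by
  refine ⟨fun r hr => ?_, fun q hq h8 a => ?_⟩
  · have : r ≠ i := by rintro rfl; exact hr hi
    simpa [this] using h.reg r hr
  · rw [arr_set _ h1]
    exact h.arr q hq h8 a

theorem Frame.put {rs qs : List ℕ} {σ τ : RamState} (h : Frame rs qs σ τ) {q : ℕ}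
    (hq : q ∈ qs) (h8 : q < 8) (a v : ℕ) : Frame rs qs σ (τ.put q a v) := by
  refine ⟨fun r hr => h.reg r hr, fun q' hq' h8' a' => ?_⟩
  have : q' ≠ q := by rintro rfl; exact hq' hq
  rw [arr_put _ h8 h8', if_neg (by tauto)]
  exact h.arr q' hq' h8' a'

@[simp] theorem eval_ld (σ : RamState) (q : ℕ) (a : RamExpr) :
    (RamExpr.ld q a).eval σ = σ.arr q (a.eval σ) := rfl

theorem Bounded.arr {z : ℕ} {σ : RamState} (h : Bounded z σ) (q a : ℕ) : σ.arr q a < 2 ^ z :=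
  h.2 _

theorem Bounded.set {z : ℕ} {σ : RamState} (h : Bounded z σ) (i : ℕ) {v : ℕ} (hv : v < 2 ^ z) :
    Bounded z (σ.set i v) := by
  refine ⟨fun r => ?_, h.2⟩
  rw [reg_set]
  split_ifs
  exacts [hv, h.1 r]

theorem Bounded.put {z : ℕ} {σ : RamState} (h : Bounded z σ) (q a : ℕ) {v : ℕ} (hv : v < 2 ^ z) :
    Bounded z (σ.put q a v) := by
  refine ⟨h.1, fun b => ?_⟩
  simp only [RamState.put, Function.update_apply]
  split_ifs
  exacts [hv, h.2 b]

end RamState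

open RamState

theorem logCost_le {x a : ℕ} (h : x < 2 ^ a) : logCost x ≤ a + 1 :=
  Nat.succ_le_succ (Nat.size_le.2 h)

/-! ### Logarithmic cost of expressions -/

namespace RamExpr

theorem one_le_size (e : RamExpr) : 1 ≤ e.size := by
  cases e <;> simp [size]

/-- Numbers of digits at most add up under the operations, so every node contributes at most `z`
digits. The bound `9 ≤ z` accommodates the constant `256`. -/
theorem eval_lt {z : ℕ} (hz : 9 ≤ z) {σ : RamState} (hσ : Bounded z σ) :
    ∀ e : RamExpr, e.small = true → e.eval σ < 2 ^ (z * e.size)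
  | const c, h => by
    simp only [small, decide_eq_true_eq] at h
    have : 2 ^ 9 ≤ 2 ^ z := Nat.pow_le_pow_right (by norm_num) hz
    simp only [eval, size, mul_one]
    omega
  | reg i, _ => by simpa [eval, size] using hσ.1 i
  | load a, _ => by
    refine (hσ.2 _).trans_le (Nat.pow_le_pow_right (by norm_num) ?_)
    exact Nat.le_mul_of_pos_right _ (one_le_size _)
  | op o a b, h => by
    simp only [small, Bool.and_eq_true] at h
    have ha := eval_lt hz hσ a h.1
    have hb := eval_lt hz hσ b h.2
    have e1 : 2 ^ (z * (op o a b).size) = 2 ^ (z * a.size) * 2 ^ (z * b.size) * 2 ^ z := by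
      rw [← pow_add, ← pow_add]; congr 1; simp only [size]; ring
    have h2 : 2 ≤ 2 ^ z := by
      calc 2 = 2 ^ 1 := rfl
        _ ≤ 2 ^ z := Nat.pow_le_pow_right (by norm_num) (by omega)
    rw [e1]
    generalize 2 ^ (z * a.size) = A at *
    generalize 2 ^ (z * b.size) = D at *
    generalize 2 ^ z = Z at *
    simp only [eval]
    have hAD : A ≤ A * D := Nat.le_mul_of_pos_right _ (by omega)
    have hDA : D ≤ A * D := Nat.le_mul_of_pos_left _ (by omega)
    have hZ : A * D * 2 ≤ A * D * Z := Nat.mul_le_mul_left _ h2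
    cases o with
    | add => simp only [RamOp.eval]; omega
    | sub => simp only [RamOp.eval]; omega
    | mul =>
      simp only [RamOp.eval]
      have : a.eval σ * b.eval σ < A * D := Nat.mul_lt_mul'' ha hb
      omega
    | div =>
      simp only [RamOp.eval]
      have : a.eval σ / b.eval σ ≤ a.eval σ := Nat.div_le_self _ _
      omega

/-- The cost of the value itself is included so that the induction closes: an operation is charged
for the values of its operands. -/
theorem cost_add_le {z : ℕ} (hz : 9 ≤ z) {σ : RamState} (hσ : Bounded z σ) (S : ℕ) :
    ∀ e : RamExpr, e.small = true → e.size ≤ S →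
      e.cost σ + logCost (e.eval σ) ≤ 3 * e.size * (z * S + 1)
  | const c, h, hS => by
    have := logCost_le ((eval_lt hz hσ _ h).trans_le
      (Nat.pow_le_pow_right (by norm_num) (Nat.mul_le_mul_left z hS)))
    simp only [cost, eval, size] at this ⊢
    omega
  | reg i, h, hS => by
    have := logCost_le ((eval_lt hz hσ _ h).trans_le
      (Nat.pow_le_pow_right (by norm_num) (Nat.mul_le_mul_left z hS)))
    simp only [cost, eval, size] at this ⊢
    omega
  | load a, h, hS => by
    have h1 := logCost_le ((eval_lt hz hσ (load a) h).trans_le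
      (Nat.pow_le_pow_right (by norm_num) (Nat.mul_le_mul_left z hS)))
    have h2 := cost_add_le hz hσ S a h (by simp only [size] at hS; omega)
    simp only [cost, eval, size] at h1 h2 ⊢
    have : 3 * (a.size + 1) * (z * S + 1) = 3 * a.size * (z * S + 1) + 3 * (z * S + 1) := by ring
    omega
  | op o a b, h, hS => by
    have h1 := logCost_le ((eval_lt hz hσ (op o a b) h).trans_le
      (Nat.pow_le_pow_right (by norm_num) (Nat.mul_le_mul_left z hS)))
    simp only [small, Bool.and_eq_true] at h
    simp only [size] at hS
    have h2 := cost_add_le hz hσ S a h.1 (by omega)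
    have h3 := cost_add_le hz hσ S b h.2 (by omega)
    simp only [cost, size] at h1 h2 h3 ⊢
    have : 3 * (a.size + b.size + 1) * (z * S + 1)
      = 3 * a.size * (z * S + 1) + 3 * b.size * (z * S + 1) + 3 * (z * S + 1) := by ring
    omega

/-- Upper bound for the cost of a single instruction. -/
def unitCost (z : ℕ) : ℕ := 100000 * z

/-- The factor two lets one unit pay for a store, which evaluates an address and a value, and for
the additional step of a test. -/
theorem cost_le {z : ℕ} (hz : 9 ≤ z) {σ : RamState} (hσ : Bounded z σ) {e : RamExpr}
    (h : e.fits = true) : 2 * (e.cost σ + logCost (e.eval σ)) ≤ unitCost z := by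
  simp only [fits, Bool.and_eq_true, decide_eq_true_eq] at h
  have h1 := cost_add_le hz hσ 100 e h.1 h.2
  have h2 : 3 * e.size * (z * 100 + 1) ≤ 300 * (z * 100 + 1) :=
    Nat.mul_le_mul_right _ (by omega)
  simp only [unitCost]
  omega

end RamExpr

open RamExpr

/-! ### Total correctness with time bounds -/

namespace RamProg

/-- Started in `σ`, the program halts after at most `N` units of time in a configuration with
`z`-digit numbers and with the property `Q`. -/
def Wp (z : ℕ) (p : RamProg) (N : ℕ) (Q : RamState → Prop) (σ : RamState) : Prop :=
  ∃ t τ, p.Exec σ t τ ∧ t ≤ N * unitCost z ∧ Bounded z τ ∧ Q τ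

variable {z : ℕ} {σ : RamState} {Q Q' : RamState → Prop}

theorem Wp.mono {p : RamProg} {N N' : ℕ} (h : Wp z p N Q σ) (hN : N ≤ N')
    (hQ : ∀ τ, Bounded z τ → Q τ → Q' τ) : Wp z p N' Q' σ := by
  obtain ⟨t, τ, h1, h2, h3, h4⟩ := h
  exact ⟨t, τ, h1, h2.trans (Nat.mul_le_mul_right _ hN), h3, hQ τ h3 h4⟩

theorem wp_skip (hz : 9 ≤ z) (hσ : Bounded z σ) (h : Q σ) : Wp z .skip 1 Q σ :=
  ⟨1, σ, .skip σ, by simp only [unitCost]; omega, hσ, h⟩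

theorem wp_assign {i : ℕ} {e : RamExpr} (hz : 9 ≤ z) (hσ : Bounded z σ)
    (he : e.fits = true) {v : ℕ} (hv : e.eval σ = v) (hlt : v < 2 ^ z) (h : Q (σ.set i v)) :
    Wp z (.assign i e) 1 Q σ := by
  subst hv
  refine ⟨_, _, .assign i e σ, ?_, hσ.set i hlt, h⟩
  have := cost_le hz hσ he
  omega

/-- Storing into array number `q`. -/
def st (q : ℕ) (a e : RamExpr) : RamProg := .store (8 * (a + .reg 1) + .const q) e

theorem wp_st {q : ℕ} {a e : RamExpr} (hz : 9 ≤ z) (hσ : Bounded z σ)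
    (ha : (8 * (a + .reg 1) + .const q : RamExpr).fits = true) (he : e.fits = true)
    {b v : ℕ} (hb : a.eval σ = b) (hv : e.eval σ = v)
    (hlt : v < 2 ^ z) (h : Q (σ.put q b v)) : Wp z (st q a e) 1 Q σ := by
  subst hb hv
  refine ⟨_, _, .store _ e σ, ?_, hσ.put q _ hlt, h⟩
  have h1 := cost_le hz hσ he
  have h2 := cost_le hz hσ ha
  omega

theorem wp_seq {p q : RamProg} {N M : ℕ}
    (h : Wp z p N (fun τ => Bounded z τ → Wp z q M Q τ) σ) : Wp z (.seq p q) (N + M) Q σ := by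
  obtain ⟨t, τ, h1, h2, h3, h4⟩ := h
  obtain ⟨s, υ, h5, h6, h7, h8⟩ := h4 h3
  exact ⟨t + s, υ, .seq h1 h5, by rw [add_mul]; omega, h7, h8⟩

theorem wp_ite {e : RamExpr} {p q : RamProg} {N : ℕ} (hz : 9 ≤ z) (hσ : Bounded z σ)
    (he : e.fits = true) (h1 : e.eval σ ≠ 0 → Wp z p N Q σ) (h0 : e.eval σ = 0 → Wp z q N Q σ) :
    Wp z (.ite e p q) (N + 1) Q σ := by
  have hc := cost_le hz hσ he
  have hl : 1 ≤ logCost (e.eval σ) := by simp [logCost]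
  by_cases h : e.eval σ = 0
  · obtain ⟨t, τ, h1, h2, h3, h4⟩ := h0 h
    exact ⟨_, τ, .ite_false h h1, by rw [add_mul]; omega, h3, h4⟩
  · obtain ⟨t, τ, h1, h2, h3, h4⟩ := h1 h
    exact ⟨_, τ, .ite_true h h1, by rw [add_mul]; omega, h3, h4⟩

/-- `for i < e do p`. -/
def loop (i : ℕ) (e : RamExpr) (p : RamProg) : RamProg :=
  .seq (.assign i 0) (.while (e - .reg i) (.seq p (.assign i (.reg i + 1))))

/-- The invariant `I j` refers to the test before round `j`, when the counter is already set, and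
the body has to preserve the counter. The end value is evaluated anew in each round, hence `heval`.
Two units per round pay for the test and the increment, two more for the initialization and the last
test. -/
theorem wp_loop {i : ℕ} {e : RamExpr} {p : RamProg} (hz : 9 ≤ z) (hσ : Bounded z σ)
    (he : (e - .reg i).fits = true) (M : ℕ) (c : ℕ → ℕ) (I : ℕ → RamState → Prop)
    (hM : M < 2 ^ z) (h0 : I 0 (σ.set i 0))
    (heval : ∀ j ≤ M, ∀ τ, τ.reg i = j → I j τ → e.eval τ = M)
    (hstep : ∀ j < M, ∀ τ, Bounded z τ → τ.reg i = j → I j τ →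
      Wp z p (c j) (fun υ => υ.reg i = j ∧ I (j + 1) (υ.set i (j + 1))) τ)
    (hQ : ∀ τ, Bounded z τ → τ.reg i = M → I M τ → Q τ) :
    Wp z (loop i e p) (∑ j ∈ Finset.range M, (c j + 2) + 2) Q σ := by
  rw [add_comm _ 2, show 2 + ∑ j ∈ Finset.range M, (c j + 2)
    = 1 + (1 + ∑ j ∈ Finset.range M, (c j + 2)) by ring]
  refine wp_seq (wp_assign hz hσ rfl (v := 0) rfl (by positivity) fun hσ' => ?_)
  -- Induction on the number `d` of rounds that remain.
  have key : ∀ d j, j + d = M → ∀ τ, Bounded z τ → τ.reg i = j → I j τ →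
      Wp z (.while (e - .reg i) (.seq p (.assign i (.reg i + 1))))
        (1 + ∑ j ∈ Finset.Ico j M, (c j + 2)) Q τ := by
    intro d
    induction d with
    | zero =>
      intro j hj τ hτ hi hI
      obtain rfl : j = M := by omega
      have h0 : (e - .reg i : RamExpr).eval τ = 0 := by simp [heval j le_rfl τ hi hI, hi]
      refine ⟨_, τ, .while_false h0, ?_, hτ, hQ τ hτ hi hI⟩
      have := cost_le hz hτ he
      have hl : 1 ≤ logCost ((e - .reg i : RamExpr).eval τ) := by simp [logCost]
      simp only [Finset.Ico_self, Finset.sum_empty]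
      omega
    | succ d ih =>
      intro j hj τ hτ hi hI
      have h0 : (e - .reg i : RamExpr).eval τ ≠ 0 := by
        simp [heval j (by omega) τ hi hI, hi]; omega
      obtain ⟨t, υ, h1, h2, h3, h4, h5⟩ := hstep j (by omega) τ hτ hi hI
      have hfit : (.reg i + 1 : RamExpr).fits = true := rfl
      have hb : (.reg i + 1 : RamExpr).eval υ = j + 1 := by simp [h4]
      have h3' : Bounded z (υ.set i (j + 1)) := h3.set i (by omega)
      obtain ⟨s, ω, g1, g2, g3, g4⟩ := ih (j + 1) (by omega) _ h3' (by simp) h5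
      have hx := Exec.assign i (.reg i + 1) υ
      have hxc := cost_le hz h3 hfit
      rw [hb] at hx hxc
      refine ⟨_, ω, .while_true h0 (.seq h1 hx) g1, ?_, g3, g4⟩
      have hc := cost_le hz hτ he
      have hl : 1 ≤ logCost ((e - .reg i : RamExpr).eval τ) := by simp [logCost]
      rw [Finset.sum_eq_sum_Ico_succ_bot (by omega)]
      have : (1 + (c j + 2 + ∑ j ∈ Finset.Ico (j + 1) M, (c j + 2))) * unitCost z
        = (1 + ∑ j ∈ Finset.Ico (j + 1) M, (c j + 2)) * unitCost z + c j * unitCost z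
          + 2 * unitCost z := by ring
      rw [this]
      omega
  have := key M 0 (by omega) _ hσ' (by simp) h0
  simpa using this

theorem wp_loop_const {i : ℕ} {e : RamExpr} {p : RamProg} (hz : 9 ≤ z) (hσ : Bounded z σ)
    (he : (e - .reg i).fits = true) (M c : ℕ) {N : ℕ} (I : ℕ → RamState → Prop)
    (hM : M < 2 ^ z) (hN : M * (c + 2) + 2 ≤ N) (h0 : I 0 (σ.set i 0))
    (heval : ∀ j ≤ M, ∀ τ, τ.reg i = j → I j τ → e.eval τ = M)
    (hstep : ∀ j < M, ∀ τ, Bounded z τ → τ.reg i = j → I j τ →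
      Wp z p c (fun υ => υ.reg i = j ∧ I (j + 1) (υ.set i (j + 1))) τ)
    (hQ : ∀ τ, Bounded z τ → τ.reg i = M → I M τ → Q τ) :
    Wp z (loop i e p) N Q σ :=
  (wp_loop hz hσ he M (fun _ => c) I hM h0 heval hstep hQ).mono (by simpa using hN)
    fun _ _ h => h

/-- Determinism transfers what is proved about one constructed run to every halting run. -/
theorem Exec.det {p : RamProg} {σ τ : RamState} {t : ℕ} (h : p.Exec σ t τ) :
    ∀ {t' : ℕ} {τ' : RamState}, p.Exec σ t' τ' → t = t' ∧ τ = τ' := by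
  induction h with
  | skip σ => intro _ _ h'; cases h'; exact ⟨rfl, rfl⟩
  | assign i e σ => intro _ _ h'; cases h'; exact ⟨rfl, rfl⟩
  | store a e σ => intro _ _ h'; cases h'; exact ⟨rfl, rfl⟩
  | seq _ _ ih1 ih2 =>
    intro _ _ h'
    cases h' with
    | seq g1 g2 =>
      obtain ⟨rfl, rfl⟩ := ih1 g1
      obtain ⟨rfl, rfl⟩ := ih2 g2
      exact ⟨rfl, rfl⟩
  | ite_true h0 _ ih =>
    intro _ _ h'
    cases h' with
    | ite_true g0 g => obtain ⟨rfl, rfl⟩ := ih g; exact ⟨rfl, rfl⟩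
    | ite_false g0 g => exact absurd g0 h0
  | ite_false h0 _ ih =>
    intro _ _ h'
    cases h' with
    | ite_true g0 g => exact absurd h0 g0
    | ite_false g0 g => obtain ⟨rfl, rfl⟩ := ih g; exact ⟨rfl, rfl⟩
  | while_true h0 _ _ ih1 ih2 =>
    intro _ _ h'
    cases h' with
    | while_true g0 g1 g2 =>
      obtain ⟨rfl, rfl⟩ := ih1 g1
      obtain ⟨rfl, rfl⟩ := ih2 g2
      exact ⟨rfl, rfl⟩
    | while_false g0 => exact absurd g0 h0
  | while_false h0 =>
    intro _ _ h'
    cases h' with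
    | while_true g0 g1 g2 => exact absurd h0 g0
    | while_false g0 => exact ⟨rfl, rfl⟩

/-- A loop with empty body halts at once or not at all. -/
theorem Exec.while_skip {e : RamExpr} {σ τ : RamState} {t : ℕ}
    (h : (RamProg.while e .skip).Exec σ t τ) : e.eval σ = 0 ∧ τ = σ := by
  generalize hp : RamProg.while e .skip = p at h
  induction h with
  | while_true h0 h1 _ _ ih2 =>
    cases hp
    cases h1
    exact absurd (ih2 rfl).1 h0
  | while_false h0 => cases hp; exact ⟨h0, rfl⟩
  | _ => cases hp

end RamProg

/-! ### The symplectic form -/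

/-- The symplectic form underlying the trace inner product. -/
def symp {n : ℕ} (e f : Fin n → F4) : ZMod 2 := ∑ i, ((e i).1 * (f i).2 + (e i).2 * (f i).1)

section Symp

variable {n : ℕ} (e e' f f' : Fin n → F4)

theorem traceInner_eq_symp : traceInner e f = (symp e f, 0) := by
  simp only [traceInner, symp, F4.trace_eq]
  ext <;> simp [Prod.fst_sum, Prod.snd_sum]

theorem traceInner_eq_zero_iff : traceInner e f = 0 ↔ symp e f = 0 := by
  rw [traceInner_eq_symp, Prod.ext_iff]; simp

theorem symp_comm : symp e f = symp f e :=
  Finset.sum_congr rfl fun i _ => by ring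

theorem symp_add_left : symp (e + e') f = symp e f + symp e' f := by
  simp only [symp, Pi.add_apply, Prod.fst_add, Prod.snd_add, ← Finset.sum_add_distrib]
  exact Finset.sum_congr rfl fun i _ => by ring

theorem symp_add_right : symp e (f + f') = symp e f + symp e f' := by
  rw [symp_comm, symp_add_left, symp_comm f, symp_comm f']

@[simp] theorem symp_zero_left : symp 0 f = 0 := by simp [symp]

@[simp] theorem symp_zero_right : symp e 0 = 0 := by simp [symp]

@[simp] theorem symp_self : symp e e = 0 := by
  refine Finset.sum_eq_zero fun i _ => ?_
  rw [mul_comm]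
  exact CharTwo.add_self_eq_zero _

theorem symp_smul_left (c : ZMod 2) : symp (c • e) f = c * symp e f := by
  simp only [symp, Finset.mul_sum, Pi.smul_apply, Prod.smul_fst, Prod.smul_snd, smul_eq_mul]
  exact Finset.sum_congr rfl fun i _ => by ring

theorem symp_single_fst (i : Fin n) : symp (Pi.single i (1, 0)) f = (f i).2 := by
  rw [symp, Finset.sum_eq_single i] <;> simp +contextual

theorem symp_single_snd (i : Fin n) : symp (Pi.single i (0, 1)) f = (f i).1 := by
  rw [symp, Finset.sum_eq_single i] <;> simp +contextual

end Symp

theorem ZMod.two_cases (x : ZMod 2) : x = 0 ∨ x = 1 := by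
  revert x; decide

theorem ZMod.eq_one_of_ne_zero {x : ZMod 2} (h : x ≠ 0) : x = 1 :=
  (ZMod.two_cases x).resolve_left h

/-! ### Vectors packed into integers -/

/-- The radix of the packed representation. -/
def radix (n : ℕ) : ℕ := 256 ^ (n + 1)

theorem radix_pos (n : ℕ) : 0 < radix n := by simp [radix]

theorem radix_even (n : ℕ) : 2 ∣ radix n := by
  rw [radix, pow_succ]; exact Dvd.dvd.mul_left (by norm_num) _

/-- The lower digits sum to less than `B ^ s`, and the higher ones contribute a multiple of `B ^ (s
+ 1)`, which is even after division by `B ^ s`. -/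
theorem digit_parity {B : ℕ} (hB : 2 ∣ B) (hB0 : 0 < B) {N : ℕ} (c : ℕ → ℕ)
    (hc : ∀ l < N, c l < B) {s : ℕ} (hs : s < N) :
    (∑ l ∈ Finset.range N, c l * B ^ l) / B ^ s % 2 = c s % 2 := by
  have low : ∀ t ≤ N, ∑ l ∈ Finset.range t, c l * B ^ l < B ^ t := by
    intro t
    induction t with
    | zero => simp
    | succ t ih =>
      intro ht
      rw [Finset.sum_range_succ, pow_succ]
      have h1 := ih (by omega)
      have h2 : (c t + 1) * B ^ t ≤ B * B ^ t := Nat.mul_le_mul_right _ (hc t (by omega))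
      rw [mul_comm (B ^ t) B]
      linarith
  obtain ⟨d, rfl⟩ : ∃ d, N = s + 1 + d := ⟨N - (s + 1), by omega⟩
  rw [Finset.sum_range_add, Finset.sum_range_succ]
  have h1 := low s (by omega)
  have h2 : ∑ x ∈ Finset.range d, c (s + 1 + x) * B ^ (s + 1 + x)
      = B ^ s * (B * ∑ x ∈ Finset.range d, c (s + 1 + x) * B ^ x) := by
    rw [Finset.mul_sum, Finset.mul_sum]
    exact Finset.sum_congr rfl fun x _ => by ring
  rw [h2, mul_comm (c s), add_assoc, ← mul_add, Nat.add_mul_div_left _ _ (by positivity),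
    Nat.div_eq_of_lt h1, zero_add]
  obtain ⟨b, rfl⟩ := hB
  rw [mul_assoc 2 b]
  omega

/-- `x` is a packed representation, with digits at most `M`, of the vector `f`. -/
def Packs {n : ℕ} (M x : ℕ) (f : Fin n → F4) : Prop :=
  ∃ ξ : ℕ → ℕ, (∀ l, ξ l ≤ M) ∧ x = ∑ l ∈ Finset.range (2 * n), ξ l * radix n ^ l ∧
    ∀ i : Fin n, f i = ((ξ i : ZMod 2), (ξ (2 * n - 1 - i) : ZMod 2))

namespace Packs

variable {n M M' x y : ℕ} {f g : Fin n → F4}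

theorem mono (h : Packs M x f) (hM : M ≤ M') : Packs M' x f := by
  obtain ⟨ξ, h1, h2⟩ := h
  exact ⟨ξ, fun l => (h1 l).trans hM, h2⟩

theorem zero : Packs (n := n) M 0 0 := ⟨0, by simp, by simp, by simp [Prod.ext_iff]⟩

/-- Digits are added without reduction modulo two; only the bound on the digits grows. -/
theorem add (h : Packs M x f) (h' : Packs M' y g) : Packs (M + M') (x + y) (f + g) := by
  obtain ⟨ξ, h1, h2, h3⟩ := h
  obtain ⟨η, h1', h2', h3'⟩ := h'
  refine ⟨ξ + η, fun l => Nat.add_le_add (h1 l) (h1' l), ?_, fun i => ?_⟩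
  · rw [h2, h2', ← Finset.sum_add_distrib]
    exact Finset.sum_congr rfl fun l _ => by simp [add_mul]
  · simp [h3, h3']

theorem single_fst (i : Fin n) : Packs 1 (radix n ^ (i : ℕ)) (Pi.single i ((1, 0) : F4)) := by
  have hi := i.2
  refine ⟨fun l => if l = i then 1 else 0, fun l => by dsimp only; split_ifs <;> simp, ?_,
    fun j => ?_⟩
  · simp only [ite_mul, one_mul, zero_mul]
    rw [Finset.sum_ite_eq' (Finset.range (2 * n)), if_pos (by simp; omega)]
  · have hj := j.2
    have h2 : ¬ (2 * n - 1 - (j : ℕ) = i) := by omega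
    by_cases h : j = i
    · subst h; simp [h2]
    · have h' : ¬ ((j : ℕ) = i) := fun e => h (Fin.ext e)
      simp [h, h', h2, Prod.ext_iff]

theorem single_snd (i : Fin n) :
    Packs 1 (radix n ^ (2 * n - 1 - (i : ℕ))) (Pi.single i ((0, 1) : F4)) := by
  have hi := i.2
  refine ⟨fun l => if l = 2 * n - 1 - i then 1 else 0,
    fun l => by dsimp only; split_ifs <;> simp, ?_, fun j => ?_⟩
  · simp only [ite_mul, one_mul, zero_mul]
    rw [Finset.sum_ite_eq' (Finset.range (2 * n)), if_pos (by simp; omega)]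
  · have hj := j.2
    have h2 : ¬ ((j : ℕ) = 2 * n - 1 - i) := by omega
    by_cases h : j = i
    · subst h; simp [h2]
    · have h' : ¬ (2 * n - 1 - (j : ℕ) = 2 * n - 1 - i) := by
        intro e; exact h (Fin.ext (by omega))
      simp [h, h', h2, Prod.ext_iff]

theorem lt (h : Packs M x f) (hM : M < radix n) : x < radix n ^ (2 * n) := by
  obtain ⟨ξ, h1, rfl, -⟩ := h
  generalize 2 * n = t
  induction t with
  | zero => simp
  | succ t ih =>
    rw [Finset.sum_range_succ, pow_succ]
    have h2 : (ξ t + 1) * radix n ^ t ≤ radix n * radix n ^ t :=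
      Nat.mul_le_mul_right _ ((h1 t).trans_lt hM)
    rw [mul_comm (radix n ^ t)]
    linarith

theorem digit (h : Packs M x f) (hM : M < radix n) (i : Fin n) :
    x / radix n ^ (i : ℕ) % 2 = (f i).1.val ∧
      x / radix n ^ (2 * n - 1 - (i : ℕ)) % 2 = (f i).2.val := by
  obtain ⟨ξ, h1, rfl, h3⟩ := h
  have hi := i.2
  rw [h3]
  simp only [ZMod.val_natCast]
  exact ⟨digit_parity (radix_even n) (radix_pos n) ξ (fun l _ => (h1 l).trans_lt hM) (by omega),
    digit_parity (radix_even n) (radix_pos n) ξ (fun l _ => (h1 l).trans_lt hM) (by omega)⟩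

/-- Since the second coordinates stand in reverse order, digit `2n - 1` of the product is the
convolution `∑ ξ l * η (2n - 1 - l)`, and this is the symplectic product modulo two. The hypothesis
`hM` excludes carries. -/
theorem symp (h : Packs M x f) (h' : Packs M' y g) (hM : 2 * n * (M * M') < radix n) (hn : 1 ≤ n) :
    x * y / radix n ^ (2 * n - 1) % 2 = (symp f g).val := by
  obtain ⟨ξ, h1, rfl, h3⟩ := h
  obtain ⟨η, h1', rfl, h3'⟩ := h'
  set N := 2 * n with hN
  -- The coefficients of the product of the two digit polynomials.
  let c : ℕ → ℕ := fun t => ∑ l ∈ Finset.range N, ∑ l' ∈ Finset.range N,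
    if t = l + l' then ξ l * η l' else 0
  have hprod : (∑ l ∈ Finset.range N, ξ l * radix n ^ l) *
      (∑ l ∈ Finset.range N, η l * radix n ^ l) = ∑ t ∈ Finset.range (2 * N), c t * radix n ^ t := by
    rw [Finset.sum_mul_sum]
    simp only [c, Finset.sum_mul]
    rw [Finset.sum_comm (s := Finset.range (2 * N))]
    refine Finset.sum_congr rfl fun l hl => ?_
    rw [Finset.sum_comm (s := Finset.range (2 * N))]
    refine Finset.sum_congr rfl fun l' hl' => ?_
    simp only [Finset.mem_range] at hl hl'
    simp only [ite_mul, zero_mul]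
    rw [Finset.sum_ite_eq' (Finset.range (2 * N)), if_pos (by simp; omega), pow_add]
    ring
  have hc : ∀ t < 2 * N, c t < radix n := by
    intro t _
    refine lt_of_le_of_lt ?_ hM
    calc c t ≤ ∑ l ∈ Finset.range N, M * M' := ?_
      _ = _ := by simp
    refine Finset.sum_le_sum fun l _ => ?_
    -- For given `t` and `l`, only the index `l' = t - l` can contribute.
    calc _ ≤ ∑ l' ∈ Finset.range N, if l' = t - l then M * M' else 0 := ?_
      _ ≤ M * M' := by rw [Finset.sum_ite_eq']; split_ifs <;> simp
    refine Finset.sum_le_sum fun l' _ => ?_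
    split_ifs with e1 e2
    · exact Nat.mul_le_mul (h1 _) (h1' _)
    · omega
    · simp
    · simp
  rw [hprod, digit_parity (radix_even n) (radix_pos n) c hc (by omega), ← ZMod.val_natCast]
  congr 1
  have hcs : c (N - 1) = ∑ l ∈ Finset.range N, ξ l * η (N - 1 - l) := by
    refine Finset.sum_congr rfl fun l hl => ?_
    simp only [Finset.mem_range] at hl
    rw [Finset.sum_eq_single (N - 1 - l)]
    · rw [if_pos (by omega)]
    · intro b _ hb; rw [if_neg (by omega)]
    · intro hb; simp only [Finset.mem_range] at hb; omega
  -- Reflection turns the upper half of the convolution into products of second coordinates of `f`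
  -- with first coordinates of `g`.
  have hre : ∑ x ∈ Finset.range n, ξ (n + x) * η (n + n - 1 - (n + x))
      = ∑ x ∈ Finset.range n, ξ (n + n - 1 - x) * η x := by
    rw [← Finset.sum_range_reflect]
    refine Finset.sum_congr rfl fun x hx => ?_
    simp only [Finset.mem_range] at hx
    congr 2 <;> omega
  rw [hcs, hN, two_mul, Finset.sum_range_add, hre, ← Finset.sum_add_distrib, Nat.cast_sum,
    _root_.symp, Finset.sum_range]
  refine Finset.sum_congr rfl fun i _ => ?_
  rw [h3, h3', hN, two_mul]
  push_cast
  ring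

end Packs

open RamState RamExpr RamProg

namespace RamProg

variable {z : ℕ} {σ : RamState} {Q : RamState → Prop}

theorem wp_skip_add {N : ℕ} (hz : 9 ≤ z) (hσ : Bounded z σ) (h : Q σ) : Wp z .skip (N + 1) Q σ :=
  (wp_skip hz hσ h).mono (by omega) fun _ _ h => h

theorem wp_assign_add {N i : ℕ} {e : RamExpr} (hz : 9 ≤ z) (hσ : Bounded z σ)
    (he : e.fits = true) (v : ℕ) (hv : e.eval σ = v) (hlt : v < 2 ^ z) (h : Q (σ.set i v)) :
    Wp z (.assign i e) (N + 1) Q σ :=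
  (wp_assign hz hσ he hv hlt h).mono (by omega) fun _ _ h => h

theorem wp_st_add {N q : ℕ} {a e : RamExpr} (hz : 9 ≤ z) (hσ : Bounded z σ)
    (ha : (8 * (a + .reg 1) + .const q : RamExpr).fits = true) (he : e.fits = true)
    (b v : ℕ) (hb : a.eval σ = b) (hv : e.eval σ = v)
    (hlt : v < 2 ^ z) (h : Q (σ.put q b v)) : Wp z (st q a e) (N + 1) Q σ :=
  (wp_st hz hσ ha he hb hv hlt h).mono (by omega) fun _ _ h => h

theorem wp_assign_seq {N i : ℕ} {e : RamExpr} {p : RamProg} (hz : 9 ≤ z) (hσ : Bounded z σ)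
    (he : e.fits = true) (v : ℕ) (hv : e.eval σ = v) (hlt : v < 2 ^ z)
    (h : Bounded z (σ.set i v) → Wp z p N Q (σ.set i v)) :
    Wp z (.seq (.assign i e) p) (N + 1) Q σ := by
  rw [add_comm]
  exact wp_seq (wp_assign hz hσ he hv hlt h)

theorem wp_st_seq {N q : ℕ} {a e : RamExpr} {p : RamProg} (hz : 9 ≤ z) (hσ : Bounded z σ)
    (ha : (8 * (a + .reg 1) + .const q : RamExpr).fits = true) (he : e.fits = true)
    (b v : ℕ) (hb : a.eval σ = b) (hv : e.eval σ = v) (hlt : v < 2 ^ z)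
    (h : Bounded z (σ.put q b v) → Wp z p N Q (σ.put q b v)) :
    Wp z (.seq (st q a e) p) (N + 1) Q σ := by
  rw [add_comm]
  exact wp_seq (wp_st hz hσ ha he hb hv hlt h)

theorem wp_seq_le {p q : RamProg} {T : ℕ} (N M : ℕ) (hT : N + M ≤ T) (R : RamState → Prop)
    (h : Wp z p N R σ) (h' : ∀ τ, Bounded z τ → R τ → Wp z q M Q τ) : Wp z (.seq p q) T Q σ :=
  (wp_seq (h.mono le_rfl fun τ hb hR _ => h' τ hb hR)).mono hT fun _ _ h => h

end RamProg

/-! ### The program -/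

/-- Parity of the symplectic product of two packed vectors. -/
def sympExpr (a b : RamExpr) : RamExpr := (a * b / ld 0 (.reg 6 - 1)).mod 2

/-- Fill array `3` with the packed unit vectors, in the order given by the registers `11`, `12`. -/
def initUnits : RamProg :=
  loop 14 (.reg 2) <|
    .seq (.assign 15 (.reg 11 + .reg 14)) <|
    .seq (.ite (.reg 4 - .reg 14) (.assign 15 (.reg 15 + .reg 12))
      (.ite (.reg 4 + .reg 12 - .reg 14) (.assign 15 (.reg 15 - .reg 4)) .skip)) <|
    .seq (.assign 15 ((reg 15).mod (.reg 2))) <|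
    .seq (st 3 (2 * .reg 14) (ld 0 (.reg 15))) <|
    st 3 (2 * .reg 14 + 1) (ld 0 (.reg 6 - 1 - .reg 15))

/-- Look for a vector with index at least `reg 13` that is not orthogonal to generator `reg 14`. -/
def findPivot : RamProg :=
  .seq (.assign 15 0) <|
  loop 16 (.reg 6 - .reg 13) <|
    .ite (sympExpr (ld 1 (.reg 14)) (ld 3 (.reg 13 + .reg 16)))
      (.assign 15 (ld 3 (.reg 13 + .reg 16))) .skip

/-- Add the pivot to all vectors that are not orthogonal to generator `reg 14`. -/
def addPivot : RamProg :=
  loop 16 (.reg 6) <|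
    .ite (sympExpr (ld 1 (.reg 14)) (ld 3 (.reg 16)))
      (st 3 (.reg 16) (ld 3 (.reg 16) + .reg 15)) .skip

/-- Pivots are taken only from vectors with index at least `reg 13`, which vanish on the window, so
entries in the window never change. -/
def eliminate : RamProg := loop 14 (.reg 3) (.seq findPivot addPivot)

/-- The weight of the vector in register `15`. -/
def weigh : RamProg :=
  .seq (.assign 17 0) <|
  loop 16 (.reg 2) <|
    .ite ((reg 15 / ld 0 (.reg 16)).mod 2 + (reg 15 / ld 0 (.reg 6 - 1 - .reg 16)).mod 2)
      (.assign 17 (.reg 17 + 1)) .skip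

/-! ### Numbers -/

/-- Number of binary digits of all numbers that occur. -/
def digits (n : ℕ) : ℕ := (8 * n + 8) * (2 * n + 2)

theorem two_pow_digits (n : ℕ) : 2 ^ digits n = radix n ^ (2 * n + 2) := by
  have h : radix n = 2 ^ (8 * (n + 1)) := by
    rw [radix, pow_mul]; norm_num
  rw [h, ← pow_mul]
  rfl

theorem nine_le_digits (n : ℕ) : 9 ≤ digits n := by
  rw [digits]; nlinarith

theorem lt_two_pow_digits {n x : ℕ} (h : x < radix n ^ (2 * n + 1)) : x < 2 ^ digits n := by
  rw [two_pow_digits]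
  exact h.trans_le (Nat.pow_le_pow_right (radix_pos n) (by omega))

theorem radix_lt (n : ℕ) : radix n < 2 ^ digits n := by
  rw [two_pow_digits]
  have h1 : 1 < radix n := Nat.one_lt_pow (by omega) (by norm_num)
  calc radix n = radix n ^ 1 := (pow_one _).symm
    _ < _ := Nat.pow_lt_pow_right h1 (by omega)

theorem lt_of_lt_radix {n x : ℕ} (h : x ≤ radix n) : x < 2 ^ digits n := h.trans_lt (radix_lt n)

/-- This fixes the base `256`: digits grow to at most a polynomial times `2 ^ r` in each factor of a
product, and `256 ^ (n + 1)` still exceeds the resulting coefficients. -/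
theorem size_bound {n r : ℕ} (hr : r ≤ n) :
    16 * (n + 1) ^ 2 * (2 ^ r * 2 ^ r) < radix n := by
  have h1 : n + 1 ≤ 2 ^ n := Nat.lt_two_pow_self
  have h2 : 2 ^ r ≤ 2 ^ n := Nat.pow_le_pow_right (by norm_num) hr
  calc 16 * (n + 1) ^ 2 * (2 ^ r * 2 ^ r)
      ≤ 16 * (2 ^ n) ^ 2 * (2 ^ n * 2 ^ n) := by gcongr
    _ = 16 * 16 ^ n := by
      rw [show (16 : ℕ) ^ n = (2 ^ n) ^ 4 by rw [← pow_mul, mul_comm, pow_mul]; norm_num]; ring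
    _ < 256 * 256 ^ n := Nat.mul_lt_mul_of_lt_of_le (by norm_num)
        (Nat.pow_le_pow_left (by norm_num) n) (by positivity)
    _ = radix n := by rw [radix, pow_succ, mul_comm]

theorem size_bound_one {n r i c : ℕ} (hr : r ≤ n) (hi : i ≤ r) (hc : c ≤ 2 ^ r) :
    2 * n * (c * 2 ^ i) < radix n := by
  refine lt_of_le_of_lt (Nat.mul_le_mul ?_
    (Nat.mul_le_mul hc (Nat.pow_le_pow_right (by norm_num) hi))) (size_bound hr)
  nlinarith

theorem lt_radix_of_le {n x : ℕ} (h : x ≤ 16 * (n + 1) ^ 2) : x < radix n := by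
  refine lt_of_le_of_lt h ?_
  simpa using size_bound (Nat.zero_le n)

/-- The part of the memory that is computed once. -/
structure Env {n r : ℕ} (m : ℕ) (g : Fin r → Fin n → F4) (σ : RamState) : Prop where
  reg2 : σ.reg 2 = n
  reg3 : σ.reg 3 = r
  reg4 : σ.reg 4 = m
  reg5 : σ.reg 5 = radix n
  reg6 : σ.reg 6 = 2 * n
  pow : ∀ j ≤ 2 * n, σ.arr 0 j = radix n ^ j
  gen : ∀ i : Fin r, Packs 1 (σ.arr 1 i) (g i)

theorem Env.frame {n r m : ℕ} {g : Fin r → Fin n → F4} {σ τ : RamState} (h : Env m g σ)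
    {rs qs : List ℕ} (hF : Frame rs qs σ τ) (hr : ∀ i ∈ [2, 3, 4, 5, 6], i ∉ rs)
    (hq : ∀ i ∈ [0, 1], i ∉ qs) : Env m g τ := by
  simp only [List.mem_cons, List.not_mem_nil, or_false, forall_eq_or_imp, forall_eq] at hr hq
  exact ⟨(hF.reg 2 hr.1).trans h.reg2, (hF.reg 3 hr.2.1).trans h.reg3,
    (hF.reg 4 hr.2.2.1).trans h.reg4, (hF.reg 5 hr.2.2.2.1).trans h.reg5,
    (hF.reg 6 hr.2.2.2.2).trans h.reg6,
    fun j hj => (hF.arr 0 hq.1 (by norm_num) j).trans (h.pow j hj),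
    fun i => by rw [hF.arr 1 hq.2 (by norm_num)]; exact h.gen i⟩

/-! ### Elimination -/

section Elimination

variable {n r : ℕ}

/-- The unit vector number `l` in the order given by `π`. -/
def unitVec (π : Fin n → Fin n) (l : ℕ) : Fin n → F4 :=
  if h : l / 2 < n then Pi.single (π ⟨l / 2, h⟩) (if l % 2 = 0 then (1, 0) else (0, 1)) else 0

/-- `f` vanishes on the first `a` positions. -/
def Vanishes (π : Fin n → Fin n) (a : ℕ) (f : Fin n → F4) : Prop :=
  ∀ t : Fin n, (t : ℕ) < a → f (π t) = 0

theorem vanishes_unitVec {π : Fin n → Fin n} (hπ : Function.Injective π) {a l : ℕ}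
    (hl : 2 * a ≤ l) : Vanishes π a (unitVec π l) := by
  intro t ht
  unfold unitVec
  by_cases h : l / 2 < n
  · rw [dif_pos h, Pi.single_apply, if_neg]
    intro e
    have := hπ e
    simp only [Fin.ext_iff] at this
    omega
  · rw [dif_neg h]; rfl

/-- A vector that vanishes on the first `a` positions is a sum of unit vectors with indices from
`2a` on. -/
theorem hom_eq_zero_of_unitVec {A : Type*} [AddCommMonoid A] {π : Fin n → Fin n}
    (hπ : Function.Bijective π) {a : ℕ} (P : (Fin n → F4) →+ A) (hP : ∀ l, 2 * a ≤ l → l < 2 * n → P (unitVec π l) = 0)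
    {f : Fin n → F4} (hf : Vanishes π a f) : P f = 0 := by
  rw [← Finset.univ_sum_single f, map_sum]
  refine Finset.sum_eq_zero fun i _ => ?_
  obtain ⟨t, rfl⟩ := hπ.2 i
  by_cases ht : (t : ℕ) < a
  · rw [hf t ht]; simp
  have h1 : P (Pi.single (π t) ((1, 0) : F4)) = 0 := by
    have := hP (2 * t) (by omega) (by omega)
    simpa [unitVec] using this
  have h2 : P (Pi.single (π t) ((0, 1) : F4)) = 0 := by
    have := hP (2 * t + 1) (by omega) (by omega)
    have h3 : (2 * (t : ℕ) + 1) / 2 = t := by omega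
    simpa [unitVec, h3, Nat.add_mod] using this
  obtain ⟨u, v⟩ := f (π t)
  have hz : ((0, 0) : F4) = 0 := rfl
  have hs : ((1, 1) : F4) = (1, 0) + (0, 1) := rfl
  rcases ZMod.two_cases u with rfl | rfl <;> rcases ZMod.two_cases v with rfl | rfl
  · rw [hz]; simp
  · exact h2
  · exact h1
  · rw [hs, Pi.single_add, map_add, h1, h2, add_zero]

/-- The effect of the elimination with the first `i` generators on the positions from `a` on. -/
structure IsReduction (g : Fin r → Fin n → F4) (π : Fin n → Fin n) (a i : ℕ)
    (Φ : (Fin n → F4) →+ (Fin n → F4)) : Prop where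
  fixes : ∀ f, (∀ j, symp (g j) f = 0) → Φ f = f
  keeps : ∀ f, ∀ t : Fin n, (t : ℕ) < a → Φ f (π t) = f (π t)
  orth : ∀ j : Fin r, (j : ℕ) < i → ∀ f, Vanishes π a f → symp (g j) (Φ f) = 0

/-- `z ↦ z + ⟨g, z⟩ p` -/
def transvect (g p : Fin n → F4) : (Fin n → F4) →+ (Fin n → F4) where
  toFun z := z + symp g z • p
  map_zero' := by simp
  map_add' x y := by rw [symp_add_right, add_smul]; abel

theorem transvect_apply (g p z : Fin n → F4) : transvect g p z = z + symp g z • p := rfl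

/-- The functional `f ↦ ⟨g, Φ f⟩`. -/
def sympHom (g : Fin n → F4) (Φ : (Fin n → F4) →+ (Fin n → F4)) : (Fin n → F4) →+ ZMod 2 where
  toFun z := symp g (Φ z)
  map_zero' := by simp
  map_add' x y := by rw [map_add, symp_add_right]

theorem isReduction_id (g : Fin r → Fin n → F4) (π : Fin n → Fin n) (a : ℕ) :
    IsReduction g π a 0 (AddMonoidHom.id _) :=
  ⟨fun _ _ => rfl, fun _ _ _ => rfl, fun _ h => absurd h (Nat.not_lt_zero _)⟩

theorem symp_smul_right (c : ZMod 2) (e f : Fin n → F4) : symp e (c • f) = c * symp e f := by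
  rw [symp_comm, symp_smul_left, symp_comm]

/-- Where the product with `g i` is one, adding `p` with `⟨g i, p⟩ = 1` cancels it in characteristic
two. Earlier generators do not notice since `p` is orthogonal to them, and the first `a` positions
are untouched since `p` vanishes there. If the product with `g i` already vanishes on all relevant
vectors, no pivot is needed. -/
theorem IsReduction.step {g : Fin r → Fin n → F4} {π : Fin n → Fin n} {a : ℕ} {i : Fin r}
    {Φ : (Fin n → F4) →+ (Fin n → F4)} (h : IsReduction g π a i Φ) {p : Fin n → F4}
    (hp : Vanishes π a p) (horth : ∀ j : Fin r, (j : ℕ) < i → symp (g j) p = 0)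
    (hpiv : symp (g i) p = 1 ∨ ∀ f, Vanishes π a f → symp (g i) (Φ f) = 0) :
    IsReduction g π a (i + 1) ((transvect (g i) p).comp Φ) := by
  refine ⟨fun f hf => ?_, fun f t ht => ?_, fun j hj f hf => ?_⟩
  · simp [transvect_apply, h.fixes f hf, hf i]
  · simp [transvect_apply, h.keeps f t ht, hp t ht]
  · simp only [AddMonoidHom.coe_comp, Function.comp_apply, transvect_apply, symp_add_right,
      symp_smul_right]
    rcases Nat.lt_succ_iff_lt_or_eq.1 hj with hj | hj
    · rw [h.orth j hj f hf, horth j hj]; simp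
    · obtain rfl : j = i := Fin.ext hj
      rcases hpiv with h1 | h1
      · rw [h1, mul_one]; exact CharTwo.add_self_eq_zero _
      · rw [h1 f hf]; simp

end Elimination

/-! ### Verification of the elimination and of the weight computation -/

section Procedures

variable {n r m : ℕ} {g : Fin r → Fin n → F4}

theorem eval_sympExpr {σ : RamState} (hσ : Env m g σ) (hn : 1 ≤ n) {a b : RamExpr} {M M' : ℕ}
    {e f : Fin n → F4} (ha : Packs M (a.eval σ) e) (hb : Packs M' (b.eval σ) f)
    (hM : 2 * n * (M * M') < radix n) : (sympExpr a b).eval σ = (symp e f).val := by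
  simp only [sympExpr, eval_mod, eval_div, eval_mul, eval_ld, eval_sub, eval_reg, eval_one, eval_two, hσ.reg6]
  rw [hσ.pow _ (by omega)]
  exact ha.symp hb hM hn

theorem two_pow_lt_radix {i : ℕ} (h : i ≤ n) : 2 ^ i < radix n := by
  have h1 := size_bound h
  have h2 : 1 ≤ 2 ^ i := Nat.one_le_two_pow
  refine lt_of_le_of_lt ?_ h1
  calc 2 ^ i = 1 * (1 * 2 ^ i) := by ring
    _ ≤ _ := Nat.mul_le_mul (by nlinarith) (Nat.mul_le_mul_right _ h2)

theorem Packs.lt_digits {M x : ℕ} {f : Fin n → F4} (h : Packs M x f) (hM : M < radix n) :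
    x < 2 ^ digits n :=
  lt_two_pow_digits ((h.lt hM).trans_le (Nat.pow_le_pow_right (radix_pos n) (by omega)))

/-- The scan does not stop at a pivot but keeps the last one found. The value zero of register `15`
stands for the zero vector, whose transvection does nothing. -/
theorem wp_findPivot (hn : 1 ≤ n) (hr : r ≤ n) {π : Fin n → Fin n} (hπ : Function.Bijective π)
    {a : ℕ} (ha : a ≤ n) (i : Fin r) {Φ : (Fin n → F4) →+ (Fin n → F4)} {σ : RamState}
    (hb : Bounded (digits n) σ) (hσ : Env m g σ) (h13 : σ.reg 13 = 2 * a) (h14 : σ.reg 14 = i)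
    (hX : ∀ l < 2 * n, Packs (2 ^ (i : ℕ)) (σ.arr 3 l) (Φ (unitVec π l)))
    (hΦ : IsReduction g π a i Φ) :
    Wp (digits n) findPivot (8 * n + 8) (fun τ => Frame [15, 16] [] σ τ ∧
      ∃ p, Packs (2 ^ (i : ℕ)) (τ.reg 15) p ∧
        IsReduction g π a (i + 1) ((transvect (g i) p).comp Φ)) σ := by
  have hz := nine_le_digits n
  have hsz : 2 * n * (1 * 2 ^ (i : ℕ)) < radix n :=
    size_bound_one hr i.2.le Nat.one_le_two_pow
  have hact : ∀ l, 2 * a ≤ l → Vanishes π a (Φ (unitVec π l)) := fun l hl t ht => by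
    rw [hΦ.keeps _ t ht, vanishes_unitVec hπ.1 hl t ht]
  refine wp_assign_seq hz hb rfl 0 rfl (by positivity) fun hb' => ?_
  refine wp_loop_const hz hb' rfl (2 * n - 2 * a) 2 (fun j τ => Frame [15, 16] [] σ τ ∧
    ((τ.reg 15 = 0 ∧ ∀ l, 2 * a ≤ l → l < 2 * a + j → symp (g i) (Φ (unitVec π l)) = 0) ∨
     ∃ l, 2 * a ≤ l ∧ Packs (2 ^ (i : ℕ)) (τ.reg 15) (Φ (unitVec π l)) ∧
        symp (g i) (Φ (unitVec π l)) = 1)) (lt_of_lt_radix ?_) (by omega) ⟨?_, ?_⟩ ?_ ?_ ?_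
  · exact (lt_radix_of_le ((Nat.sub_le _ _).trans (by nlinarith))).le
  · exact ((Frame.refl _ _ _).set (by decide) (by decide) _).set (by decide) (by decide) _
  · left; simp; intros; omega
  · rintro j hj τ - ⟨hF, -⟩
    simp [hF.reg 6 (by decide), hF.reg 13 (by decide), h13, hσ.reg6]
  · rintro j hj τ hbτ h16 ⟨hF, hI⟩
    have hE := hσ.frame hF (by decide) (by decide)
    have e13 : τ.reg 13 = 2 * a := by rw [hF.reg 13 (by decide), h13]
    have e14 : τ.reg 14 = i := by rw [hF.reg 14 (by decide), h14]
    have hx : Packs (2 ^ (i : ℕ)) (τ.arr 3 (2 * a + j)) (Φ (unitVec π (2 * a + j))) := by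
      rw [hF.arr 3 (by decide) (by decide)]; exact hX _ (by omega)
    have hs := eval_sympExpr hE hn (a := ld 1 (.reg 14)) (b := ld 3 (.reg 13 + .reg 16))
      (by simpa [e14] using hE.gen i) (by simpa [e13, h16] using hx) hsz
    refine wp_ite hz hbτ rfl (fun h0 => ?_) (fun h0 => ?_)
    · rw [hs] at h0
      have h1 : symp (g i) (Φ (unitVec π (2 * a + j))) = 1 :=
        ZMod.eq_one_of_ne_zero fun h => h0 (by rw [h]; rfl)
      refine wp_assign_add hz hbτ rfl (τ.arr 3 (2 * a + j)) (by simp [e13, h16]) (hbτ.arr _ _)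
        ⟨by simp [h16], ?_, ?_⟩
      · exact (hF.set (by decide) (by decide) _).set (by decide) (by decide) _
      · right; exact ⟨2 * a + j, by omega, by simpa using hx, h1⟩
    · rw [hs, ZMod.val_eq_zero] at h0
      refine wp_skip_add hz hbτ ⟨h16, hF.set (by decide) (by decide) _, ?_⟩
      rcases hI with ⟨h1, h2⟩ | h1
      · left
        refine ⟨by simpa using h1, fun l hl hl' => ?_⟩
        rcases Nat.lt_succ_iff_lt_or_eq.1 (show l < (2 * a + j) + 1 by omega) with h | rfl
        exacts [h2 l hl h, h0]
      · right; simpa using h1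
  · rintro τ hbτ - ⟨hF, hI⟩
    refine ⟨hF, ?_⟩
    rcases hI with ⟨h1, h2⟩ | ⟨l, h1, h2, h3⟩
    -- Without a pivot the functional `⟨g i, Φ ·⟩` vanishes on all unit vectors beyond position `a`,
    -- hence on everything that vanishes before it.
    · refine ⟨0, by rw [h1]; exact Packs.zero, hΦ.step (fun _ _ => rfl) (by simp) (Or.inr ?_)⟩
      exact fun f hf => hom_eq_zero_of_unitVec hπ (sympHom (g i) Φ)
        (fun l hl hl' => h2 l hl (by omega)) hf
    · exact ⟨_, h2, hΦ.step (hact l h1)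
        (fun j hj => hΦ.orth j hj _ (vanishes_unitVec hπ.1 h1)) (Or.inl h3)⟩

theorem wp_addPivot (hn : 1 ≤ n) (hr : r ≤ n) (π : Fin n → Fin n) (i : Fin r)
    (Φ : (Fin n → F4) →+ (Fin n → F4)) (p : Fin n → F4) {σ : RamState}
    (hb : Bounded (digits n) σ) (hσ : Env m g σ) (h14 : σ.reg 14 = i)
    (hX : ∀ l < 2 * n, Packs (2 ^ (i : ℕ)) (σ.arr 3 l) (Φ (unitVec π l)))
    (hp : Packs (2 ^ (i : ℕ)) (σ.reg 15) p) :
    Wp (digits n) addPivot (8 * n + 8) (fun τ => Frame [16] [3] σ τ ∧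
      ∀ l < 2 * n, Packs (2 ^ ((i : ℕ) + 1)) (τ.arr 3 l)
        ((transvect (g i) p).comp Φ (unitVec π l))) σ := by
  have hz := nine_le_digits n
  have hsz : 2 * n * (1 * 2 ^ (i : ℕ)) < radix n :=
    size_bound_one hr i.2.le Nat.one_le_two_pow
  refine wp_loop_const hz hb rfl (2 * n) 2 (fun j τ => Frame [16] [3] σ τ ∧
    ∀ l < 2 * n, if l < j then Packs (2 ^ ((i : ℕ) + 1)) (τ.arr 3 l)
        ((transvect (g i) p).comp Φ (unitVec π l)) else τ.arr 3 l = σ.arr 3 l)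
    (lt_of_lt_radix ?_) (by omega) ⟨?_, ?_⟩ ?_ ?_ ?_
  · exact (lt_radix_of_le (by nlinarith)).le
  · exact (Frame.refl _ _ _).set (by decide) (by decide) _
  · intro l _; simp [arr_set]
  · rintro j hj τ - ⟨hF, -⟩
    simp [hF.reg 6 (by decide), hσ.reg6]
  · rintro j hj τ hbτ h16 ⟨hF, hI⟩
    have hE := hσ.frame hF (by decide) (by decide)
    have e14 : τ.reg 14 = i := by rw [hF.reg 14 (by decide), h14]
    have e15 : τ.reg 15 = σ.reg 15 := hF.reg 15 (by decide)
    have hxe : τ.arr 3 j = σ.arr 3 j := by simpa using hI j hj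
    have hx := hX j hj
    rw [← hxe] at hx
    have hs := eval_sympExpr hE hn (a := ld 1 (.reg 14)) (b := ld 3 (.reg 16))
      (by simpa [e14] using hE.gen i) (by simpa [h16] using hx) hsz
    refine wp_ite hz hbτ rfl (fun h0 => ?_) (fun h0 => ?_)
    · rw [hs] at h0
      have h1 : symp (g i) (Φ (unitVec π j)) = 1 :=
        ZMod.eq_one_of_ne_zero fun h => h0 (by rw [h]; rfl)
      -- One pivot addition at most doubles the digit bound, from `2 ^ i` to `2 ^ (i + 1)`.
      have hsum := hx.add hp
      rw [← two_mul, ← pow_succ'] at hsum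
      refine wp_st_add hz hbτ rfl rfl j (τ.arr 3 j + σ.reg 15) (by simp [h16])
        (by simp [h16, e15]) (hsum.lt_digits (two_pow_lt_radix (by have := i.2; omega)))
        ⟨by simp [h16], ?_, fun l hl => ?_⟩
      · exact (hF.put (by decide) (by decide) _ _).set (by decide) (by decide) _
      · rw [arr_set _ (by decide), arr_put _ (by decide) (by decide)]
        by_cases hlj : l = j
        · subst hlj
          simpa [transvect_apply, h1] using hsum
        · have := hI l hl
          have h3 : l < j + 1 ↔ l < j := by omega
          simpa [hlj, h3] using this
    · rw [hs, ZMod.val_eq_zero] at h0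
      refine wp_skip_add hz hbτ ⟨h16, hF.set (by decide) (by decide) _, fun l hl => ?_⟩
      rw [arr_set _ (by decide)]
      by_cases hlj : l = j
      · subst hlj
        have := hx.mono (Nat.pow_le_pow_right (n := 2) (by norm_num) (Nat.le_succ i))
        simpa [transvect_apply, h0] using this
      · have := hI l hl
        have h3 : l < j + 1 ↔ l < j := by omega
        simpa [h3] using this
  · rintro τ hbτ - ⟨hF, hI⟩
    exact ⟨hF, fun l hl => by simpa [hl] using hI l hl⟩

theorem wp_eliminate (hn : 1 ≤ n) (hr : r ≤ n) {π : Fin n → Fin n} (hπ : Function.Bijective π)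
    {a : ℕ} (ha : a ≤ n) {σ : RamState}
    (hb : Bounded (digits n) σ) (hσ : Env m g σ) (h13 : σ.reg 13 = 2 * a)
    (hX : ∀ l < 2 * n, Packs 1 (σ.arr 3 l) (unitVec π l)) :
    Wp (digits n) eliminate (n * (16 * n + 18) + 2) (fun τ => Frame [14, 15, 16] [3] σ τ ∧
      ∃ Φ, IsReduction g π a r Φ ∧
        ∀ l < 2 * n, Packs (2 ^ r) (τ.arr 3 l) (Φ (unitVec π l))) σ := by
  have hz := nine_le_digits n
  refine wp_loop_const hz hb rfl r (16 * n + 16) (fun j τ => Frame [14, 15, 16] [3] σ τ ∧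
    ∃ Φ, IsReduction g π a j Φ ∧ ∀ l < 2 * n, Packs (2 ^ j) (τ.arr 3 l) (Φ (unitVec π l)))
    (lt_of_lt_radix ?_) (by gcongr) ⟨?_, ?_⟩ ?_ ?_ ?_
  · exact (lt_radix_of_le (by nlinarith)).le
  · exact (Frame.refl _ _ _).set (by decide) (by decide) _
  · exact ⟨_, isReduction_id _ _ _, fun l hl => by
      rw [arr_set _ (by decide)]; simpa using hX l hl⟩
  · rintro j hj τ - ⟨hF, -⟩
    simp [hF.reg 3 (by decide), hσ.reg3]
  · rintro j hj τ hbτ h14 ⟨hF, Φ, hΦ, hI⟩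
    have hE := hσ.frame hF (by decide) (by decide)
    have e13 : τ.reg 13 = 2 * a := by rw [hF.reg 13 (by decide), h13]
    refine wp_seq_le (8 * n + 8) (8 * n + 8) (by omega) _
      (wp_findPivot hn hr hπ ha ⟨j, hj⟩ hbτ hE e13 h14 hI hΦ) ?_
    rintro υ hbυ ⟨hF', p, hp, hred⟩
    have hE' := hE.frame hF' (by decide) (by decide)
    have e14 : υ.reg 14 = j := by rw [hF'.reg 14 (by decide), h14]
    refine (wp_addPivot hn hr π ⟨j, hj⟩ Φ p hbυ hE' e14 (fun l hl => ?_) hp).mono le_rfl ?_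
    · rw [hF'.arr 3 (by decide) (by decide)]
      exact hI l hl
    · rintro ω hbω ⟨hF'', hX''⟩
      refine ⟨by rw [hF''.reg 14 (by decide), e14], ?_, _, hred, fun l hl => ?_⟩
      · exact ((hF.trans (hF'.mono (by decide) (by decide))).trans
          (hF''.mono (by decide) (by decide))).set (by decide) (by decide) _
      · rw [arr_set _ (by decide)]
        exact hX'' l hl
  · rintro τ hbτ - ⟨hF, hI⟩
    exact ⟨hF, hI⟩

theorem wp_weigh {σ : RamState} (hb : Bounded (digits n) σ) (hσ : Env m g σ) {M : ℕ}
    (hM : M < radix n) {f : Fin n → F4} (hf : Packs M (σ.reg 15) f) :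
    Wp (digits n) weigh (4 * n + 8) (fun τ => Frame [16, 17] [] σ τ ∧
      τ.reg 17 = hammingNorm f) σ := by
  have hz := nine_le_digits n
  refine wp_assign_seq hz hb rfl 0 rfl (by positivity) fun hb' => ?_
  refine wp_loop_const hz hb' rfl n 2 (fun j τ => Frame [16, 17] [] σ τ ∧
    τ.reg 17 = (Finset.univ.filter fun i : Fin n => f i ≠ 0 ∧ (i : ℕ) < j).card)
    (lt_of_lt_radix ?_) (by omega) ⟨?_, ?_⟩ ?_ ?_ ?_
  · exact (lt_radix_of_le (by nlinarith)).le
  · exact ((Frame.refl _ _ _).set (by decide) (by decide) _).set (by decide) (by decide) _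
  · simp
  · rintro j hj τ - ⟨hF, -⟩
    simp [hF.reg 2 (by decide), hσ.reg2]
  · rintro j hj τ hbτ h16 ⟨hF, hI⟩
    have hE := hσ.frame hF (by decide) (by decide)
    have e15 : τ.reg 15 = σ.reg 15 := hF.reg 15 (by decide)
    have hd := hf.digit hM ⟨j, hj⟩
    have hs : ((reg 15 / ld 0 (.reg 16)).mod 2 + (reg 15 / ld 0 (.reg 6 - 1 - .reg 16)).mod 2
        : RamExpr).eval τ = (f ⟨j, hj⟩).1.val + (f ⟨j, hj⟩).2.val := by
      rw [← hd.1, ← hd.2]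
      simp [h16, hE.reg6, e15, hE.pow j (by omega), hE.pow (2 * n - 1 - j) (by omega)]
    have hcard : (Finset.univ.filter fun i : Fin n => f i ≠ 0 ∧ (i : ℕ) < j + 1).card
        = (Finset.univ.filter fun i : Fin n => f i ≠ 0 ∧ (i : ℕ) < j).card
          + if f ⟨j, hj⟩ ≠ 0 then 1 else 0 := by
      split_ifs with h
      · rw [← Finset.card_insert_of_notMem (a := ⟨j, hj⟩) (by simp)]
        congr 1; ext i
        simp only [Finset.mem_filter, Finset.mem_univ, true_and, Finset.mem_insert, Fin.ext_iff]
        constructor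
        · rintro ⟨h1, h2⟩
          by_cases hij : (i : ℕ) = j
          exacts [Or.inl hij, Or.inr ⟨h1, by omega⟩]
        · rintro (hij | ⟨h1, h2⟩)
          · obtain rfl : i = ⟨j, hj⟩ := Fin.ext hij
            exact ⟨h, by simp⟩
          · exact ⟨h1, by omega⟩
      · rw [add_zero]
        congr 1; ext i
        simp only [Finset.mem_filter, Finset.mem_univ, true_and]
        refine and_congr_right fun h1 => ⟨fun h2 => ?_, fun h2 => by omega⟩
        by_contra h3
        obtain rfl : i = ⟨j, hj⟩ := Fin.ext (by simp; omega)
        exact h h1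
    refine wp_ite hz hbτ rfl (fun h0 => ?_) (fun h0 => ?_)
    · rw [hs] at h0
      have h1 : f ⟨j, hj⟩ ≠ 0 := by intro h; rw [h] at h0; exact h0 rfl
      refine wp_assign_add hz hbτ rfl (τ.reg 17 + 1) (by simp) ?_
        ⟨by simp [h16], (hF.set (by decide) (by decide) _).set (by decide) (by decide) _, ?_⟩
      · rw [hI]
        have := (Finset.univ.filter fun i : Fin n => f i ≠ 0 ∧ (i : ℕ) < j).card_le_univ
        simp only [Fintype.card_fin] at this
        exact lt_of_lt_radix (lt_radix_of_le (by nlinarith)).le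
      · rw [hcard, if_pos h1, ← hI]; simp
    · rw [hs] at h0
      have h1 : f ⟨j, hj⟩ = 0 := by
        simp only [Nat.add_eq_zero_iff, ZMod.val_eq_zero] at h0
        exact Prod.ext h0.1 h0.2
      refine wp_skip_add hz hbτ ⟨h16, hF.set (by decide) (by decide) _, ?_⟩
      rw [hcard, if_neg (by simpa using h1), ← hI]; simp
  · rintro τ hbτ - ⟨hF, hI⟩
    refine ⟨hF, hI.trans ?_⟩
    simp [hammingNorm]

/-- The order in which the positions are processed. -/
def position (n m p i t : ℕ) : ℕ :=
  (if t < m then p + t + i else if t < m + i then p + t - m else p + t) % n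

theorem wp_initUnits (hn : 1 ≤ n) (hm : m ≤ n) {π : Fin n → Fin n} {p i : ℕ} (hp : p ≤ n)
    (hi : i ≤ n) (hπ : ∀ t : Fin n, (π t : ℕ) = position n m p i t) {σ : RamState}
    (hb : Bounded (digits n) σ) (hσ : Env m g σ) (h11 : σ.reg 11 = p) (h12 : σ.reg 12 = i) :
    Wp (digits n) initUnits (10 * n + 2) (fun τ => Frame [14, 15] [3] σ τ ∧
      ∀ l < 2 * n, Packs 1 (τ.arr 3 l) (unitVec π l)) σ := by
  have hz := nine_le_digits n
  have hlt : ∀ x ≤ 5 * n, x < 2 ^ digits n := fun x hx =>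
    lt_of_lt_radix (lt_radix_of_le (by nlinarith)).le
  refine wp_loop_const hz hb rfl n 8 (fun j τ => Frame [14, 15] [3] σ τ ∧
    ∀ l < 2 * j, Packs 1 (τ.arr 3 l) (unitVec π l))
    (hlt _ (by omega)) (by omega) ⟨?_, ?_⟩ ?_ ?_ ?_
  · exact (Frame.refl _ _ _).set (by decide) (by decide) _
  · simp
  · rintro j hj τ - ⟨hF, -⟩
    simp [hF.reg 2 (by decide), hσ.reg2]
  · rintro j hj τ hbτ h14 ⟨hF, hI⟩
    have hE := hσ.frame hF (by decide) (by decide)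
    have e11 : τ.reg 11 = p := by rw [hF.reg 11 (by decide), h11]
    have e12 : τ.reg 12 = i := by rw [hF.reg 12 (by decide), h12]
    refine wp_assign_seq hz hbτ rfl (p + j) (by simp [h14, e11]) (hlt _ (by omega)) fun hb1 => ?_
    refine wp_seq_le 3 4 (by omega) (fun υ => υ = τ.set 15 (if j < m then p + j + i else
      if j < m + i then p + j - m else p + j)) ?_ ?_
    · refine wp_ite hz hb1 rfl (fun h0 => ?_) (fun h0 => ?_)
      · have h1 : j < m := by simp [h14, hE.reg4] at h0; omega
        refine wp_assign_add hz hb1 rfl (p + j + i) (by simp [e12]) (hlt _ (by omega)) ?_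
        simp [h1, RamState.set]
      · have h1 : ¬ j < m := by simp [h14, hE.reg4] at h0; omega
        refine wp_ite hz hb1 rfl (fun h0 => ?_) (fun h0 => ?_)
        · have h2 : j < m + i := by simp [h14, hE.reg4, e12] at h0; omega
          refine wp_assign hz hb1 rfl (v := p + j - m) (by simp [hE.reg4]) (hlt _ (by omega)) ?_
          simp [h1, h2, RamState.set]
        · have h2 : ¬ j < m + i := by simp [h14, hE.reg4, e12] at h0; omega
          refine wp_skip hz hb1 ?_
          simp [h1, h2]
    · rintro υ hb2 rfl
      have hpos := hπ ⟨j, hj⟩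
      have hpn := (π ⟨j, hj⟩).2
      refine wp_assign_seq hz hb2 rfl (π ⟨j, hj⟩ : ℕ) (by rw [hpos]; simp [hE.reg2, position])
        (hlt _ (by omega)) fun hb3 => ?_
      have hP1 := Packs.single_fst (π ⟨j, hj⟩)
      have hP2 := Packs.single_snd (π ⟨j, hj⟩)
      have h1r : 1 < radix n := by
        have := two_pow_lt_radix (Nat.zero_le n); simpa using this
      refine wp_st_seq hz hb3 rfl rfl (2 * j) (radix n ^ (π ⟨j, hj⟩ : ℕ)) (by simp [h14])
        (by simp [arr_set, hE.pow (π ⟨j, hj⟩) (by omega)]) (hP1.lt_digits h1r) fun hb4 => ?_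
      refine wp_st_add hz hb4 rfl rfl (2 * j + 1) (radix n ^ (2 * n - 1 - (π ⟨j, hj⟩ : ℕ)))
        (by simp [h14])
        (by simp [arr_set, arr_put, hE.reg6, hE.pow (2 * n - 1 - π ⟨j, hj⟩) (by omega)])
        (hP2.lt_digits h1r) ⟨by simp [h14], ?_, fun l hl => ?_⟩
      · exact (((((hF.set (by decide) (by decide) _).set (by decide) (by decide) _).put
          (by decide) (by decide) _ _).put (by decide) (by decide) _ _).set
          (by decide) (by decide) _)
      · simp only [arr_set _ (show 1 ≠ 14 by decide), arr_set _ (show 1 ≠ 15 by decide),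
          arr_put _ (show 3 < 8 by decide) (show 3 < 8 by decide), true_and]
        by_cases h1 : l = 2 * j + 1
        · have h3 : (2 * j + 1) / 2 = j := by omega
          simpa [h1, unitVec, h3, hj, Nat.add_mod] using hP2
        · by_cases h2 : l = 2 * j
          · simpa [h1, h2, unitVec, hj] using hP1
          · simpa [h1, h2] using hI l (by omega)
  · rintro τ hbτ - ⟨hF, hI⟩
    exact ⟨hF, hI⟩

end Procedures

/-! ### Lists of vectors of low weight -/

section Lists

variable {n : ℕ}

theorem hammingNorm_add_single {a : Fin n → F4} {i : Fin n} {x : F4} (ha : a i = 0)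
    (hx : x ≠ 0) : hammingNorm (a + Pi.single i x) = hammingNorm a + 1 := by
  unfold hammingNorm
  rw [← Finset.card_insert_of_notMem (a := i) (by simp [ha])]
  congr 1; ext j
  by_cases h : j = i
  · subst h; simp [ha, hx]
  · simp [h]

/-- The three nonzero symbols at position `t`. -/
def symbolsAt (π : Fin n → Fin n) (t : ℕ) : List (Fin n → F4) :=
  [unitVec π (2 * t), unitVec π (2 * t + 1), unitVec π (2 * t) + unitVec π (2 * t + 1)]

theorem symbolsAt_eq (π : Fin n → Fin n) (t : Fin n) :
    symbolsAt π t = [((1, 0) : F4), (0, 1), (1, 1)].map (Pi.single (π t)) := by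
  have h3 : (2 * (t : ℕ) + 1) / 2 = t := by omega
  have hs : ((1, 1) : F4) = (1, 0) + (0, 1) := rfl
  simp only [List.map_cons, List.map_nil]
  rw [hs, Pi.single_add]
  simp [symbolsAt, unitVec, h3, Nat.add_mod]

/-- The extensions of `a` by a nonzero symbol at position `t`, of weight at most `v`. -/
def extensions (π : Fin n → Fin n) (v t : ℕ) (a : Fin n → F4) : List (Fin n → F4) :=
  if hammingNorm a < v then (symbolsAt π t).map (a + ·) else []

/-- The vectors of weight at most `v` on the `j` positions from `t₀` on. -/
def lowWeight (π : Fin n → Fin n) (v t₀ : ℕ) : ℕ → List (Fin n → F4)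
  | 0 => [0]
  | j + 1 => lowWeight π v t₀ j ++ (lowWeight π v t₀ j).flatMap (extensions π v (t₀ + j))

/-- Vectors that vanish outside the positions `t₀, …, t₀ + j - 1`. -/
def SupportedOn (π : Fin n → Fin n) (t₀ j : ℕ) (a : Fin n → F4) : Prop :=
  ∀ t : Fin n, ¬ (t₀ ≤ (t : ℕ) ∧ (t : ℕ) < t₀ + j) → a (π t) = 0

theorem mem_extensions {π : Fin n → Fin n} {v t : ℕ} (ht : t < n) {a b : Fin n → F4} :
    b ∈ extensions π v t a ↔
      hammingNorm a < v ∧ ∃ x, x ≠ 0 ∧ b = a + Pi.single (π ⟨t, ht⟩) x := by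
  have hx : ∀ x : F4, x ≠ 0 ↔ x = (1, 0) ∨ x = (0, 1) ∨ x = (1, 1) := by decide
  unfold extensions
  split_ifs with h
  · have hs := symbolsAt_eq π ⟨t, ht⟩
    simp only at hs
    simp only [hs, List.map_cons, List.map_nil, List.mem_cons, List.not_mem_nil,
      or_false, h, true_and, hx]
    constructor
    · rintro (h | h | h)
      exacts [⟨_, Or.inl rfl, h⟩, ⟨_, Or.inr (Or.inl rfl), h⟩, ⟨_, Or.inr (Or.inr rfl), h⟩]
    · rintro ⟨x, rfl | rfl | rfl, h⟩ <;> simp [h]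
  · simp [h]

variable {π : Fin n → Fin n} (hπ : Function.Bijective π) {v t₀ : ℕ}

-- A vector on `j + 1` positions is either zero at the last one or a vector on the first `j`
-- positions, of weight one less, plus a nonzero symbol.
include hπ in
theorem mem_lowWeight {j : ℕ} (hj : t₀ + j ≤ n) {a : Fin n → F4} :
    a ∈ lowWeight π v t₀ j ↔ hammingNorm a ≤ v ∧ SupportedOn π t₀ j a := by
  induction j generalizing a with
  | zero =>
    simp only [lowWeight, List.mem_singleton]
    constructor
    · rintro rfl; exact ⟨by simp, fun _ _ => rfl⟩
    · rintro ⟨-, h⟩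
      funext i
      obtain ⟨t, rfl⟩ := hπ.2 i
      exact h t (by omega)
  | succ j ih =>
    have ht : t₀ + j < n := by omega
    rw [lowWeight, List.mem_append, List.mem_flatMap, ih (by omega)]
    simp only [mem_extensions ht]
    constructor
    · rintro (⟨h1, h2⟩ | ⟨b, hb, h3, x, hx, rfl⟩)
      · exact ⟨h1, fun t h => h2 t (by omega)⟩
      · obtain ⟨h1, h2⟩ := (ih (by omega)).1 hb
        refine ⟨?_, fun t h => ?_⟩
        · rw [hammingNorm_add_single (h2 _ (by simp)) hx]; omega
        · have : π t ≠ π ⟨t₀ + j, ht⟩ := fun e => by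
            have := hπ.1 e; subst this; simp at h
          simp [this, h2 t (by omega)]
    · rintro ⟨h1, h2⟩
      by_cases h0 : a (π ⟨t₀ + j, ht⟩) = 0
      · left
        refine ⟨h1, fun t h => ?_⟩
        by_cases e : (t : ℕ) = t₀ + j
        · obtain rfl : t = ⟨t₀ + j, ht⟩ := Fin.ext e
          exact h0
        · exact h2 t (by omega)
      · right
        set i := π ⟨t₀ + j, ht⟩ with hi
        have hsplit : a = (a - Pi.single i (a i)) + Pi.single i (a i) := by simp
        have hz : (a - (Pi.single i (a i) : Fin n → F4)) i = 0 := by simp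
        have hw : hammingNorm a = hammingNorm (a - Pi.single i (a i)) + 1 := by
          conv_lhs => rw [hsplit]
          exact hammingNorm_add_single hz h0
        refine ⟨a - Pi.single i (a i), (ih (by omega)).2 ⟨by omega, fun t h => ?_⟩, by omega,
          a i, h0, hsplit⟩
        by_cases e : (t : ℕ) = t₀ + j
        · obtain rfl : t = ⟨t₀ + j, ht⟩ := Fin.ext e
          exact hz
        · have : π t ≠ i := fun e' => e (by rw [hπ.1 e'])
          simp [this, h2 t (by omega)]

-- The truncated vector and the last symbol can be recovered from an extension. Thus the length of
-- the list, which enters the running time, is a number of vectors.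
include hπ in
theorem nodup_lowWeight {j : ℕ} (hj : t₀ + j ≤ n) : (lowWeight π v t₀ j).Nodup := by
  induction j with
  | zero => simp [lowWeight]
  | succ j ih =>
    have ht : t₀ + j < n := by omega
    have hzero : ∀ b ∈ lowWeight π v t₀ j, b (π ⟨t₀ + j, ht⟩) = 0 := fun b hb =>
      ((mem_lowWeight hπ (by omega)).1 hb).2 _ (by simp)
    rw [lowWeight, List.nodup_append, List.nodup_flatMap]
    refine ⟨ih (by omega), ⟨fun a _ => ?_, ?_⟩, ?_⟩
    · unfold extensions
      split_ifs
      · refine List.Nodup.map (add_right_injective a) ?_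
        have hs := symbolsAt_eq π ⟨t₀ + j, ht⟩
        simp only at hs
        rw [hs]
        exact List.Nodup.map (Pi.single_injective _) (by decide)
      · exact List.nodup_nil
    · refine (ih (by omega)).pairwise_of_forall_ne fun a ha b hb hab c hca hcb => ?_
      obtain ⟨-, x, -, rfl⟩ := (mem_extensions ht).1 hca
      obtain ⟨-, y, -, h⟩ := (mem_extensions ht).1 hcb
      have hxy := congrFun h (π ⟨t₀ + j, ht⟩)
      simp only [Pi.add_apply, hzero a ha, hzero b hb, Pi.single_eq_same, zero_add] at hxy
      subst hxy
      exact hab (add_right_cancel h)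
    · rintro a ha b hb rfl
      obtain ⟨c, hc, hb⟩ := List.mem_flatMap.1 hb
      obtain ⟨-, x, hx, rfl⟩ := (mem_extensions ht).1 hb
      have := hzero _ ha
      simp only [Pi.add_apply, hzero c hc, Pi.single_eq_same, zero_add] at this
      exact hx this

theorem length_lowWeight_le (j : ℕ) : (lowWeight π v t₀ j).length ≤ 4 ^ j := by
  induction j with
  | zero => simp [lowWeight]
  | succ j ih =>
    rw [lowWeight, List.length_append, List.length_flatMap, pow_succ]
    have : ((lowWeight π v t₀ j).map fun a => (extensions π v (t₀ + j) a).length).sum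
        ≤ (lowWeight π v t₀ j).length * 3 := by
      refine (List.sum_le_card_nsmul _ 3 ?_).trans (by simp)
      intro x hx
      obtain ⟨a, -, rfl⟩ := List.mem_map.1 hx
      unfold extensions
      split_ifs <;> simp [symbolsAt]
    omega

end Lists

/-! ### Keys -/

section Keys

variable {n r : ℕ} (g : Fin r → Fin n → F4)

/-- The bits of the symplectic products with the first `j` generators. -/
def keyUpTo (f : Fin n → F4) : ℕ → ℕ
  | 0 => 0
  | j + 1 => 2 * keyUpTo f j + if h : j < r then (symp (g ⟨j, h⟩) f).val else 0

/-- The syndrome of `f` as a number. -/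
def key (f : Fin n → F4) : ℕ := keyUpTo g f r

theorem keyUpTo_succ (f : Fin n → F4) {j : ℕ} (hj : j < r) :
    keyUpTo g f (j + 1) = 2 * keyUpTo g f j + (symp (g ⟨j, hj⟩) f).val := by
  simp [keyUpTo, hj]

theorem keyUpTo_lt (f : Fin n → F4) (j : ℕ) : keyUpTo g f j < 2 ^ j := by
  induction j with
  | zero => simp [keyUpTo]
  | succ j ih =>
    rw [keyUpTo, pow_succ]
    have : (if h : j < r then (symp (g ⟨j, h⟩) f).val else 0) < 2 := by
      split_ifs with h
      exacts [ZMod.val_lt _, by norm_num]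
    omega

theorem key_eq_iff {f f' : Fin n → F4} :
    key g f = key g f' ↔ ∀ j, symp (g j) f = symp (g j) f' := by
  have : ∀ i ≤ r, (keyUpTo g f i = keyUpTo g f' i ↔
      ∀ j : Fin r, (j : ℕ) < i → symp (g j) f = symp (g j) f') := by
    intro i
    induction i with
    | zero => simp [keyUpTo]
    | succ i ih =>
      intro hi
      have hi' : i < r := by omega
      rw [keyUpTo_succ g f hi', keyUpTo_succ g f' hi']
      have h1 := ZMod.val_lt (symp (g ⟨i, hi'⟩) f)
      have h2 := ZMod.val_lt (symp (g ⟨i, hi'⟩) f')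
      constructor
      · intro h j hj
        rcases Nat.lt_succ_iff_lt_or_eq.1 hj with hj | hj
        · exact (ih (by omega)).1 (by omega) j hj
        · obtain rfl : j = ⟨i, hi'⟩ := Fin.ext hj
          exact ZMod.val_injective 2 (by omega)
      · intro h
        rw [(ih (by omega)).2 fun j hj => h j (by omega), h ⟨i, hi'⟩ (by simp)]
  rw [key, key, this r le_rfl]
  exact ⟨fun h j => h j j.2, fun h j _ => h j⟩

end Keys

/-- Append the vector in register `15`, extended by the three nonzero symbols at position
`reg 18 + reg 14`, to the list in array `4`. -/
def appendSymbols : RamProg :=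
  .seq (st 4 (.reg 19) (.reg 15 + (ld 3 (2 * (.reg 18 + .reg 14)) * .reg 5 + 1))) <|
  .seq (st 4 (.reg 19 + 1) (.reg 15 + (ld 3 (2 * (.reg 18 + .reg 14) + 1) * .reg 5 + 1))) <|
  .seq (st 4 (.reg 19 + 2) (.reg 15 + ((ld 3 (2 * (.reg 18 + .reg 14)) +
    ld 3 (2 * (.reg 18 + .reg 14) + 1)) * .reg 5 + 1))) <|
  .assign 19 (.reg 19 + 3)

/-- Fill array `4` with the vectors of weight at most `reg 10` on `reg 4` positions starting with
number `reg 18`; register `19` becomes the length of the list. -/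
def buildList : RamProg :=
  .seq (st 4 0 0) <|
  .seq (.assign 19 1) <|
  loop 14 (.reg 4) <|
    .seq (.assign 20 (.reg 19)) <|
    loop 16 (.reg 20) <|
      .seq (.assign 15 (ld 4 (.reg 16))) <|
      .ite (.reg 10 - (reg 15).mod (.reg 5))
        appendSymbols
        .skip

/-- Register `17` becomes the key of the vector in register `15`. -/
def computeKey : RamProg :=
  .seq (.assign 17 0) <|
  loop 21 (.reg 3) <|
    .assign 17 (2 * .reg 17 + sympExpr (ld 1 (.reg 21)) (.reg 15))

/-- Distribute the list in array `4` to the buckets of stage `reg 8` in array `5`. -/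
def insertList : RamProg :=
  loop 14 (.reg 19) <|
    .seq (.assign 15 (ld 4 (.reg 14) / .reg 5)) <|
    .seq computeKey <|
    .seq (.assign 22 ((.reg 8 * .reg 5 + .reg 17) * .reg 5)) <|
    .seq (.assign 20 (ld 5 (.reg 22))) <|
    .seq (st 5 (.reg 22 + (.reg 20 + 1)) (.reg 15)) <|
    st 5 (.reg 22) (.reg 20 + 1)

/-! ### Verification of the list construction and of the keys -/

section

variable {n r m : ℕ} {g : Fin r → Fin n → F4}

/-- `y` stores the vector `Φ a` together with the weight of `a`. -/
def Item {n : ℕ} (Φ : (Fin n → F4) →+ (Fin n → F4)) (M y : ℕ) (a : Fin n → F4) : Prop :=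
  ∃ x, y = x * radix n + hammingNorm a ∧ Packs M x (Φ a)

/-- Array `4` holds the list. -/
def Stored {n : ℕ} (Φ : (Fin n → F4) →+ (Fin n → F4)) (M : ℕ) (σ : RamState)
    (l : List (Fin n → F4)) : Prop :=
  ∀ s a, l[s]? = some a → Item Φ M (σ.arr 4 s) a

variable {Φ : (Fin n → F4) →+ (Fin n → F4)} {M : ℕ} {σ : RamState}

theorem Item.mono {M' y : ℕ} {a : Fin n → F4} (h : Item Φ M y a) (hM : M ≤ M') :
    Item Φ M' y a := by
  obtain ⟨x, h1, h2⟩ := h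
  exact ⟨x, h1, h2.mono hM⟩

theorem hammingNorm_lt_radix (a : Fin n → F4) : hammingNorm a < radix n := by
  have h1 : hammingNorm a ≤ n := by simpa using hammingNorm_le_card_fintype (x := a)
  exact lt_radix_of_le (by nlinarith)

theorem Item.div {y : ℕ} {a : Fin n → F4} (h : Item Φ M y a) : Packs M (y / radix n) (Φ a) := by
  obtain ⟨x, rfl, h2⟩ := h
  rwa [mul_comm, Nat.mul_add_div (radix_pos n), Nat.div_eq_of_lt (hammingNorm_lt_radix a),
    add_zero]

theorem Item.mod {y : ℕ} {a : Fin n → F4} (h : Item Φ M y a) : y % radix n = hammingNorm a := by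
  obtain ⟨x, rfl, h2⟩ := h
  rw [mul_comm, Nat.mul_add_mod, Nat.mod_eq_of_lt (hammingNorm_lt_radix a)]

theorem Item.lt {y : ℕ} {a : Fin n → F4} (h : Item Φ M y a) (hM : M < radix n) :
    y < 2 ^ digits n := by
  obtain ⟨x, rfl, h2⟩ := h
  refine lt_two_pow_digits ?_
  have h1 := h2.lt hM
  have h3 := hammingNorm_lt_radix a
  rw [pow_succ]
  nlinarith

/-- The weight occupies the lowest digit, so adding `x * radix n + 1` updates the vector and its
weight at once. -/
theorem Item.add_single {y x M' : ℕ} {a : Fin n → F4} (h : Item Φ M y a) {i : Fin n} {c : F4}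
    (ha : a i = 0) (hc : c ≠ 0) (hx : Packs M' x (Φ (Pi.single i c))) :
    Item Φ (M + M') (y + (x * radix n + 1)) (a + Pi.single i c) := by
  obtain ⟨x', rfl, h2⟩ := h
  refine ⟨x' + x, ?_, ?_⟩
  · rw [hammingNorm_add_single ha hc]; ring
  · rw [map_add]; exact h2.add hx

theorem Stored.put {l : List (Fin n → F4)} {a : Fin n → F4} {p y : ℕ}
    (h : Stored Φ M σ l) (hp : p = l.length) (hy : Item Φ M y a) :
    Stored Φ M (σ.put 4 p y) (l ++ [a]) := by
  intro s b hs
  rw [arr_put _ (by decide) (by decide)]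
  rw [List.getElem?_append] at hs
  split_ifs at hs with h1
  · rw [if_neg (by omega)]
    exact h s b hs
  · rw [List.getElem?_singleton] at hs
    split_ifs at hs with h2
    · rw [if_pos (by omega)]
      simp only [Option.some.injEq] at hs
      rwa [← hs]

theorem Stored.set {l : List (Fin n → F4)} (h : Stored Φ M σ l) {i : ℕ} (hi : 1 ≠ i) (v : ℕ) :
    Stored Φ M (σ.set i v) l := by
  intro s b hs
  rw [arr_set _ hi]
  exact h s b hs

theorem four_pow_lt_radix (n : ℕ) : 4 ^ n + 3 < radix n := by
  have h := size_bound (le_refl n)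
  have h1 : 4 ^ n = 2 ^ n * 2 ^ n := by
    rw [← mul_pow]; norm_num
  have h2 : 1 ≤ 4 ^ n := Nat.one_le_pow _ _ (by norm_num)
  rw [← h1] at h
  have h4 : 1 ≤ (n + 1) ^ 2 := Nat.one_le_pow _ _ (by omega)
  have h5 : 16 * 1 * 4 ^ n ≤ 16 * (n + 1) ^ 2 * 4 ^ n := by gcongr
  omega

theorem wp_appendSymbols {N M' t : ℕ} {π : Fin n → Fin n} {P : List (Fin n → F4)}
    {a : Fin n → F4} (ht : t < n) (hb : Bounded (digits n) σ) (h19 : σ.reg 19 = P.length)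
    (h18 : σ.reg 18 + σ.reg 14 = t) (h5 : σ.reg 5 = radix n)
    (hx1 : Packs (2 ^ r) (σ.arr 3 (2 * t)) (Φ (unitVec π (2 * t))))
    (hx2 : Packs (2 ^ r) (σ.arr 3 (2 * t + 1)) (Φ (unitVec π (2 * t + 1))))
    (hitem : Item Φ M (σ.reg 15) a) (hP : Stored Φ M' σ P) (hM : M + (2 ^ r + 2 ^ r) ≤ M')
    (hMb : M' < radix n) (hlen : P.length + 3 < radix n) (hzero : a (π ⟨t, ht⟩) = 0) :
    Wp (digits n) appendSymbols (N + 1 + 1 + 1 + 1) (fun τ => Frame [19] [4] σ τ ∧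
      τ.reg 19 = P.length + 3 ∧ Stored Φ M' τ (P ++ (symbolsAt π t).map (a + ·)) ∧
      ∀ s < P.length, τ.arr 4 s = σ.arr 4 s) σ := by
  have hz := nine_le_digits n
  have h3' : (2 * t + 1) / 2 = t := by omega
  have hu1 : unitVec π (2 * t) = Pi.single (π ⟨t, ht⟩) (1, 0) := by
    simp [unitVec, ht]
  have hu2 : unitVec π (2 * t + 1) = Pi.single (π ⟨t, ht⟩) (0, 1) := by
    simp [unitVec, h3', ht, Nat.add_mod]
  have hx3 := hx1.add hx2
  rw [← map_add, hu1, hu2, ← Pi.single_add] at hx3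
  rw [hu1] at hx1
  rw [hu2] at hx2
  have i1 := (hitem.add_single hzero (by decide) hx1).mono ((Nat.add_le_add_left (Nat.le_add_right _ _) _).trans hM)
  have i2 := (hitem.add_single hzero (by decide) hx2).mono ((Nat.add_le_add_left (Nat.le_add_right _ _) _).trans hM)
  have i3 := (hitem.add_single hzero (by decide) hx3).mono hM
  rw [symbolsAt, hu1, hu2, ← Pi.single_add]
  refine wp_st_seq hz hb rfl rfl P.length _ (by simp [h19])
    (by simp only [eval_add, eval_reg, eval_mul, eval_ld, eval_two, eval_one, h18, h5])
    (i1.lt hMb) fun hb5 => ?_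
  refine wp_st_seq hz hb5 rfl rfl (P.length + 1) _ (by simp [h19])
    (by simp only [eval_add, eval_reg, eval_mul, eval_ld, eval_two, eval_one, h18, h5, reg_put,
          arr_put _ (show 4 < 8 by decide) (show 3 < 8 by decide)]; rfl) (i2.lt hMb) fun hb6 => ?_
  refine wp_st_seq hz hb6 rfl rfl (P.length + 2) _ (by simp [h19])
    (by simp only [eval_add, eval_reg, eval_mul, eval_ld, eval_two, eval_one, h18, h5, reg_put,
          arr_put _ (show 4 < 8 by decide) (show 3 < 8 by decide)]; rfl) (i3.lt hMb) fun hb7 => ?_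
  refine wp_assign_add hz hb7 rfl (P.length + 3) (by simp [h19]) (lt_of_lt_radix hlen.le)
    ⟨?_, by simp, ?_, ?_⟩
  · exact ((((Frame.refl _ _ _).put (by decide) (by decide) _ _).put
      (by decide) (by decide) _ _).put (by decide) (by decide) _ _).set (by decide) (by decide) _
  · have := ((hP.put rfl i1).put (p := P.length + 1) (by simp) i2).put (p := P.length + 2)
      (by simp) i3
    simpa using this.set (show 1 ≠ 19 by decide) (P.length + 3)
  · intro s' hs'
    simp only [arr_set _ (show 1 ≠ 19 by decide),
      arr_put _ (show 4 < 8 by decide) (show 4 < 8 by decide), true_and]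
    rw [if_neg (by omega), if_neg (by omega), if_neg (by omega)]

/-- Each pass appends to the list over which it runs. The inner loop stops at the old length, saved
in register `20`, and this reproduces the recursion of `lowWeight`. The digit bound `2 * j * 2 ^ r`
allows two packed unit vectors per position. -/
theorem wp_buildList (hr : r ≤ n) {π : Fin n → Fin n} (hπ : Function.Bijective π)
    {v t₀ : ℕ} (ht₀ : t₀ + m ≤ n) (hb : Bounded (digits n) σ) (hσ : Env m g σ)
    (h10 : σ.reg 10 = v) (h18 : σ.reg 18 = t₀)
    (hX : ∀ l < 2 * n, Packs (2 ^ r) (σ.arr 3 l) (Φ (unitVec π l))) :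
    Wp (digits n) buildList (20 * (n + 1) * (lowWeight π v t₀ m).length)
      (fun τ => Frame [14, 15, 16, 19, 20] [4] σ τ ∧
        τ.reg 19 = (lowWeight π v t₀ m).length ∧
        Stored Φ (2 * n * 2 ^ r) τ (lowWeight π v t₀ m)) σ := by
  have hz := nine_le_digits n
  have hMr : ∀ {j : ℕ}, j ≤ n → 2 * j * 2 ^ r < radix n := fun {j} hj => by
    have := size_bound_one (c := 1) hr (le_refl r) Nat.one_le_two_pow
    rw [one_mul] at this
    exact lt_of_le_of_lt (by gcongr) this
  have hlen : ∀ j ≤ n, (lowWeight π v t₀ j).length + 3 < radix n := fun j hj => by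
    have h1 := length_lowWeight_le (π := π) (v := v) (t₀ := t₀) j
    have h2 := Nat.pow_le_pow_right (n := 4) (by norm_num) hj
    have h3 := four_pow_lt_radix n
    omega
  have hmono : ∀ j ≤ m, 1 ≤ (lowWeight π v t₀ j).length ∧
      (lowWeight π v t₀ j).length ≤ (lowWeight π v t₀ m).length := by
    intro j hj
    constructor
    · clear hj hlen
      induction j with
      | zero => simp [lowWeight]
      | succ j ih => rw [lowWeight, List.length_append]; omega
    · induction hj using Nat.decreasingInduction with
      | self => exact le_rfl
      | of_succ k _ ih => rw [lowWeight, List.length_append] at ih; omega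
  set K := (lowWeight π v t₀ m).length with hK
  have hK1 : 1 ≤ K := (hmono m le_rfl).1
  have hT : m * (8 * K + 2 + 1 + 2) + 2 + 1 + 1 ≤ 20 * (n + 1) * K := by
    calc _ = m * (8 * K + 5) + 4 := by ring
      _ ≤ n * (8 * K + 5 * K) + 4 * K := by gcongr <;> omega
      _ ≤ _ := by nlinarith
  refine Wp.mono ?_ hT fun _ _ h => h
  refine wp_st_seq hz hb rfl rfl 0 0 rfl rfl (by positivity) fun hb1 => ?_
  refine wp_assign_seq hz hb1 rfl 1 rfl (Nat.one_lt_two_pow (by omega)) fun hb2 => ?_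
  refine wp_loop_const hz hb2 rfl m (8 * K + 2 + 1)
    (fun j τ => Frame [14, 15, 16, 19, 20] [4] σ τ ∧
    τ.reg 19 = (lowWeight π v t₀ j).length ∧
    Stored Φ (2 * j * 2 ^ r) τ (lowWeight π v t₀ j)) (lt_of_lt_radix ?_) le_rfl ⟨?_, ?_, ?_⟩
      ?_ ?_ ?_
  · exact (lt_radix_of_le (by nlinarith)).le
  · exact (((Frame.refl _ _ _).put (by decide) (by decide) _ _).set (by decide) (by decide) _).set
      (by decide) (by decide) _
  · simp [lowWeight]
  · refine Stored.set (Stored.set ?_ (by decide) _) (by decide) _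
    refine Stored.put (l := []) (fun s a h => by simp at h) rfl ⟨0, by simp, ?_⟩
    rw [map_zero]; exact Packs.zero
  · rintro j hj τ - ⟨hF, -⟩
    simp [hF.reg 4 (by decide), hσ.reg4]
  · rintro j hj τ hbτ h14 ⟨hF, h19, hS⟩
    have hjn : t₀ + j < n := by omega
    refine wp_assign_seq hz hbτ rfl _ rfl (hbτ.1 _) fun hb3 => ?_
    set L := lowWeight π v t₀ j with hL
    have hLK := (hmono j hj.le).2
    refine wp_loop_const hz hb3 rfl L.length 6
      (fun s υ => Frame [14, 15, 16, 19, 20] [4] σ υ ∧ υ.reg 14 = j ∧ υ.reg 20 = L.length ∧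
      υ.reg 19 = (L ++ (L.take s).flatMap (extensions π v (t₀ + j))).length ∧
      Stored Φ (2 * (j + 1) * 2 ^ r) υ (L ++ (L.take s).flatMap (extensions π v (t₀ + j))) ∧
      ∀ s < L.length, υ.arr 4 s = τ.arr 4 s)
      (lt_of_lt_radix (by have := hlen j (by omega); rw [← hL] at this; omega)) (by nlinarith) ⟨?_, ?_, ?_, ?_, ?_, ?_⟩
      ?_ ?_ ?_
    · exact (hF.set (by decide) (by decide) _).set (by decide) (by decide) _
    · simp [h14]
    · simp [h19]
    · simp [h19]
    · simp only [List.take_zero, List.flatMap_nil, List.append_nil]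
      refine Stored.set (Stored.set ?_ (by decide) _) (by decide) _
      exact fun s a h => (hS s a h).mono (by gcongr; omega)
    · intro s _; rw [arr_set _ (by decide), arr_set _ (by decide)]
    · rintro s hs υ - ⟨-, -, h20, -⟩
      simpa using h20
    · rintro s hs υ hbυ h16 ⟨hF', h14', h20', h19', hS', hA⟩
      have hE := hσ.frame hF' (by decide) (by decide)
      -- The list after `s` items of the current pass have been extended.
      set P := L ++ (L.take s).flatMap (extensions π v (t₀ + j)) with hP
      have hPs : P[s]? = some L[s] := by
        rw [hP, List.getElem?_append_left hs, List.getElem?_eq_getElem hs]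
      have hPn : P ++ extensions π v (t₀ + j) L[s]
          = L ++ (L.take (s + 1)).flatMap (extensions π v (t₀ + j)) := by
        rw [List.take_succ_eq_append_getElem hs, List.flatMap_append, hP]; simp
      have hPlen : P.length + (extensions π v (t₀ + j) L[s]).length + 3 < radix n := by
        refine lt_of_le_of_lt ?_ (hlen (j + 1) (by omega))
        rw [← List.length_append, hPn, lowWeight, ← hL, List.length_append, List.length_append]
        gcongr
        rw [List.length_flatMap, List.length_flatMap, List.map_take]
        exact List.Sublist.sum_le_sum (List.take_sublist _ _) (fun _ _ => Nat.zero_le _)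
      have hmem := (mem_lowWeight hπ (by omega)).1 (List.getElem_mem hs)
      have hzero : L[s] (π ⟨t₀ + j, hjn⟩) = 0 := hmem.2 _ (by simp)
      have e10 : υ.reg 10 = v := by rw [hF'.reg 10 (by decide), h10]
      have e18 : υ.reg 18 = t₀ := by rw [hF'.reg 18 (by decide), h18]
      refine wp_assign_seq hz hbυ rfl (υ.arr 4 s) (by simp [h16]) (hbυ.arr _ _) fun hb4 => ?_
      have hitem : Item Φ (2 * j * 2 ^ r) (υ.arr 4 s) L[s] := by
        rw [hA s hs]
        exact hS s _ (List.getElem?_eq_getElem hs)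
      have hval : (.reg 10 - (reg 15).mod (.reg 5) : RamExpr).eval (υ.set 15 (υ.arr 4 s))
          = v - hammingNorm L[s] := by
        simp [e10, hE.reg5, hitem.mod]
      refine wp_ite hz hb4 rfl (fun h0 => ?_) (fun h0 => ?_)
      · have hw : hammingNorm L[s] < v := by rw [hval] at h0; omega
        have hext : extensions π v (t₀ + j) L[s] = (symbolsAt π (t₀ + j)).map (L[s] + ·) := by
          rw [extensions, if_pos hw]
        rw [hext] at hPn hPlen
        simp only [symbolsAt, List.map_cons, List.map_nil, List.length_cons,
          List.length_nil] at hPlen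
        -- The symbol `(1, 1)` is the sum of two packed unit vectors, each with digits at most `2 ^
        -- r`.
        have hMs : 2 * (j + 1) * 2 ^ r = 2 * j * 2 ^ r + (2 ^ r + 2 ^ r) := by ring
        have a3 : ∀ x, (υ.set 15 (υ.arr 4 s)).arr 3 x = σ.arr 3 x := fun x => by
          rw [arr_set _ (by decide)]; exact hF'.arr 3 (by decide) (by decide) x
        refine (wp_appendSymbols (P := P) (N := 0) (r := r) (t := t₀ + j) (π := π) hjn hb4
          (by simp [h19']) (by simp [e18, h14']) (by simp [hE.reg5])
          (by rw [a3]; exact hX _ (by omega)) (by rw [a3]; exact hX _ (by omega))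
          (by simpa using hitem) (hS'.set (by decide) _) hMs.ge (hMr (by omega)) (by omega)
          hzero).mono le_rfl ?_
        rintro ω hbω ⟨hF2, g19, gS, gA⟩
        refine ⟨by simp [hF2.reg 16 (by decide), h16], ?_,
          by simp [hF2.reg 14 (by decide), h14'], by simp [hF2.reg 20 (by decide), h20'],
          ?_, ?_, ?_⟩
        · exact ((hF'.set (by decide) (by decide) _).trans
            (hF2.mono (by decide) (by decide))).set (by decide) (by decide) _
        · rw [← hPn]; simp [g19, symbolsAt]
        · rw [← hPn]
          exact gS.set (by decide) _
        · intro s' hs'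
          have hPL : L.length ≤ P.length := by rw [hP, List.length_append]; omega
          rw [arr_set _ (by decide), gA s' (by omega), arr_set _ (by decide)]
          exact hA s' hs'
      · have hw : ¬ hammingNorm L[s] < v := by rw [hval] at h0; omega
        have hext : extensions π v (t₀ + j) L[s] = [] := by rw [extensions, if_neg hw]
        rw [hext, List.append_nil] at hPn
        refine wp_skip_add hz hb4 ⟨by simp [h16], ?_, by simp [h14'], by simp [h20'], ?_, ?_, ?_⟩
        · exact (hF'.set (by decide) (by decide) _).set (by decide) (by decide) _
        · rw [← hPn]; simp [h19']
        · rw [← hPn]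
          exact (hS'.set (by decide) _).set (by decide) _
        · intro s' hs'
          simp only [arr_set _ (show 1 ≠ 16 by decide), arr_set _ (show 1 ≠ 15 by decide)]
          exact hA s' hs'
    · rintro τ hbτ hτ ⟨hF, h14, -, h19, hS, -⟩
      rw [List.take_length] at h19 hS
      refine ⟨h14, hF.set (by decide) (by decide) _, by simp only [reg_set]; exact h19,
        Stored.set hS (by decide) _⟩
  · rintro τ hbτ - ⟨hF, h19, hS⟩
    exact ⟨hF, h19, fun s a h => (hS s a h).mono (by gcongr; omega)⟩

theorem wp_computeKey (hn : 1 ≤ n) (hr : r ≤ n) (hM : 2 * n * M < radix n) {f : Fin n → F4}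
    (hb : Bounded (digits n) σ) (hσ : Env m g σ) (hf : Packs M (σ.reg 15) f) :
    Wp (digits n) computeKey (3 * n + 3) (fun τ => Frame [17, 21] [] σ τ ∧ τ.reg 17 = key g f)
      σ := by
  have hz := nine_le_digits n
  refine wp_assign_seq hz hb rfl 0 rfl (by positivity) fun hb1 => ?_
  refine wp_loop_const hz hb1 rfl r 1 (fun j τ => Frame [17, 21] [] σ τ ∧
    τ.reg 17 = keyUpTo g f j) (lt_of_lt_radix ?_) (by omega) ⟨?_, ?_⟩ ?_ ?_ ?_
  · exact (lt_radix_of_le (by nlinarith)).le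
  · exact ((Frame.refl _ _ _).set (by decide) (by decide) _).set (by decide) (by decide) _
  · simp [keyUpTo]
  · rintro j hj τ - ⟨hF, -⟩
    simp [hF.reg 3 (by decide), hσ.reg3]
  · rintro j hj τ hbτ h21 ⟨hF, hI⟩
    have hE := hσ.frame hF (by decide) (by decide)
    have e15 : τ.reg 15 = σ.reg 15 := hF.reg 15 (by decide)
    have hs := eval_sympExpr hE hn (a := ld 1 (.reg 21)) (b := .reg 15)
      (by simpa [h21] using hE.gen ⟨j, hj⟩) (by simpa [e15] using hf) (by simpa using hM)
    refine wp_assign hz hbτ rfl (v := keyUpTo g f (j + 1)) ?_ ?_ ⟨by simp [h21], ?_, by simp⟩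
    · rw [keyUpTo_succ g f hj, eval_add, hs]; simp [hI]
    · refine lt_of_lt_radix ((keyUpTo_lt g f (j + 1)).trans (two_pow_lt_radix (by omega))).le
    · exact (hF.set (by decide) (by decide) _).set (by decide) (by decide) _
  · rintro τ hbτ - ⟨hF, hI⟩
    exact ⟨hF, hI⟩

end

/-- If the vector in register `15` has weight at most `reg 9` and is not orthogonal to all vectors
in array `2`, the answer is `reg 9`. -/
def testVector : RamProg :=
  .seq weigh <|
  .ite (.reg 9 + 1 - .reg 17)
    (loop 16 (.reg 6) <| .ite (sympExpr (ld 2 (.reg 16)) (.reg 15)) (.assign 0 (.reg 9)) .skip)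
    .skip

/-- Combine every vector of the list in array `4` with all vectors in its bucket. -/
def lookupList : RamProg :=
  loop 14 (.reg 19) <|
    .seq (.assign 15 (ld 4 (.reg 14) / .reg 5)) <|
    .seq (.assign 23 (.reg 15)) <|
    .seq computeKey <|
    .seq (.assign 22 ((.reg 8 * .reg 5 + .reg 17) * .reg 5)) <|
    .seq (.assign 20 (ld 5 (.reg 22))) <|
    loop 24 (.reg 20) <|
      .seq (.assign 15 (.reg 23 + ld 5 (.reg 22 + (.reg 24 + 1)))) testVector

/-! ### Buckets and the matching of the two lists -/

section

variable {n r m : ℕ} (g : Fin r → Fin n → F4) (Φ : (Fin n → F4) →+ (Fin n → F4))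

/-- The vectors of the list with a given key. -/
def bucket (l : List (Fin n → F4)) (κ : ℕ) : List (Fin n → F4) :=
  l.filter fun a => key g (Φ a) = κ

/-- The address of a bucket. -/
def bucketIdx (n q κ : ℕ) : ℕ := (q * radix n + κ) * radix n

/-- The buckets of stage `q` hold the list. -/
def Buckets (M q : ℕ) (σ : RamState) (l : List (Fin n → F4)) : Prop :=
  ∀ κ < radix n, σ.arr 5 (bucketIdx n q κ) = (bucket g Φ l κ).length ∧
    ∀ j a, (bucket g Φ l κ)[j]? = some a → Packs M (σ.arr 5 (bucketIdx n q κ + (j + 1))) (Φ a)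

/-- An address in the bucket array consists of the stage, the key and the offset, written in base
`radix n`. As key and offset are proper digits, buckets do not overlap. -/
theorem bucketIdx_inj {q κ κ' i i' : ℕ} (hi : i < radix n) (hi' : i' < radix n)
    (h : bucketIdx n q κ + i = bucketIdx n q κ' + i') : κ = κ' ∧ i = i' := by
  have e : ∀ κ i, i < radix n → (bucketIdx n q κ + i) / radix n = q * radix n + κ := by
    intro κ i hi
    rw [bucketIdx, mul_comm, Nat.mul_add_div (radix_pos n), Nat.div_eq_of_lt hi, add_zero]
  have h1 := e κ i hi
  rw [h, e κ' i' hi'] at h1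
  obtain rfl : κ = κ' := by omega
  exact ⟨rfl, by omega⟩

variable {g Φ} {M q : ℕ} {σ : RamState}

theorem length_bucket_le (l : List (Fin n → F4)) (κ : ℕ) :
    (bucket g Φ l κ).length ≤ l.length := List.length_filter_le _ _

theorem Buckets.insert {l : List (Fin n → F4)} {a : Fin n → F4} (h : Buckets g Φ M q σ l)
    {x κ c : ℕ} (hx : Packs M x (Φ a)) (hκ : key g (Φ a) = κ) (hc : c = (bucket g Φ l κ).length)
    (hl : l.length + 3 < radix n) :
    Buckets g Φ M q ((σ.put 5 (bucketIdx n q κ + (c + 1)) x).put 5 (bucketIdx n q κ) (c + 1))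
      (l ++ [a]) := by
  intro κ' hκ'
  have hb : bucket g Φ (l ++ [a]) κ' = bucket g Φ l κ' ++ if κ = κ' then [a] else [] := by
    simp only [bucket, List.filter_append, List.filter_singleton, hκ]
    by_cases e : κ = κ' <;> simp [e]
  have hlen := fun κ => length_bucket_le (g := g) (Φ := Φ) l κ
  have hlen1 := hlen κ
  have hlen2 := hlen κ'
  simp only [arr_put _ (show 5 < 8 by decide) (show 5 < 8 by decide), true_and]
  rw [hb]
  obtain ⟨h1, h2⟩ := h κ' hκ'
  by_cases e : κ = κ'
  · subst e
    refine ⟨by simp [hc], fun j b hj => ?_⟩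
    rw [if_neg (by omega)]
    rw [if_pos rfl, List.getElem?_append] at hj
    split_ifs at hj with h3
    · rw [if_neg (by omega)]
      exact h2 j b hj
    · rw [List.getElem?_singleton] at hj
      split_ifs at hj with h4
      · rw [if_pos (by omega)]
        simp only [Option.some.injEq] at hj
        rwa [← hj]
  · have hne : ∀ i < radix n, ∀ i' < radix n,
        ¬ bucketIdx n q κ' + i = bucketIdx n q κ + i' := fun i hi i' hi' h =>
      e (bucketIdx_inj hi hi' h).1.symm
    rw [if_neg e, List.append_nil]
    refine ⟨?_, fun j b hj => ?_⟩
    · rw [if_neg (show ¬ bucketIdx n q κ' = bucketIdx n q κ from hne 0 (by omega) 0 (by omega)),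
        if_neg (show ¬ bucketIdx n q κ' = bucketIdx n q κ + (c + 1) from
          hne 0 (by omega) _ (by omega))]
      exact h1
    · have h3 := (List.getElem?_eq_some_iff.1 hj).1
      rw [if_neg (show ¬ bucketIdx n q κ' + (j + 1) = bucketIdx n q κ from
        hne _ (by omega) 0 (by omega)), if_neg (hne _ (by omega) _ (by omega))]
      exact h2 j b hj

theorem Buckets.congr {l : List (Fin n → F4)} {τ : RamState} (h : Buckets g Φ M q σ l)
    (hτ : ∀ b, τ.arr 5 b = σ.arr 5 b) : Buckets g Φ M q τ l := by
  intro κ hκ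
  simp only [hτ]
  exact h κ hκ

theorem bucketIdx_lt (hn : 1 ≤ n) {κ : ℕ} (hq : q < radix n) (hκ : κ < radix n) :
    bucketIdx n q κ < 2 ^ digits n := by
  refine lt_two_pow_digits ?_
  calc bucketIdx n q κ < radix n * radix n * radix n := by
        rw [bucketIdx]
        refine Nat.mul_lt_mul_of_pos_right ?_ (radix_pos n)
        nlinarith
    _ = radix n ^ 3 := by ring
    _ ≤ _ := Nat.pow_le_pow_right (radix_pos n) (by omega)

/-- Different stages use disjoint intervals of addresses. The cells of a new stage are therefore
still zero, and no bucket is ever cleared. -/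
theorem bucketIdx_bounds {κ i : ℕ} (hκ : κ < radix n) (hi : i < radix n) :
    q * radix n * radix n ≤ bucketIdx n q κ + i ∧
      bucketIdx n q κ + i < (q + 1) * radix n * radix n := by
  have h1 : bucketIdx n q κ = q * radix n * radix n + κ * radix n := by rw [bucketIdx]; ring
  have h2 : (q + 1) * radix n * radix n = q * radix n * radix n + radix n * radix n := by ring
  have h3 : (κ + 1) * radix n ≤ radix n * radix n := Nat.mul_le_mul_right _ hκ
  have h4 : (κ + 1) * radix n = κ * radix n + radix n := by ring
  omega

theorem wp_insertList (hn : 1 ≤ n) (hr : r ≤ n) (hM : 2 * n * M < radix n) (hq : q < radix n)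
    {l : List (Fin n → F4)} (hl : l.length + 3 < radix n)
    (hb : Bounded (digits n) σ) (hσ : Env m g σ) (h8 : σ.reg 8 = q) (h19 : σ.reg 19 = l.length)
    (hS : Stored Φ M σ l) (hfresh : ∀ b, q * radix n * radix n ≤ b → σ.arr 5 b = 0) :
    Wp (digits n) insertList (l.length * (3 * n + 20) + 2)
      (fun τ => Frame [14, 15, 17, 20, 21, 22] [5] σ τ ∧ Buckets g Φ M q τ l ∧
        ∀ b, (q + 1) * radix n * radix n ≤ b → τ.arr 5 b = 0) σ := by
  have hz := nine_le_digits n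
  have hM1 : M < radix n := by nlinarith
  refine wp_loop_const hz hb rfl l.length (3 * n + 18)
    (fun s τ => Frame [14, 15, 17, 20, 21, 22] [5] σ τ ∧ Buckets g Φ M q τ (l.take s) ∧
        ∀ b, (q + 1) * radix n * radix n ≤ b → τ.arr 5 b = 0)
    (lt_of_lt_radix (by omega)) (by ring_nf; omega) ⟨?_, ?_, ?_⟩ ?_ ?_ ?_
  · exact (Frame.refl _ _ _).set (by decide) (by decide) _
  · intro κ hκ
    rw [arr_set _ (by decide), hfresh _ (by
      have := (bucketIdx_bounds (q := q) hκ (radix_pos n)).1; omega)]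
    simp [bucket]
  · intro b hb'
    rw [arr_set _ (by decide)]
    exact hfresh b (le_trans (by gcongr; omega) hb')
  · rintro j hj τ - ⟨hF, -⟩
    simp [hF.reg 19 (by decide), h19]
  · rintro s hs τ hbτ h14 ⟨hF, hB, hfr⟩
    have hE := hσ.frame hF (by decide) (by decide)
    have hitem : Item Φ M (τ.arr 4 s) l[s] := by
      rw [hF.arr 4 (by decide) (by decide)]
      exact hS s _ (List.getElem?_eq_getElem hs)
    have hx := hitem.div
    refine wp_assign_seq hz hbτ rfl (τ.arr 4 s / radix n) (by simp [h14, hE.reg5])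
      (hx.lt_digits hM1) fun hb1 => ?_
    have hE1 : Env m g (τ.set 15 (τ.arr 4 s / radix n)) :=
      hE.frame ((Frame.refl [15] [] _).set (by decide) (by decide) _) (by decide) (by decide)
    refine wp_seq_le (3 * n + 3) 13 (by omega) _
      (wp_computeKey hn hr hM hb1 hE1 (f := Φ l[s]) (by simpa using hx)) ?_
    rintro υ hbυ ⟨hF2, h17⟩
    have hE2 := hE1.frame hF2 (by decide) (by decide)
    have hκ : key g (Φ l[s]) < radix n :=
      (keyUpTo_lt g _ r).trans (two_pow_lt_radix hr)
    obtain ⟨hB1, hB2⟩ := hB _ hκ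
    set κ := key g (Φ l[s]) with hκdef
    set c := (bucket g Φ (l.take s) κ).length with hcdef
    have hcl : c + 3 < radix n := by
      have h1 := length_bucket_le (g := g) (Φ := Φ) (l.take s) κ
      have h2 := List.length_take_le s l
      have h3 : (l.take s).length ≤ l.length := (List.take_sublist s l).length_le
      omega
    have e8 : υ.reg 8 = q := by
      rw [hF2.reg 8 (by decide)]; simp [hF.reg 8 (by decide), h8]
    have e14 : υ.reg 14 = s := by
      rw [hF2.reg 14 (by decide)]; simp [h14]
    have e15 : υ.reg 15 = τ.arr 4 s / radix n := by
      rw [hF2.reg 15 (by decide)]; simp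
    have e5 : ∀ b, υ.arr 5 b = τ.arr 5 b := fun b => by
      rw [hF2.arr 5 (by decide) (by decide), arr_set _ (by decide)]
    refine wp_assign_seq hz hbυ rfl (bucketIdx n q κ) (by simp [e8, h17, hE2.reg5, bucketIdx])
      (bucketIdx_lt hn hq hκ) fun hb2 => ?_
    refine wp_assign_seq hz hb2 rfl c (by simp [arr_set, e5, hB1])
      (lt_of_lt_radix (by omega)) fun hb3 => ?_
    refine wp_st_seq hz hb3 rfl rfl (bucketIdx n q κ + (c + 1)) (τ.arr 4 s / radix n) (by simp)
      (by simp [e15]) (hx.lt_digits hM1) fun hb4 => ?_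
    refine wp_st_add hz hb4 rfl rfl (bucketIdx n q κ) (c + 1) (by simp)
      (by simp) (lt_of_lt_radix (by omega)) ⟨by simp [e14], ?_, ?_, ?_⟩
    · refine ((((Frame.put ?_ (by decide) (by decide) _ _).put (by decide) (by decide) _ _))).set
        (by decide) (by decide) _
      refine (Frame.set ?_ (by decide) (by decide) _).set (by decide) (by decide) _
      exact (hF.set (by decide) (by decide) _).trans (hF2.mono (by decide) (by decide))
    · have hB' : Buckets g Φ M q ((υ.set 22 (bucketIdx n q κ)).set 20 c) (l.take s) :=
        hB.congr fun b => by rw [arr_set _ (by decide), arr_set _ (by decide), e5]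
      have := hB'.insert hx rfl hcdef (by
        have h3 : (l.take s).length ≤ l.length := (List.take_sublist s l).length_le
        omega)
      rw [← List.take_succ_eq_append_getElem hs] at this
      exact this.congr fun b => by rw [arr_set _ (by decide)]
    · intro b hb'
      have h1 := bucketIdx_bounds (q := q) hκ (show c + 1 < radix n by omega)
      simp only [arr_set _ (show 1 ≠ 14 by decide), arr_set _ (show 1 ≠ 20 by decide),
        arr_set _ (show 1 ≠ 22 by decide),
        arr_put _ (show 5 < 8 by decide) (show 5 < 8 by decide), true_and]
      rw [if_neg (by omega), if_neg (by omega), e5]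
      exact hfr b hb'
  · rintro τ hbτ - ⟨hF, hB, hfr⟩
    rw [List.take_length] at hB
    exact ⟨hF, hB, hfr⟩

/-- A vector that sets the answer. -/
def Hit (w : ℕ) (h : ℕ → Fin n → F4) (f : Fin n → F4) : Prop :=
  hammingNorm f ≤ w ∧ ∃ l < 2 * n, symp (h l) f ≠ 0

theorem wp_testVector (hn : 1 ≤ n) {M' w : ℕ} (hM : 2 * n * (M' * M) < radix n)
    (hMb : M < radix n) {h : ℕ → Fin n → F4} {f : Fin n → F4} (hb : Bounded (digits n) σ)
    (hσ : Env m g σ) (h9 : σ.reg 9 = w) (hw : w < 2 ^ digits n)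
    (hH : ∀ l < 2 * n, Packs M' (σ.arr 2 l) (h l)) (hf : Packs M (σ.reg 15) f) :
    Wp (digits n) testVector (12 * n + 12) (fun τ => Frame [0, 16, 17] [] σ τ ∧
      (τ.reg 0 = σ.reg 0 ∧ ¬ Hit w h f ∨ τ.reg 0 = w ∧ Hit w h f)) σ := by
  have hz := nine_le_digits n
  refine wp_seq_le (4 * n + 8) (8 * n + 2 + 1) (by omega) _ (wp_weigh hb hσ hMb hf) ?_
  rintro τ hbτ ⟨hF, h17⟩
  have hE := hσ.frame hF (by decide) (by decide)
  have e9 : τ.reg 9 = w := by rw [hF.reg 9 (by decide), h9]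
  have e0 : τ.reg 0 = σ.reg 0 := hF.reg 0 (by decide)
  have hF0 : Frame [0, 16, 17] [] σ τ := hF.mono (by decide) (by decide)
  refine wp_ite hz hbτ rfl (fun h0 => ?_) (fun h0 => ?_)
  · have h1 : hammingNorm f ≤ w := by simp [e9, h17] at h0; omega
    refine wp_loop_const hz hbτ rfl (2 * n) 2 (fun j υ => Frame [0, 16, 17] [] σ υ ∧
      (υ.reg 0 = σ.reg 0 ∧ (∀ l < j, symp (h l) f = 0) ∨ υ.reg 0 = w ∧ Hit w h f))
      (lt_of_lt_radix ?_) (by omega) ⟨?_, ?_⟩ ?_ ?_ ?_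
    · exact (lt_radix_of_le (by nlinarith)).le
    · exact hF0.set (by decide) (by decide) _
    · left; simp [e0]
    · rintro j hj υ - ⟨hF', -⟩
      simp [hF'.reg 6 (by decide), hσ.reg6]
    · rintro j hj υ hbυ h16 ⟨hF', hI⟩
      have hE' := hσ.frame hF' (by decide) (by decide)
      have hs := eval_sympExpr hE' hn (a := ld 2 (.reg 16)) (b := .reg 15) (e := h j) (f := f)
        (by rw [eval_ld, eval_reg, h16, hF'.arr 2 (by decide) (by decide)]; exact hH j hj)
        (by rw [eval_reg, hF'.reg 15 (by decide)]; exact hf) hM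
      have hF'' := hF'.set (i := 16) (by decide) (by decide) (j + 1)
      refine wp_ite hz hbυ rfl (fun h0 => ?_) (fun h0 => ?_)
      · rw [hs] at h0
        refine wp_assign_add hz hbυ rfl w (by simp [hF'.reg 9 (by decide), h9]) hw
          ⟨by simp [h16], (hF'.set (by decide) (by decide) _).set (by decide) (by decide) _, ?_⟩
        right
        exact ⟨by simp, h1, j, hj, fun e => h0 (by rw [e]; rfl)⟩
      · rw [hs, ZMod.val_eq_zero] at h0
        refine wp_skip_add hz hbυ ⟨h16, hF'', ?_⟩
        rcases hI with ⟨g1, g2⟩ | g1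
        · left
          refine ⟨by simpa using g1, fun l hl => ?_⟩
          rcases Nat.lt_succ_iff_lt_or_eq.1 hl with hl | rfl
          exacts [g2 l hl, h0]
        · right; simpa using g1
    · rintro υ hbυ - ⟨hF', hI⟩
      refine ⟨hF', hI.imp_left fun ⟨g1, g2⟩ => ⟨g1, ?_⟩⟩
      rintro ⟨-, l, hl, hne⟩
      exact hne (g2 l hl)
  · have h1 : ¬ hammingNorm f ≤ w := by simp [e9, h17] at h0; omega
    exact wp_skip_add hz hbτ ⟨hF0, Or.inl ⟨e0, fun h => h1 h.1⟩⟩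

/-- The time is governed by the number of matching pairs, which is the sum of the lengths of the
buckets that are looked up. Their number is compared with the number of balanced dual vectors in
`IsReduction.sum_bucket_le`. -/
theorem wp_lookupList (hn : 1 ≤ n) (hr : r ≤ n) {M' w : ℕ} (hM : 2 * n * (M' * (M + M)) < radix n)
    (hM' : 1 ≤ M') (hq : q < radix n) {l l' : List (Fin n → F4)} (hl : l.length + 3 < radix n)
    (hl' : l'.length < radix n) {h : ℕ → Fin n → F4}
    (hb : Bounded (digits n) σ) (hσ : Env m g σ) (h0 : σ.reg 0 = 0) (h8 : σ.reg 8 = q)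
    (h9 : σ.reg 9 = w) (hw : w < 2 ^ digits n) (h19 : σ.reg 19 = l'.length)
    (hH : ∀ l < 2 * n, Packs M' (σ.arr 2 l) (h l))
    (hS : Stored Φ M σ l') (hB : Buckets g Φ M q σ l) :
    Wp (digits n) lookupList (∑ s ∈ Finset.range l'.length,
        (3 * n + 20 + (bucket g Φ l (key g (Φ (l'.getD s 0)))).length * (12 * n + 20)) + 2)
      (fun τ => Frame [0, 14, 15, 16, 17, 20, 21, 22, 23, 24] [] σ τ ∧
        (τ.reg 0 = 0 ∧ (∀ b ∈ l', ∀ a ∈ l, key g (Φ a) = key g (Φ b) → ¬ Hit w h (Φ (b + a))) ∨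
        τ.reg 0 = w ∧ ∃ b ∈ l', ∃ a ∈ l, key g (Φ a) = key g (Φ b) ∧ Hit w h (Φ (b + a)))) σ := by
  have hz := nine_le_digits n
  have hMM : M + M ≤ M' * (M + M) := Nat.le_mul_of_pos_left _ hM'
  have hM1 : 2 * n * (M + M) < radix n := lt_of_le_of_lt (Nat.mul_le_mul_left _ hMM) hM
  have hM2 : 2 * n * M < radix n := lt_of_le_of_lt (Nat.mul_le_mul_left _ (by omega)) hM1
  have hMb : M + M < radix n := by nlinarith
  refine (wp_loop hz hb rfl l'.length
    (fun s => (bucket g Φ l (key g (Φ (l'.getD s 0)))).length * (12 * n + 16) + 3 * n + 14)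
    (fun s τ => Frame [0, 14, 15, 16, 17, 20, 21, 22, 23, 24] [] σ τ ∧
        (τ.reg 0 = 0 ∧ (∀ b ∈ l'.take s, ∀ a ∈ l, key g (Φ a) = key g (Φ b) →
          ¬ Hit w h (Φ (b + a))) ∨
        τ.reg 0 = w ∧ ∃ b ∈ l', ∃ a ∈ l, key g (Φ a) = key g (Φ b) ∧ Hit w h (Φ (b + a))))
    (lt_of_lt_radix (by omega)) ⟨?_, ?_⟩ ?_ ?_ ?_).mono ?_ fun _ _ h => h
  · exact (Frame.refl _ _ _).set (by decide) (by decide) _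
  · left; simp [h0]
  · rintro j hj τ - ⟨hF, -⟩
    simp [hF.reg 19 (by decide), h19]
  · rintro s hs τ hbτ h14 ⟨hF, hI⟩
    have hE := hσ.frame hF (by decide) (by decide)
    have hgetD : l'.getD s 0 = l'[s] := by simp [hs]
    rw [hgetD]
    have hitem : Item Φ M (τ.arr 4 s) l'[s] := by
      rw [hF.arr 4 (by decide) (by decide)]
      exact hS s _ (List.getElem?_eq_getElem hs)
    have hx := hitem.div
    have hxlt := hx.lt_digits (show M < radix n by omega)
    set x := τ.arr 4 s / radix n with hxdef
    refine wp_assign_seq hz hbτ rfl x (by simp [h14, hE.reg5, hxdef]) hxlt fun hb1 => ?_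
    refine wp_assign_seq hz hb1 rfl x (by simp) hxlt fun hb1' => ?_
    have hF1 : Frame [15, 23] [] τ ((τ.set 15 x).set 23 x) :=
      ((Frame.refl _ _ _).set (by decide) (by decide) _).set (by decide) (by decide) _
    have hE1 := hE.frame hF1 (by decide) (by decide)
    refine wp_seq_le (3 * n + 3)
      (((bucket g Φ l (key g (Φ l'[s]))).length * (12 * n + 16) + 2) + 1 + 1) (by omega) _
      (wp_computeKey hn hr hM2 hb1' hE1 (f := Φ l'[s]) (by simpa using hx)) ?_
    rintro υ hbυ ⟨hF2, h17⟩
    have hF12 : Frame [15, 17, 21, 23] [] τ υ :=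
      (hF1.mono (by decide) (by decide)).trans (hF2.mono (by decide) (by decide))
    have hE2 := hE1.frame hF2 (by decide) (by decide)
    have hκ : key g (Φ l'[s]) < radix n :=
      (keyUpTo_lt g _ r).trans (two_pow_lt_radix hr)
    obtain ⟨hB1, hB2⟩ := hB _ hκ
    set κ := key g (Φ l'[s]) with hκdef
    set c := (bucket g Φ l κ).length with hcdef
    have hcl : c + 3 < radix n := by
      have h1 := length_bucket_le (g := g) (Φ := Φ) l κ
      omega
    have e5 : ∀ b, υ.arr 5 b = σ.arr 5 b := fun b => by
      rw [hF12.arr 5 (by decide) (by decide), hF.arr 5 (by decide) (by decide)]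
    have e8 : υ.reg 8 = q := by rw [hF12.reg 8 (by decide), hF.reg 8 (by decide), h8]
    have e23 : υ.reg 23 = x := by rw [hF2.reg 23 (by decide)]; simp
    refine wp_assign_seq hz hbυ rfl (bucketIdx n q κ) (by simp [e8, h17, hE2.reg5, bucketIdx])
      (bucketIdx_lt hn hq hκ) fun hb2 => ?_
    refine wp_assign_seq hz hb2 rfl c (by simp [arr_set, e5, hB1])
      (lt_of_lt_radix (by omega)) fun hb3 => ?_
    have hF3 : Frame [0, 15, 16, 17, 20, 21, 22, 23, 24] [] τ
        ((υ.set 22 (bucketIdx n q κ)).set 20 c) :=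
      ((hF12.mono (by decide) (by decide)).set (by decide) (by decide) _).set
        (by decide) (by decide) _
    refine wp_loop_const hz hb3 rfl c (12 * n + 14)
      (fun j ω => Frame [0, 15, 16, 17, 20, 21, 22, 23, 24] [] τ ω ∧ ω.reg 20 = c ∧
        ω.reg 22 = bucketIdx n q κ ∧ ω.reg 23 = x ∧
        (ω.reg 0 = 0 ∧ (∀ b ∈ l'.take s, ∀ a ∈ l, key g (Φ a) = key g (Φ b) →
          ¬ Hit w h (Φ (b + a))) ∧ (∀ a ∈ (bucket g Φ l κ).take j, ¬ Hit w h (Φ (l'[s] + a))) ∨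
        ω.reg 0 = w ∧ ∃ b ∈ l', ∃ a ∈ l, key g (Φ a) = key g (Φ b) ∧ Hit w h (Φ (b + a))))
      (lt_of_lt_radix (by omega)) (by ring_nf; omega) ⟨?_, ?_, ?_, ?_, ?_⟩ ?_ ?_ ?_
    · exact hF3.set (by decide) (by decide) _
    · simp
    · simp
    · simp [e23]
    · simpa [hF12.reg 0 (by decide)] using hI
    · rintro j hj ω - ⟨-, h20, -⟩
      simpa using h20
    · rintro j hj ω hbω h24 ⟨hFω, h20, h22, h23, hJ⟩
      set a := (bucket g Φ l κ)[j] with ha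
      have hat : (bucket g Φ l κ).take (j + 1) = (bucket g Φ l κ).take j ++ [a] :=
        List.take_succ_eq_append_getElem hj
      have hamem : a ∈ l ∧ key g (Φ a) = κ := by
        have := List.getElem_mem hj
        rw [← ha] at this
        simpa [bucket] using this
      have hFσ : Frame [0, 14, 15, 16, 17, 20, 21, 22, 23, 24] [] σ ω :=
        hF.trans (hFω.mono (by decide) (by decide))
      have hEω := hσ.frame hFσ (by decide) (by decide)
      have hxa : Packs M (ω.arr 5 (bucketIdx n q κ + (j + 1))) (Φ a) := by
        rw [hFσ.arr 5 (by decide) (by decide)]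
        exact hB2 j a (List.getElem?_eq_getElem hj)
      have hsum := hx.add hxa
      rw [← map_add] at hsum
      refine wp_assign_seq hz hbω rfl _ (by simp only [eval_add, eval_reg, eval_ld, eval_one,
        h22, h23, h24]) (hsum.lt_digits hMb) fun hb5 => ?_
      have hF5 : Frame [15] [] ω
          (ω.set 15 (x + ω.arr 5 (bucketIdx n q κ + (j + 1)))) :=
        (Frame.refl _ _ _).set (by decide) (by decide) _
      refine (wp_testVector hn (w := w) hM hMb (h := h) (f := Φ (l'[s] + a)) hb5
        (hEω.frame hF5 (by decide) (by decide))
        (by rw [hF5.reg 9 (by decide), hFσ.reg 9 (by decide), h9]) hw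
        (fun i hi => by
          rw [hF5.arr 2 (by decide) (by decide), hFσ.arr 2 (by decide) (by decide)]
          exact hH i hi) (by simpa using hsum)).mono (by omega) ?_
      rintro χ hbχ ⟨hF6, hres⟩
      have hF56 : Frame [0, 15, 16, 17] [] ω χ :=
        (hF5.mono (by decide) (by decide)).trans (hF6.mono (by decide) (by decide))
      refine ⟨by rw [hF56.reg 24 (by decide), h24], (hFω.trans
        (hF56.mono (by decide) (by decide))).set (by decide) (by decide) _,
        by simp [hF56.reg 20 (by decide), h20], by simp [hF56.reg 22 (by decide), h22],
        by simp [hF56.reg 23 (by decide), h23], ?_⟩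
      simp only [reg_set, show (0 : ℕ) ≠ 24 by decide, if_false, show (0 : ℕ) ≠ 15 by decide]
        at hres ⊢
      rcases hres with ⟨g1, g2⟩ | ⟨g1, g2⟩
      · rw [g1]
        refine hJ.imp_left fun ⟨k1, k2, k3⟩ => ⟨k1, k2, fun b hb' => ?_⟩
        rw [hat, List.mem_append, List.mem_singleton] at hb'
        rcases hb' with hb' | rfl
        exacts [k3 b hb', g2]
      · exact Or.inr ⟨g1, _, List.getElem_mem hs, a, hamem.1, hamem.2, g2⟩
    · rintro ω hbω - ⟨hFω, -, -, -, hJ⟩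
      refine ⟨by rw [hFω.reg 14 (by decide), h14], (hF.trans
        (hFω.mono (by decide) (by decide))).set (by decide) (by decide) _, ?_⟩
      simp only [reg_set, show (0 : ℕ) ≠ 14 by decide, if_false]
      refine hJ.imp_left fun ⟨k1, k2, k3⟩ => ⟨k1, fun b hb' a ha hab => ?_⟩
      rw [List.take_succ_eq_append_getElem hs, List.mem_append, List.mem_singleton] at hb'
      rcases hb' with hb' | rfl
      · exact k2 b hb' a ha hab
      · refine k3 a ?_
        rw [List.take_length]
        simp [bucket, ha, hab, hκdef]
  · rintro τ hbτ - ⟨hF, hI⟩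
    rw [List.take_length] at hI
    exact ⟨hF, hI⟩
  · refine Nat.add_le_add_right (Finset.sum_le_sum fun s _ => ?_) 2
    have := Nat.mul_le_mul_left (bucket g Φ l (key g (Φ (l'.getD s 0)))).length
      (show 12 * n + 16 ≤ 12 * n + 20 by omega)
    omega

end

/-! ### Matches and elements of the dual code -/

section Semantics

variable {n r m : ℕ} (g : Fin r → Fin n → F4)

/-- `f` is orthogonal to all generators. -/
def Dual (f : Fin n → F4) : Prop := ∀ j, symp (g j) f = 0

/-- The number of nonzero entries at the `j` positions from `t₀` on. -/
def weightOn (π : Fin n → Fin n) (t₀ j : ℕ) (f : Fin n → F4) : ℕ :=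
  (Finset.univ.filter fun t : Fin n => (t₀ ≤ (t : ℕ) ∧ (t : ℕ) < t₀ + j) ∧ f (π t) ≠ 0).card

/-- `f` has low weight on the first and on the second `m` positions. -/
def HalvesLight (π : Fin n → Fin n) (m v : ℕ) (f : Fin n → F4) : Prop :=
  weightOn π 0 m f ≤ v ∧ weightOn π m m f ≤ v

open Classical in
/-- The number of balanced vectors orthogonal to all generators. -/
noncomputable def pairCount (π : Fin n → Fin n) (m v : ℕ) : ℕ :=
  (Finset.univ.filter fun f : Fin n → F4 => Dual g f ∧ HalvesLight π m v f).card

/-- No nonzero vector orthogonal to all generators vanishes on the window. -/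
def NoDefect (π : Fin n → Fin n) (a : ℕ) : Prop := ∀ f, Dual g f → Vanishes π a f → f = 0

variable {g} {π : Fin n → Fin n} {Φ : (Fin n → F4) →+ (Fin n → F4)}

/-- The part of `f` at the `j` positions from `t₀` on. -/
noncomputable def restrictTo (hπ : Function.Bijective π) (t₀ j : ℕ) (f : Fin n → F4) :
    Fin n → F4 := fun i =>
  if t₀ ≤ ((Equiv.ofBijective π hπ).symm i : ℕ) ∧ ((Equiv.ofBijective π hπ).symm i : ℕ) < t₀ + j
  then f i else 0

theorem restrictTo_apply (hπ : Function.Bijective π) (t₀ j : ℕ) (f : Fin n → F4) (t : Fin n) :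
    restrictTo hπ t₀ j f (π t) = if t₀ ≤ (t : ℕ) ∧ (t : ℕ) < t₀ + j then f (π t) else 0 := by
  have : (Equiv.ofBijective π hπ).symm (π t) = t := by
    rw [Equiv.symm_apply_eq]; rfl
  simp only [restrictTo, this]

theorem supportedOn_restrictTo (hπ : Function.Bijective π) (t₀ j : ℕ) (f : Fin n → F4) :
    SupportedOn π t₀ j (restrictTo hπ t₀ j f) := fun t ht => by
  rw [restrictTo_apply, if_neg ht]

theorem hammingNorm_eq_weightOn (hπ : Function.Bijective π) {t₀ j : ℕ} {f : Fin n → F4}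
    (hf : SupportedOn π t₀ j f) : hammingNorm f = weightOn π t₀ j f := by
  symm
  refine Finset.card_bij (fun t _ => π t) ?_ (fun _ _ _ _ h => hπ.1 h) ?_
  · intro t ht
    simpa using (Finset.mem_filter.1 ht).2.2
  · intro i hi
    obtain ⟨t, rfl⟩ := hπ.2 i
    simp only [Finset.mem_filter, Finset.mem_univ, true_and] at hi ⊢
    refine ⟨t, ⟨?_, hi⟩, rfl⟩
    by_contra h
    exact hi (hf t h)

theorem weightOn_congr {t₀ j : ℕ} {f f' : Fin n → F4}
    (h : ∀ t : Fin n, t₀ ≤ (t : ℕ) ∧ (t : ℕ) < t₀ + j → f (π t) = f' (π t)) :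
    weightOn π t₀ j f = weightOn π t₀ j f' := by
  unfold weightOn
  congr 1; ext t
  simp only [Finset.mem_filter, Finset.mem_univ, true_and, and_congr_right_iff]
  intro ht
  rw [h t ht]

theorem hammingNorm_restrictTo (hπ : Function.Bijective π) (t₀ j : ℕ) (f : Fin n → F4) :
    hammingNorm (restrictTo hπ t₀ j f) = weightOn π t₀ j f := by
  rw [hammingNorm_eq_weightOn hπ (supportedOn_restrictTo hπ t₀ j f)]
  exact weightOn_congr fun t ht => by rw [restrictTo_apply, if_pos ht]

/-- The image of a unit vector outside the window is orthogonal to all generators and still vanishes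
on the window. -/
theorem IsReduction.eq_zero_of_noDefect (h : IsReduction g π (2 * m) r Φ)
    (hπ : Function.Bijective π) (hg : NoDefect g π (2 * m)) {l : ℕ} (hl : 4 * m ≤ l) :
    Φ (unitVec π l) = 0 := by
  have hv := vanishes_unitVec hπ.1 (show 2 * (2 * m) ≤ l by omega)
  refine hg _ (fun j => h.orth j j.2 _ hv) fun t ht => ?_
  rw [h.keeps _ t ht, hv t ht]

theorem add_self_vec (f : Fin n → F4) : f + f = 0 := by
  funext i
  have : ∀ x : F4, x + x = 0 := by decide
  exact this _

theorem dual_add_iff_key {f f' : Fin n → F4} : Dual g (f + f') ↔ key g f = key g f' := by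
  rw [key_eq_iff]
  refine forall_congr' fun j => ?_
  rw [symp_add_right]
  exact CharTwo.add_eq_zero

/-- If `Φ` kills everything outside the window, then `f = Φ f` is the image of the part of `f` in
the window, which is the sum of its two halves. The syndromes of the halves agree because their sum
is the syndrome of `f`. -/
theorem IsReduction.exists_pair (h : IsReduction g π (2 * m) r Φ) (hπ : Function.Bijective π)
    (hm : 2 * m ≤ n) (h0 : ∀ l, 4 * m ≤ l → l < 2 * n → Φ (unitVec π l) = 0) {v : ℕ}
    {f : Fin n → F4} (hf : Dual g f) (hb : HalvesLight π m v f) :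
    ∃ b ∈ lowWeight π v m m, ∃ a ∈ lowWeight π v 0 m, key g (Φ a) = key g (Φ b) ∧
      Φ (b + a) = f := by
  set a := restrictTo hπ 0 m f with ha
  set b := restrictTo hπ m m f with hb'
  have hΦ : Φ (b + a) = f := by
    conv_rhs => rw [← h.fixes f hf]
    have hz : Φ (f + (b + a)) = 0 := by
      refine hom_eq_zero_of_unitVec hπ Φ (a := 2 * m) (fun l hl => h0 l (by omega)) fun t ht => ?_
      simp only [Pi.add_apply, ha, hb', restrictTo_apply]
      have h2 : ∀ x : F4, x + x = 0 := by decide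
      by_cases h3 : (t : ℕ) < m
      · rw [if_neg (by omega), if_pos (by omega), zero_add, h2]
      · rw [if_pos (by omega), if_neg (by omega), add_zero, h2]
    rw [map_add] at hz
    have := congrArg (Φ f + ·) hz
    simp only [← add_assoc, add_self_vec, zero_add, add_zero] at this
    exact this
  refine ⟨b, (mem_lowWeight hπ (by omega)).2 ⟨?_, supportedOn_restrictTo hπ _ _ _⟩,
    a, (mem_lowWeight hπ (by omega)).2 ⟨?_, supportedOn_restrictTo hπ _ _ _⟩, ?_, hΦ⟩
  · rw [hb', hammingNorm_restrictTo]; exact hb.2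
  · rw [ha, hammingNorm_restrictTo]; exact hb.1
  · rw [eq_comm, ← dual_add_iff_key, ← map_add, hΦ]; exact hf

theorem List.sum_range_getD {α : Type*} (l : List α) (d : α) (F : α → ℕ) :
    ∑ s ∈ Finset.range l.length, F (l.getD s d) = (l.map F).sum := by
  rw [← Fin.sum_univ_fun_getElem, Finset.sum_range]
  exact Finset.sum_congr rfl fun i _ => by simp

-- A match gives the dual vector `Φ (b + a)`, which agrees with `b + a` on the window. It therefore
-- has light halves and determines `a` and `b`. No assumption on defects is needed.
open Classical in
theorem IsReduction.sum_bucket_le (h : IsReduction g π (2 * m) r Φ) (hπ : Function.Bijective π)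
    (hm : 2 * m ≤ n) (v : ℕ) :
    ∑ s ∈ Finset.range (lowWeight π v m m).length,
      (bucket g Φ (lowWeight π v 0 m) (key g (Φ ((lowWeight π v m m).getD s 0)))).length
      ≤ pairCount g π m v := by
  have hL := nodup_lowWeight hπ (v := v) (t₀ := 0) (j := m) (by omega)
  have hR := nodup_lowWeight hπ (v := v) (t₀ := m) (j := m) (by omega)
  rw [List.sum_range_getD (lowWeight π v m m) 0 fun b =>
    (bucket g Φ (lowWeight π v 0 m) (key g (Φ b))).length, ← List.sum_toFinset _ hR]
  have hcard : ∀ b, (bucket g Φ (lowWeight π v 0 m) (key g (Φ b))).length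
      = (bucket g Φ (lowWeight π v 0 m) (key g (Φ b))).toFinset.card := fun b =>
    (List.toFinset_card_of_nodup (hL.filter _)).symm
  simp only [hcard]
  rw [← Finset.card_sigma]
  refine Finset.card_le_card_of_injOn (fun x => Φ (x.1 + x.2)) ?_ ?_
  · rintro ⟨b, a⟩ hx
    simp only [Finset.coe_sigma, Set.mem_sigma_iff, Finset.mem_coe, List.mem_toFinset, bucket,
      List.mem_filter, decide_eq_true_eq] at hx
    obtain ⟨hb, ha, hk⟩ := hx
    obtain ⟨hb1, hb2⟩ := (mem_lowWeight hπ (by omega)).1 hb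
    obtain ⟨ha1, ha2⟩ := (mem_lowWeight hπ (by omega)).1 ha
    simp only [Finset.coe_filter, Finset.mem_univ, true_and, Set.mem_ofPred_eq]
    refine ⟨?_, ?_, ?_⟩
    · rw [map_add, dual_add_iff_key, hk]
    · rw [weightOn_congr (f' := a), ← hammingNorm_eq_weightOn hπ ha2]
      · exact ha1
      · intro t ht
        rw [h.keeps _ t (by omega), Pi.add_apply, hb2 t (by omega), zero_add]
    · rw [weightOn_congr (f' := b), ← hammingNorm_eq_weightOn hπ hb2]
      · exact hb1
      · intro t ht
        rw [h.keeps _ t (by omega), Pi.add_apply, ha2 t (by omega), add_zero]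
  · rintro ⟨b, a⟩ hx ⟨b', a'⟩ hx' he
    simp only [Finset.coe_sigma, Set.mem_sigma_iff, Finset.mem_coe, List.mem_toFinset, bucket,
      List.mem_filter, decide_eq_true_eq] at hx hx'
    obtain ⟨-, hb2⟩ := (mem_lowWeight hπ (by omega)).1 hx.1
    obtain ⟨-, ha2⟩ := (mem_lowWeight hπ (by omega)).1 hx.2.1
    obtain ⟨-, hb2'⟩ := (mem_lowWeight hπ (by omega)).1 hx'.1
    obtain ⟨-, ha2'⟩ := (mem_lowWeight hπ (by omega)).1 hx'.2.1
    have key : ∀ t : Fin n, (t : ℕ) < 2 * m → b (π t) + a (π t) = b' (π t) + a' (π t) := by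
      intro t ht
      have := congrFun he (π t)
      simpa only [h.keeps _ t ht, Pi.add_apply] using this
    have e1 : b = b' := by
      funext i
      obtain ⟨t, rfl⟩ := hπ.2 i
      by_cases ht : m ≤ (t : ℕ) ∧ (t : ℕ) < m + m
      · have := key t (by omega)
        rwa [ha2 t (by omega), ha2' t (by omega), add_zero, add_zero] at this
      · rw [hb2 t ht, hb2' t ht]
    have e2 : a = a' := by
      funext i
      obtain ⟨t, rfl⟩ := hπ.2 i
      by_cases ht : 0 ≤ (t : ℕ) ∧ (t : ℕ) < 0 + m
      · have := key t (by omega)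
        rwa [hb2 t (by omega), hb2' t (by omega), zero_add, zero_add] at this
      · rw [ha2 t ht, ha2' t ht]
    rw [e1, e2]

end Semantics

/-! ### One stage of the search -/

/-- Register `7` becomes `1` if some vector with index at least `reg 13` is not zero. -/
def checkActive : RamProg :=
  loop 14 (.reg 6 - .reg 13) <|
    .seq (.assign 15 (ld 3 (.reg 13 + .reg 14))) <|
    .seq weigh <|
    .ite (.reg 17) (.assign 7 1) .skip

/-- Search with the window number `reg 8`. -/
def stage : RamProg :=
  .seq (.assign 9 (.reg 8 / (.reg 2 * (.reg 4 + 1)) + 1)) <|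
  .seq (.assign 11 ((reg 8 / (.reg 4 + 1)).mod (.reg 2))) <|
  .seq (.assign 12 ((reg 8).mod (.reg 4 + 1))) <|
  .seq (.assign 10 (.reg 9 * .reg 4 / .reg 2 + 1)) <|
  .seq initUnits <|
  .seq eliminate <|
  .seq checkActive <|
  .seq (.assign 18 0) <|
  .seq buildList <|
  .seq insertList <|
  .seq (.assign 18 (.reg 4)) <|
  .seq buildList lookupList

/-- The order of the positions for the parameters `p`, `i`. -/
def order {n : ℕ} (hn : 1 ≤ n) (m p i : ℕ) (t : Fin n) : Fin n :=
  ⟨position n m p i t, Nat.mod_lt _ hn⟩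

/-- Up to the cyclic shift by `p`, the order sends the first `m` indices to `i, …, i + m - 1`, the
next `i` indices to `0, …, i - 1`, and fixes the others. Thus the first half is a block inside the
window and the second half is the rest of the window. -/
theorem order_bijective {n : ℕ} (hn : 1 ≤ n) {m p i : ℕ} (hm : 2 * m ≤ n) (hi : i ≤ m) :
    Function.Bijective (order hn m p i) := by
  rw [Finite.injective_iff_bijective.symm]
  intro s t hst
  have hst' : position n m p i s = position n m p i t := congrArg Fin.val hst
  have hs := s.2
  have ht := t.2
  have e : ∀ t < n, position n m p i t
      = (p + (if t < m then t + i else if t < m + i then t - m else t)) % n := by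
    intro t _
    unfold position
    congr 1
    split_ifs <;> omega
  rw [e s hs, e t ht] at hst'
  have h1 := Nat.ModEq.add_left_cancel' p hst'
  have h2 := Nat.ModEq.eq_of_lt_of_lt h1 (by split_ifs <;> omega) (by split_ifs <;> omega)
  apply Fin.ext
  split_ifs at h2 <;> omega

/-! ### Verification of one stage -/

section

variable {n r m : ℕ} {g : Fin r → Fin n → F4} {σ : RamState}

theorem wp_checkActive (hn : 1 ≤ n) (hr : r ≤ n) (hb : Bounded (digits n) σ) (hσ : Env m g σ)
    {c : ℕ} (h13 : σ.reg 13 = c) {x : ℕ → Fin n → F4}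
    (hX : ∀ l < 2 * n, Packs (2 ^ r) (σ.arr 3 l) (x l)) :
    Wp (digits n) checkActive (2 * n * (4 * n + 14) + 2)
      (fun τ => Frame [7, 14, 15, 16, 17] [] σ τ ∧
        (τ.reg 7 = 0 ↔ σ.reg 7 = 0 ∧ ∀ l, c ≤ l → l < 2 * n → x l = 0)) σ := by
  have hz := nine_le_digits n
  refine wp_loop_const hz hb rfl (2 * n - c) (4 * n + 8 + 2 + 1)
    (fun j τ => Frame [7, 14, 15, 16, 17] [] σ τ ∧
        (τ.reg 7 = 0 ↔ σ.reg 7 = 0 ∧ ∀ l, c ≤ l → l < c + j → x l = 0))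
    (lt_of_lt_radix ?_) (Nat.add_le_add_right (Nat.mul_le_mul (Nat.sub_le _ _) (by omega)) _) ⟨?_, ?_⟩ ?_ ?_ ?_
  · exact (lt_radix_of_le ((Nat.sub_le _ _).trans (by nlinarith))).le
  · exact (Frame.refl _ _ _).set (by decide) (by decide) _
  · simp only [reg_set, show (7 : ℕ) ≠ 14 by decide, if_false]
    exact ⟨fun h => ⟨h, fun l _ _ => by omega⟩, fun h => h.1⟩
  · rintro j hj τ - ⟨hF, -⟩
    simp [hF.reg 6 (by decide), hσ.reg6, hF.reg 13 (by decide), h13]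
  · rintro j hj τ hbτ h14 ⟨hF, hI⟩
    have hE := hσ.frame hF (by decide) (by decide)
    have hx : Packs (2 ^ r) (τ.arr 3 (c + j)) (x (c + j)) := by
      rw [hF.arr 3 (by decide) (by decide)]; exact hX _ (by omega)
    have hrad : 2 ^ r < radix n := two_pow_lt_radix hr
    refine wp_assign_seq hz hbτ rfl (τ.arr 3 (c + j))
      (by simp [hF.reg 13 (by decide), h13, h14]) (hbτ.arr _ _) fun hb1 => ?_
    have hF1 : Frame [15] [] τ (τ.set 15 (τ.arr 3 (c + j))) :=
      (Frame.refl _ _ _).set (by decide) (by decide) _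
    refine wp_seq_le (4 * n + 8) 2 (by omega) _
      (wp_weigh hb1 (hE.frame hF1 (by decide) (by decide)) hrad (f := x (c + j))
        (by simpa using hx)) ?_
    rintro υ hbυ ⟨hF2, h17⟩
    have hF12 : Frame [7, 14, 15, 16, 17] [] σ υ := (hF.trans
      (hF1.mono (by decide) (by decide))).trans (hF2.mono (by decide) (by decide))
    have e14 : υ.reg 14 = j := by
      rw [hF2.reg 14 (by decide), hF1.reg 14 (by decide), h14]
    have e7 : υ.reg 7 = τ.reg 7 := by
      rw [hF2.reg 7 (by decide), hF1.reg 7 (by decide)]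
    refine wp_ite hz hbυ rfl (fun h0 => ?_) (fun h0 => ?_)
    · refine wp_assign hz hbυ rfl (v := 1) rfl (Nat.one_lt_two_pow (by omega))
        ⟨by simp [e14], (hF12.set (by decide) (by decide) _).set (by decide) (by decide) _, ?_⟩
      simp only [eval_reg, h17] at h0
      simp only [reg_set, show (7 : ℕ) ≠ 14 by decide, if_false, if_true, one_ne_zero, false_iff,
        not_and]
      intro _ hall
      exact h0 (by rw [hall (c + j) (by omega) (by omega)]; simp)
    · simp only [eval_reg, h17, hammingNorm_eq_zero] at h0
      refine wp_skip hz hbυ ⟨e14, hF12.set (by decide) (by decide) _, ?_⟩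
      simp only [reg_set, show (7 : ℕ) ≠ 14 by decide, if_false, e7, hI]
      refine and_congr_right fun _ => ⟨fun h l h1 h2 => ?_, fun h l h1 h2 => h l h1 (by omega)⟩
      by_cases e : l = c + j
      · rw [e, h0]
      · exact h l h1 (by omega)
  · rintro τ hbτ - ⟨hF, hI⟩
    refine ⟨hF, hI.trans (and_congr_right fun _ =>
      ⟨fun h l h1 h2 => h l h1 (by omega), fun h l h1 h2 => ?_⟩)⟩
    exact h l h1 (by omega)

/-- The weight that is searched for in stage `q`. -/
def stageWeight (n m q : ℕ) : ℕ := q / (n * (m + 1)) + 1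

/-- The weight bound for the halves of the window when the weight is `w`. -/
def halfWeight (n m w : ℕ) : ℕ := w * m / n + 1

/-- The order of the positions in stage `q`. -/
def stageOrder (hn : 1 ≤ n) (m q : ℕ) : Fin n → Fin n :=
  order hn m (q / (m + 1) % n) (q % (m + 1))

/-- Upper bound for the number of steps of a stage. -/
noncomputable def stageSteps (g : Fin r → Fin n → F4) (π : Fin n → Fin n) (m v : ℕ) : ℕ :=
  100 * (n + 1) ^ 2 *
    (1 + (lowWeight π v 0 m).length + (lowWeight π v m m).length + pairCount g π m v)

-- The time bound and the genuineness of a reported hit hold for every code. Only the completeness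
-- of the search depends on the flag in register `7` being zero.
set_option maxHeartbeats 1000000 in
theorem wp_stage (hn : 1 ≤ n) (hr : r ≤ n) (hm : 2 * m ≤ n) {q : ℕ} (hq : q < n * n * (m + 1))
    {h : ℕ → Fin n → F4} (hb : Bounded (digits n) σ) (hσ : Env m g σ) (h0 : σ.reg 0 = 0)
    (h8 : σ.reg 8 = q) (h13 : σ.reg 13 = 4 * m)
    (hH : ∀ l < 2 * n, Packs (2 ^ r) (σ.arr 2 l) (h l))
    (hfresh : ∀ b, q * radix n * radix n ≤ b → σ.arr 5 b = 0) :
    Wp (digits n) stage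
      (stageSteps g (stageOrder hn m q) m (halfWeight n m (stageWeight n m q)))
      (fun τ => Frame [0, 7, 9, 10, 11, 12, 14, 15, 16, 17, 18, 19, 20, 21, 22, 23, 24] [3, 4, 5]
          σ τ ∧
        (∀ b, (q + 1) * radix n * radix n ≤ b → τ.arr 5 b = 0) ∧
        (τ.reg 7 = 0 → σ.reg 7 = 0) ∧
        (σ.reg 7 = 0 → NoDefect g (stageOrder hn m q) (2 * m) → τ.reg 7 = 0) ∧
        (τ.reg 0 = 0 ∧ (τ.reg 7 = 0 → ∀ f, Dual g f →
            HalvesLight (stageOrder hn m q) m (halfWeight n m (stageWeight n m q)) f →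
            ¬ Hit (stageWeight n m q) h f) ∨
         τ.reg 0 = stageWeight n m q ∧ ∃ f, Dual g f ∧ Hit (stageWeight n m q) h f)) σ := by
  have hz := nine_le_digits n
  have hw : stageWeight n m q ≤ n := by
    rw [stageWeight, Nat.succ_le_iff, Nat.div_lt_iff_lt_mul (by positivity)]
    linarith
  have hp : q / (m + 1) % n < n := Nat.mod_lt _ hn
  have hi : q % (m + 1) ≤ m := Nat.le_of_lt_succ (Nat.mod_lt _ (by omega))
  have hv : halfWeight n m (stageWeight n m q) ≤ m + 1 := by
    rw [halfWeight]
    gcongr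
    exact Nat.div_le_of_le_mul (Nat.mul_le_mul_right _ hw)
  have hqr : q < radix n := by
    refine hq.trans_le (le_trans ?_ (size_bound (le_refl n)).le)
    have h1 : n ≤ 2 ^ n := Nat.lt_two_pow_self.le
    have h2 : m + 1 ≤ 2 * (2 ^ n * 2 ^ n) := by nlinarith
    calc n * n * (m + 1) ≤ n * n * (2 * (2 ^ n * 2 ^ n)) := Nat.mul_le_mul_left _ h2
      _ = (2 * (n * n)) * (2 ^ n * 2 ^ n) := by ring
      _ ≤ _ := Nat.mul_le_mul_right _ (by nlinarith)
  have hsmall : ∀ x ≤ n + 1, x < 2 ^ digits n := fun x hx =>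
    lt_of_lt_radix (lt_radix_of_le (by nlinarith)).le
  have hπ : Function.Bijective (stageOrder hn m q) := order_bijective hn hm hi
  have hM1 : 2 * n * (2 * n * 2 ^ r) < radix n := by
    refine lt_of_le_of_lt ?_ (size_bound hr)
    rw [← mul_assoc]
    exact Nat.mul_le_mul (by nlinarith) (Nat.le_mul_of_pos_left _ (by positivity))
  have hM2 : 2 * n * (2 ^ r * (2 * n * 2 ^ r + 2 * n * 2 ^ r)) < radix n := by
    refine lt_of_le_of_lt ?_ (size_bound hr)
    calc _ = 8 * n ^ 2 * (2 ^ r * 2 ^ r) := by ring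
      _ ≤ _ := Nat.mul_le_mul_right _ (by nlinarith)
  set w := stageWeight n m q with hwdef
  set v := halfWeight n m w with hvdef
  set π := stageOrder hn m q with hπdef
  have hlen : ∀ t₀, (lowWeight π v t₀ m).length + 3 < radix n := fun t₀ => by
    have h1 := length_lowWeight_le (π := π) (v := v) (t₀ := t₀) m
    have h2 := Nat.pow_le_pow_right (n := 4) (by norm_num) (show m ≤ n by omega)
    have h3 := four_pow_lt_radix n
    omega
  set A := (lowWeight π v 0 m).length with hA
  set D := (lowWeight π v m m).length with hD
  -- The budgets of the instructions and procedures of `stage` in their order, with the sum over the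
  -- buckets bounded by `pairCount`.
  have hT : 1 + (1 + (1 + (1 + ((10 * n + 2) + ((n * (16 * n + 18) + 2) +
      ((2 * n * (4 * n + 14) + 2) + (1 + (20 * (n + 1) * A + ((A * (3 * n + 20) + 2) +
      (1 + (20 * (n + 1) * D + (D * (3 * n + 20) + pairCount g π m v * (12 * n + 20) + 2))))))))))))
      ≤ stageSteps g π m v := by
    rw [stageSteps, ← hA, ← hD]
    generalize pairCount g π m v = N
    nlinarith [Nat.zero_le (n * A), Nat.zero_le (n * D), Nat.zero_le (n * N),
      Nat.zero_le (n * n * A), Nat.zero_le (n * n * D), Nat.zero_le (n * n * N)]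
  refine Wp.mono ?_ hT fun _ _ h => h
  refine wp_seq (wp_assign hz hb rfl (v := w) (by simp [h8, hσ.reg2, hσ.reg4, hwdef, stageWeight])
    (hsmall _ (by omega)) fun hb1 => ?_)
  refine wp_seq (wp_assign hz hb1 rfl (v := q / (m + 1) % n) (by simp [h8, hσ.reg2, hσ.reg4])
    (hsmall _ (by omega)) fun hb2 => ?_)
  refine wp_seq (wp_assign hz hb2 rfl (v := q % (m + 1)) (by simp [h8, hσ.reg4])
    (hsmall _ (by omega)) fun hb3 => ?_)
  refine wp_seq (wp_assign hz hb3 rfl (v := v) (by simp [hσ.reg2, hσ.reg4, hvdef, halfWeight])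
    (hsmall _ (by omega)) fun hb4 => ?_)
  have hF4 : Frame [9, 10, 11, 12] [] σ ((((σ.set 9 w).set 11 (q / (m + 1) % n)).set 12
      (q % (m + 1))).set 10 v) :=
    ((((Frame.refl _ _ _).set (by decide) (by decide) _).set (by decide) (by decide) _).set
      (by decide) (by decide) _).set (by decide) (by decide) _
  have e9 : ((((σ.set 9 w).set 11 (q / (m + 1) % n)).set 12 (q % (m + 1))).set 10 v).reg 9 = w := by
    simp
  have e10 : ((((σ.set 9 w).set 11 (q / (m + 1) % n)).set 12 (q % (m + 1))).set 10 v).reg 10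
      = v := by simp
  have e11 : ((((σ.set 9 w).set 11 (q / (m + 1) % n)).set 12 (q % (m + 1))).set 10 v).reg 11
      = q / (m + 1) % n := by simp
  have e12 : ((((σ.set 9 w).set 11 (q / (m + 1) % n)).set 12 (q % (m + 1))).set 10 v).reg 12
      = q % (m + 1) := by simp
  generalize (((σ.set 9 w).set 11 (q / (m + 1) % n)).set 12 (q % (m + 1))).set 10 v = σ₄
    at hb4 hF4 e9 e10 e11 e12
  have hE4 := hσ.frame hF4 (by decide) (by decide)
  refine wp_seq_le _ _ le_rfl _ (wp_initUnits hn (by omega) (π := π) hp.le (hi.trans (by omega))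
    (fun t => rfl) hb4 hE4 e11 e12) ?_
  rintro σ₅ hb5 ⟨hF5, hX5⟩
  have hE5 := hE4.frame hF5 (by decide) (by decide)
  have e13 : σ₅.reg 13 = 2 * (2 * m) := by
    rw [hF5.reg 13 (by decide), hF4.reg 13 (by decide), h13]; ring
  refine wp_seq_le _ _ le_rfl _ (wp_eliminate hn hr hπ hm hb5 hE5 e13 hX5) ?_
  rintro σ₆ hb6 ⟨hF6, Φ, hΦ, hX6⟩
  have hE6 := hE5.frame hF6 (by decide) (by decide)
  refine wp_seq_le _ _ le_rfl _ (wp_checkActive hn hr hb6 hE6 rfl hX6) ?_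
  rintro σ₇ hb7 ⟨hF7, h7⟩
  have hE7 := hE6.frame hF7 (by decide) (by decide)
  rw [hF6.reg 13 (by decide), e13, hF6.reg 7 (by decide), hF5.reg 7 (by decide),
    hF4.reg 7 (by decide)] at h7
  have hF47 : Frame [7, 9, 10, 11, 12, 14, 15, 16, 17] [3] σ σ₇ :=
    (((hF4.mono (by decide) (by decide)).trans (hF5.mono (by decide) (by decide))).trans
      (hF6.mono (by decide) (by decide))).trans (hF7.mono (by decide) (by decide))
  have k9 : σ₇.reg 9 = w := by
    rw [hF7.reg 9 (by decide), hF6.reg 9 (by decide), hF5.reg 9 (by decide), e9]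
  have k10 : σ₇.reg 10 = v := by
    rw [hF7.reg 10 (by decide), hF6.reg 10 (by decide), hF5.reg 10 (by decide), e10]
  refine wp_seq (wp_assign hz hb7 rfl (v := 0) rfl (by positivity) fun hb8 => ?_)
  have hF8 : Frame [18] [] σ₇ (σ₇.set 18 0) := (Frame.refl _ _ _).set (by decide) (by decide) _
  have e18 : (σ₇.set 18 0).reg 18 = 0 := by simp
  generalize σ₇.set 18 0 = σ₈ at hb8 hF8 e18
  have hE8 := hE7.frame hF8 (by decide) (by decide)
  have hX8 : ∀ l < 2 * n, Packs (2 ^ r) (σ₈.arr 3 l) (Φ (unitVec π l)) := fun l hl => by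
    rw [hF8.arr 3 (by decide) (by decide), hF7.arr 3 (by decide) (by decide)]
    exact hX6 l hl
  refine wp_seq_le _ _ le_rfl _ (wp_buildList hr hπ (t₀ := 0) (v := v) (by omega) hb8 hE8
    (by rw [hF8.reg 10 (by decide), k10]) e18 hX8) ?_
  rintro σ₉ hb9 ⟨hF9, h19, hS9⟩
  have hE9 := hE8.frame hF9 (by decide) (by decide)
  have hF49 : Frame [7, 9, 10, 11, 12, 14, 15, 16, 17, 18, 19, 20] [3, 4] σ σ₉ :=
    ((hF47.mono (by decide) (by decide)).trans (hF8.mono (by decide) (by decide))).trans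
      (hF9.mono (by decide) (by decide))
  refine wp_seq_le _ _ le_rfl _ (wp_insertList hn hr hM1 hqr (hlen 0) hb9 hE9
    (by rw [hF49.reg 8 (by decide), h8]) h19 hS9
    (fun b hb' => by rw [hF49.arr 5 (by decide) (by decide)]; exact hfresh b hb')) ?_
  rintro σ₁₀ hb10 ⟨hF10, hB10, hfr10⟩
  have hE10 := hE9.frame hF10 (by decide) (by decide)
  refine wp_seq (wp_assign hz hb10 rfl (v := m) (by simp [hE10.reg4]) (hsmall _ (by omega))
    fun hb11 => ?_)
  have hF11 : Frame [18] [] σ₁₀ (σ₁₀.set 18 m) := (Frame.refl _ _ _).set (by decide) (by decide) _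
  have e18' : (σ₁₀.set 18 m).reg 18 = m := by simp
  generalize σ₁₀.set 18 m = σ₁₁ at hb11 hF11 e18'
  have hE11 := hE10.frame hF11 (by decide) (by decide)
  have hF811 : Frame [14, 15, 16, 17, 18, 19, 20, 21, 22] [4, 5] σ₈ σ₁₁ :=
    ((hF9.mono (by decide) (by decide)).trans (hF10.mono (by decide) (by decide))).trans
      (hF11.mono (by decide) (by decide))
  refine wp_seq_le _ _ le_rfl _ (wp_buildList hr hπ (t₀ := m) (v := v) (by omega) hb11 hE11
    (by rw [hF811.reg 10 (by decide), hF8.reg 10 (by decide), k10]) e18' (Φ := Φ)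
    (fun l hl => by rw [hF811.arr 3 (by decide) (by decide)]; exact hX8 l hl)) ?_
  rintro σ₁₂ hb12 ⟨hF12, h19', hS12⟩
  have hE12 := hE11.frame hF12 (by decide) (by decide)
  have hF412 : Frame [7, 9, 10, 11, 12, 14, 15, 16, 17, 18, 19, 20, 21, 22] [3, 4, 5] σ σ₁₂ :=
    ((hF49.mono (by decide) (by decide)).trans (hF10.mono (by decide) (by decide))).trans
      ((hF11.mono (by decide) (by decide)).trans (hF12.mono (by decide) (by decide)))
  have hF712 : Frame [14, 15, 16, 17, 18, 19, 20, 21, 22] [4, 5] σ₇ σ₁₂ :=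
    (hF8.mono (by decide) (by decide)).trans
      ((hF811.mono (by decide) (by decide)).trans (hF12.mono (by decide) (by decide)))
  have a5 : ∀ b, σ₁₂.arr 5 b = σ₁₀.arr 5 b := fun b => by
    rw [hF12.arr 5 (by decide) (by decide), hF11.arr 5 (by decide) (by decide)]
  refine (wp_lookupList hn hr (M' := 2 ^ r) hM2 Nat.one_le_two_pow hqr (w := w) (h := h) (hlen 0)
    (by have := hlen m; omega) hb12 hE12 (by rw [hF412.reg 0 (by decide), h0])
    (by rw [hF412.reg 8 (by decide), h8]) (by rw [hF712.reg 9 (by decide), k9])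
    (hsmall _ (by omega)) h19'
    (fun l hl => by rw [hF412.arr 2 (by decide) (by decide)]; exact hH l hl) hS12
    (hB10.congr a5)).mono ?_ ?_
  · rw [Finset.sum_add_distrib, ← Finset.sum_mul, Finset.sum_const, Finset.card_range, smul_eq_mul]
    have := hΦ.sum_bucket_le hπ hm v
    gcongr
  · rintro τ hbτ ⟨hF13, hres⟩
    have t7 : τ.reg 7 = σ₇.reg 7 := by
      rw [hF13.reg 7 (by decide), hF712.reg 7 (by decide)]
    refine ⟨(hF412.mono (by decide) (by decide)).trans (hF13.mono (by decide) (by decide)),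
      fun b hb' => ?_, fun ht => ?_, fun hs hg => ?_, ?_⟩
    · rw [hF13.arr 5 (by decide) (by decide), a5]
      exact hfr10 b hb'
    · rw [t7, h7] at ht; exact ht.1
    · rw [t7, h7]
      exact ⟨hs, fun l hl _ => hΦ.eq_zero_of_noDefect hπ hg (by omega)⟩
    · rcases hres with ⟨g1, g2⟩ | ⟨g1, b, hb', a, ha, hk, hhit⟩
      · left
        refine ⟨g1, fun ht f hf hlight hhit => ?_⟩
        rw [t7, h7] at ht
        obtain ⟨b, hb', a, ha, hk, rfl⟩ := hΦ.exists_pair hπ hm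
          (fun l hl hl' => ht.2 l (by omega) hl') hf hlight
        exact g2 b hb' a ha hk hhit
      · right
        exact ⟨g1, _, by rw [map_add, dual_add_iff_key, hk], hhit⟩

end

/-! ### Windows and balanced splits -/

section Balance

variable {n m : ℕ}

/-- A discrete intermediate value argument: `S` moves in steps of at most one between two values
with sum `T`, so it meets the range from `T - v` to `v`. -/
theorem exists_balanced_split {S : ℕ → ℕ} {T v : ℕ} (hends : S 0 + S m = T)
    (hup : ∀ i < m, S (i + 1) ≤ S i + 1) (hdown : ∀ i < m, S i ≤ S (i + 1) + 1)
    (hv : T + 1 ≤ 2 * v) : ∃ i ≤ m, S i ≤ v ∧ T ≤ S i + v := by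
  classical
  by_cases h1 : S 0 ≤ v
  -- The last index qualifies as `S m = T - S 0`. Just before the first index that qualifies, `S` is
  -- below `T - v`, so at that index it has not yet passed `v`.
  · have hex : ∃ i, i ≤ m ∧ T ≤ S i + v := ⟨m, le_rfl, by omega⟩
    obtain ⟨h2, h3⟩ := Nat.find_spec hex
    refine ⟨_, h2, ?_, h3⟩
    rcases Nat.eq_zero_or_pos (Nat.find hex) with h0 | h0
    · rw [h0]; exact h1
    · have h4 := Nat.find_min hex (show Nat.find hex - 1 < Nat.find hex by omega)
      have h5 := hup (Nat.find hex - 1) (by omega)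
      rw [Nat.sub_add_cancel h0] at h5
      omega
  · have hex : ∃ i, i ≤ m ∧ S i ≤ v := ⟨m, le_rfl, by omega⟩
    obtain ⟨h2, h3⟩ := Nat.find_spec hex
    refine ⟨_, h2, h3, ?_⟩
    rcases Nat.eq_zero_or_pos (Nat.find hex) with h0 | h0
    · rw [h0] at h3; exact absurd h3 h1
    · have h4 := Nat.find_min hex (show Nat.find hex - 1 < Nat.find hex by omega)
      have h5 := hdown (Nat.find hex - 1) (by omega)
      rw [Nat.sub_add_cancel h0] at h5
      omega

/-- The indicator function of the support of `f`, extended periodically. -/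
def periodicSupport (hn : 1 ≤ n) (f : Fin n → F4) (j : ℕ) : ℕ :=
  if f ⟨j % n, Nat.mod_lt _ hn⟩ ≠ 0 then 1 else 0

theorem sum_periodicSupport (hn : 1 ≤ n) (f : Fin n → F4) (u : ℕ) :
    ∑ p ∈ Finset.range n, periodicSupport hn f (p + u) = hammingNorm f := by
  induction u with
  | zero =>
    rw [Finset.sum_range, hammingNorm, Finset.card_filter]
    refine Finset.sum_congr rfl fun i _ => ?_
    have : (⟨((i : ℕ) + 0) % n, Nat.mod_lt _ hn⟩ : Fin n) = i :=
      Fin.ext (by simp [Nat.mod_eq_of_lt i.2])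
    rw [periodicSupport, this]
  | succ u ih =>
    rw [← ih]
    have h1 := Finset.sum_range_succ (fun p => periodicSupport hn f (p + u)) n
    have h2 := Finset.sum_range_succ' (fun p => periodicSupport hn f (p + u)) n
    have h3 : periodicSupport hn f (n + u) = periodicSupport hn f (0 + u) := by
      simp [periodicSupport]
    have h4 : ∑ p ∈ Finset.range n, periodicSupport hn f (p + (u + 1))
        = ∑ p ∈ Finset.range n, periodicSupport hn f (p + 1 + u) :=
      Finset.sum_congr rfl fun p _ => by congr 1; ring
    rw [h4]
    omega

theorem weightOn_eq_sum (hn : 1 ≤ n) {p i t₀ : ℕ} (ht : t₀ + m ≤ n) (f : Fin n → F4) {M : ℕ} :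
    weightOn (order hn M p i) t₀ m f
      = ∑ u ∈ Finset.range m, periodicSupport hn f (position n M p i (t₀ + u)) := by
  have hpos : ∀ t : Fin n, periodicSupport hn f (position n M p i t)
      = if f (order hn M p i t) ≠ 0 then 1 else 0 := by
    intro t
    have : (⟨position n M p i t % n, Nat.mod_lt _ hn⟩ : Fin n) = order hn M p i t :=
      Fin.ext (Nat.mod_eq_of_lt (Nat.mod_lt _ hn))
    rw [periodicSupport, this]
  rw [weightOn, ← Finset.filter_filter, Finset.card_filter]
  simp only [← hpos]
  symm
  refine Finset.sum_bij (fun u hu => ⟨t₀ + u, by simp at hu; omega⟩) ?_ ?_ ?_ ?_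
  · intro u hu
    simp only [Finset.mem_range] at hu
    simp only [Finset.mem_filter, Finset.mem_univ, true_and]
    omega
  · intro u _ u' _ h
    simp only [Fin.mk.injEq] at h
    omega
  · intro t ht'
    simp only [Finset.mem_filter, Finset.mem_univ, true_and] at ht'
    exact ⟨t - t₀, by simp; omega, Fin.ext (by simp; omega)⟩
  · intro u _
    rfl

/-- Every position lies in `2m` of the `n` cyclic windows, so some window carries weight at most
`2mw/n`. Sliding the inner block of length `m` from the left end to the right end of this window
balances the halves. -/
theorem exists_halvesLight (hn : 1 ≤ n) (hm : 2 * m ≤ n) (f : Fin n → F4) :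
    ∃ p < n, ∃ i ≤ m, HalvesLight (order hn m p i) m (halfWeight n m (hammingNorm f)) f := by
  set c := periodicSupport hn f with hc
  have hc1 : ∀ j, c j ≤ 1 := fun j => by rw [hc, periodicSupport]; split_ifs <;> omega
  have hper : ∀ j, c (j % n) = c j := fun j => by simp [hc, periodicSupport]
  set w := hammingNorm f
  obtain ⟨p, hp, hT⟩ : ∃ p ∈ Finset.range n,
      n * ∑ u ∈ Finset.range (2 * m), c (p + u) ≤ 2 * m * w := by
    by_contra! hcon
    have h1 := Finset.sum_lt_sum_of_nonempty (by simpa using (by omega : n ≠ 0)) hcon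
    have h2 : ∑ p ∈ Finset.range n, n * ∑ u ∈ Finset.range (2 * m), c (p + u)
        = n * (2 * m * w) := by
      rw [← Finset.mul_sum, Finset.sum_comm]
      simp only [hc, sum_periodicSupport, Finset.sum_const, Finset.card_range, smul_eq_mul, w]
    rw [h2] at h1
    simp only [Finset.sum_const, Finset.card_range, smul_eq_mul] at h1
    exact lt_irrefl _ h1
  set T := ∑ u ∈ Finset.range (2 * m), c (p + u) with hTdef
  -- The weight of the block of `m` positions starting at `p + i`.
  let S : ℕ → ℕ := fun i => ∑ u ∈ Finset.range m, c (p + i + u)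
  have hstep : ∀ i, S (i + 1) + c (p + i) = S i + c (p + i + m) := by
    intro i
    have h1 := Finset.sum_range_succ (fun u => c (p + i + u)) m
    have h2 := Finset.sum_range_succ' (fun u => c (p + i + u)) m
    have h3 : S (i + 1) = ∑ u ∈ Finset.range m, c (p + i + (u + 1)) :=
      Finset.sum_congr rfl fun u _ => by congr 1; ring
    have h4 : S i = ∑ u ∈ Finset.range m, c (p + i + u) := rfl
    simp only [add_zero] at h2
    omega
  -- The summand one in `halfWeight` makes up for rounding down and for the parity of `T`.
  have hv : T + 1 ≤ 2 * halfWeight n m w := by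
    rw [halfWeight]
    have h1 := Nat.lt_mul_div_succ (w * m) (show 0 < n by omega)
    have h2 : n * T < n * (2 * (w * m / n + 1)) := by
      calc n * T ≤ 2 * (w * m) := by linarith
        _ < 2 * (n * (w * m / n + 1)) := by omega
        _ = _ := by ring
    exact Nat.lt_of_mul_lt_mul_left h2
  have hends : S 0 + S m = T := by
    simp only [S]
    rw [hTdef, two_mul, Finset.sum_range_add]
    simp only [add_zero, add_assoc]
  have hup : ∀ i < m, S (i + 1) ≤ S i + 1 := by
    intro i _
    have := hstep i
    have := hc1 (p + i + m)
    omega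
  have hdown : ∀ i < m, S i ≤ S (i + 1) + 1 := by
    intro i _
    have := hstep i
    have := hc1 (p + i)
    omega
  obtain ⟨i, hi, h1, h2⟩ := exists_balanced_split hends hup hdown hv
  · refine ⟨p, by simpa using hp, i, hi, ?_, ?_⟩
    · rw [weightOn_eq_sum hn (by omega)]
      refine le_trans (le_of_eq (Finset.sum_congr rfl fun u hu => ?_)) h1
      simp only [Finset.mem_range] at hu
      rw [position, if_pos (by omega), ← hc, hper]
      congr 1; ring
    · rw [weightOn_eq_sum hn (by omega)]
      -- The second half consists of the `i` positions before the block and the `m - i` positions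
      -- after it.
      have hJ : S i + ∑ u ∈ Finset.range m, c (position n m p i (m + u)) = T := by
        have e1 : ∀ u, c (position n m p i (m + u)) = if u < i then c (p + u) else c (p + m + u) := by
          intro u
          rw [position, if_neg (by omega)]
          split_ifs with h3 h4 h4
          · rw [hper]; congr 1; omega
          · omega
          · omega
          · rw [hper]; congr 1; omega
        simp only [e1]
        obtain ⟨d, rfl⟩ : ∃ d, m = i + d := ⟨m - i, by omega⟩
        have e2 : T = ∑ u ∈ Finset.range i, c (p + u) +
            (∑ u ∈ Finset.range (i + d), c (p + i + u) +
              ∑ u ∈ Finset.range d, c (p + (i + d) + (i + u))) := by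
          rw [hTdef, show 2 * (i + d) = i + ((i + d) + d) by ring, Finset.sum_range_add,
            Finset.sum_range_add]
          congr 1
          congr 1
          · exact Finset.sum_congr rfl fun u _ => by congr 1; ring
          · exact Finset.sum_congr rfl fun u _ => by congr 1; ring
        have e3 : ∑ u ∈ Finset.range (i + d), (if u < i then c (p + u) else c (p + (i + d) + u))
            = ∑ u ∈ Finset.range i, c (p + u) + ∑ u ∈ Finset.range d, c (p + (i + d) + (i + u)) := by
          rw [Finset.sum_range_add]
          congr 1
          · refine Finset.sum_congr rfl fun u hu => ?_
            rw [if_pos (by simpa using hu)]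
          · refine Finset.sum_congr rfl fun u hu => ?_
            rw [if_neg (by omega)]
        rw [e2, e3]
        simp only [S]
        omega
      rw [← hc]
      omega

end Balance

/-! ### The search over weights, windows and splits -/

section Search

variable {n r m : ℕ} {g : Fin r → Fin n → F4}

/-- A stage number encodes `w - 1`, `p` and `i` in mixed radix, with the weight as the leading
digit. Hence the weights increase along the stages. -/
theorem exists_stage (hn : 1 ≤ n) (hm : 2 * m ≤ n) {f : Fin n → F4} (hf : f ≠ 0) :
    ∃ q < n * n * (m + 1), stageWeight n m q = hammingNorm f ∧
      HalvesLight (stageOrder hn m q) m (halfWeight n m (stageWeight n m q)) f := by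
  obtain ⟨p, hp, i, hi, h⟩ := exists_halvesLight hn hm f
  have hw1 : 1 ≤ hammingNorm f := hammingNorm_pos_iff.2 hf
  have hwn : hammingNorm f ≤ n := by simpa using hammingNorm_le_card_fintype (x := f)
  set w := hammingNorm f
  obtain ⟨w', hw'⟩ : ∃ w', w = w' + 1 := ⟨w - 1, by omega⟩
  have hw'n : w' < n := by omega
  have e1 : ((w' * n + p) * (m + 1) + i) / (m + 1) = w' * n + p := by
    rw [mul_comm, Nat.mul_add_div (by omega), Nat.div_eq_of_lt (by omega), add_zero]
  have e2 : ((w' * n + p) * (m + 1) + i) % (m + 1) = i := by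
    rw [mul_comm, Nat.mul_add_mod, Nat.mod_eq_of_lt (by omega)]
  have e3 : (w' * n + p) / n = w' := by
    rw [mul_comm, Nat.mul_add_div (by omega), Nat.div_eq_of_lt hp, add_zero]
  have e4 : (w' * n + p) % n = p := by
    rw [mul_comm, Nat.mul_add_mod, Nat.mod_eq_of_lt hp]
  have hsw : stageWeight n m ((w' * n + p) * (m + 1) + i) = w := by
    rw [stageWeight, mul_comm n, ← Nat.div_div_eq_div_mul, e1, e3, hw']
  refine ⟨(w' * n + p) * (m + 1) + i, ?_, hsw, ?_⟩
  · have h1 : w' * n + p + 1 ≤ n * n := by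
      have : (w' + 1) * n ≤ n * n := Nat.mul_le_mul_right _ hw'n
      rw [add_mul, one_mul] at this
      omega
    have h2 := Nat.mul_le_mul_right (m + 1) h1
    have h3 : (w' * n + p + 1) * (m + 1) = (w' * n + p) * (m + 1) + (m + 1) := by ring
    omega
  · rw [hsw, stageOrder, e1, e2, e4]
    exact h

/-- The outer loop. -/
def search : RamProg := loop 8 (.reg 2 * .reg 2 * (.reg 4 + 1)) (.ite (.reg 0) .skip stage)

/-- Upper bound for the number of steps of the search for weights up to `W`. -/
noncomputable def searchSteps (g : Fin r → Fin n → F4) (hn : 1 ≤ n) (m W : ℕ) : ℕ :=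
  ∑ q ∈ Finset.range (n * n * (m + 1)),
    ((if stageWeight n m q ≤ W then
      stageSteps g (stageOrder hn m q) m (halfWeight n m (stageWeight n m q)) else 0) + 4) + 2

/-- As long as the flag is zero, the search succeeds at the latest in stage `q₀`, which fits a
vector of weight `d`. A success in a stage of weight at most `d` exhibits a vector of at most that
weight, so the two weights agree. In `hW`, the first alternative serves partial correctness for
arbitrary codes. The second one bounds the time when there are no defects, since later stages are
skipped. -/
theorem wp_search (hn : 1 ≤ n) (hr : r ≤ n) (hm : 2 * m ≤ n) {h : ℕ → Fin n → F4} {d W : ℕ}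
    {σ : RamState} (hb : Bounded (digits n) σ) (hσ : Env m g σ) (h0 : σ.reg 0 = 0)
    (h7 : σ.reg 7 = 0) (h13 : σ.reg 13 = 4 * m)
    (hH : ∀ l < 2 * n, Packs (2 ^ r) (σ.arr 2 l) (h l)) (hfresh : ∀ b, σ.arr 5 b = 0)
    (hd : IsLeast {w | ∃ f, Dual g f ∧ (∃ l < 2 * n, symp (h l) f ≠ 0) ∧ hammingNorm f = w} d)
    (hW : n ≤ W ∨ d ≤ W ∧ ∀ q, NoDefect g (stageOrder hn m q) (2 * m)) :
    Wp (digits n) search (searchSteps g hn m W) (fun τ =>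
      (τ.reg 7 = 0 → τ.reg 0 = d) ∧
      ((∀ q, NoDefect g (stageOrder hn m q) (2 * m)) → τ.reg 7 = 0)) σ := by
  have hz := nine_le_digits n
  obtain ⟨⟨f₀, hf₀, hC₀, hw₀⟩, hmin⟩ := hd
  have hne : f₀ ≠ 0 := by
    rintro rfl
    obtain ⟨l, -, hl⟩ := hC₀
    exact hl (symp_zero_right _)
  obtain ⟨q₀, hq₀, hsw, hlight⟩ := exists_stage hn hm hne
  rw [hw₀] at hsw
  have hhit : Hit (stageWeight n m q₀) h f₀ := ⟨by rw [hw₀, hsw], hC₀⟩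
  have hmono : ∀ q, q ≤ q₀ → stageWeight n m q ≤ d := fun q hq => by
    rw [← hsw]; unfold stageWeight; gcongr
  have hlt : n * n * (m + 1) < 2 ^ digits n := by
    refine lt_of_lt_radix (le_trans ?_ (size_bound (le_refl n)).le)
    have h1 : n ≤ 2 ^ n := Nat.lt_two_pow_self.le
    have h2 : m + 1 ≤ 2 * (2 ^ n * 2 ^ n) := by nlinarith
    calc n * n * (m + 1) ≤ n * n * (2 * (2 ^ n * 2 ^ n)) := Nat.mul_le_mul_left _ h2
      _ = (2 * (n * n)) * (2 ^ n * 2 ^ n) := by ring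
      _ ≤ _ := Nat.mul_le_mul_right _ (by nlinarith)
  refine wp_loop hz hb rfl (n * n * (m + 1)) (fun q => (if stageWeight n m q ≤ W then
      stageSteps g (stageOrder hn m q) m (halfWeight n m (stageWeight n m q)) else 0) + 1 + 1)
    (fun q τ => Frame [0, 7, 8, 9, 10, 11, 12, 14, 15, 16, 17, 18, 19, 20, 21, 22, 23, 24]
        [3, 4, 5] σ τ ∧
      (τ.reg 0 = 0 → ∀ b, q * radix n * radix n ≤ b → τ.arr 5 b = 0) ∧
      ((∀ q, NoDefect g (stageOrder hn m q) (2 * m)) → τ.reg 7 = 0) ∧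
      (τ.reg 7 = 0 → τ.reg 0 = d ∨ τ.reg 0 = 0 ∧ q ≤ q₀)) hlt ⟨?_, ?_, ?_, ?_⟩ ?_ ?_ ?_
  · exact (Frame.refl _ _ _).set (by decide) (by decide) _
  · intro _ b _
    rw [arr_set _ (by decide)]
    exact hfresh b
  · simp [h7]
  · simp [h0]
  · rintro q hq τ - ⟨hF, -⟩
    simp [hF.reg 2 (by decide), hF.reg 4 (by decide), hσ.reg2, hσ.reg4]
  · rintro q hq τ hbτ h8 ⟨hF, hfr, hgood, hans⟩
    have hE := hσ.frame hF (by decide) (by decide)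
    refine wp_ite hz hbτ rfl (fun ha => ?_) (fun ha => ?_)
    · simp only [eval_reg] at ha
      refine wp_skip_add hz hbτ ⟨h8, hF.set (by decide) (by decide) _, ?_, ?_, ?_⟩
      · intro h; exact absurd (by simpa using h) ha
      · simpa using hgood
      · simp only [reg_set, show (7 : ℕ) ≠ 8 by decide, show (0 : ℕ) ≠ 8 by decide, if_false]
        intro h
        exact Or.inl ((hans h).resolve_right fun h' => ha h'.1)
    · simp only [eval_reg] at ha
      -- Without defects a stage is entered with answer zero only if `q ≤ q₀`, so its weight is at
      -- most `d`.
      have hqW : stageWeight n m q ≤ W := by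
        rcases hW with hW | ⟨hW, hall⟩
        · refine le_trans ?_ hW
          rw [stageWeight, Nat.succ_le_iff, Nat.div_lt_iff_lt_mul (by positivity)]
          linarith
        · rcases hans (hgood hall) with h | ⟨-, h⟩
          · have : 1 ≤ d := by rw [← hw₀]; exact hammingNorm_pos_iff.2 hne
            omega
          · exact (hmono q h).trans hW
      rw [if_pos hqW]
      refine (wp_stage hn hr hm hq hbτ hE ha h8 (by rw [hF.reg 13 (by decide), h13])
        (fun l hl => by rw [hF.arr 2 (by decide) (by decide)]; exact hH l hl) (hfr ha)).mono
        (Nat.le_succ _) ?_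
      rintro υ hbυ ⟨hF', hfr', hb1, hb2, hres⟩
      refine ⟨by rw [hF'.reg 8 (by decide), h8], ((hF.trans (hF'.mono (by decide)
        (by decide)))).set (by decide) (by decide) _, ?_, ?_, ?_⟩
      · intro _ b hb'
        rw [arr_set _ (by decide)]
        exact hfr' b hb'
      · simp only [reg_set, show (7 : ℕ) ≠ 8 by decide, if_false]
        exact fun hall => hb2 (hgood hall) (hall q)
      · simp only [reg_set, show (7 : ℕ) ≠ 8 by decide, show (0 : ℕ) ≠ 8 by decide, if_false]
        intro h
        have hqq : q ≤ q₀ := by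
          rcases hans (hb1 h) with h' | ⟨-, h'⟩
          · have : 1 ≤ d := by rw [← hw₀]; exact hammingNorm_pos_iff.2 hne
            omega
          · exact h'
        rcases hres with ⟨g1, g2⟩ | ⟨g1, f, hf, hfw, hfC⟩
        · refine Or.inr ⟨g1, ?_⟩
          rcases hqq.lt_or_eq with h' | rfl
          · exact h'
          · exact absurd hhit (g2 h f₀ hf₀ hlight)
        · left
          rw [g1]
          exact le_antisymm (hmono q hqq) ((hmin ⟨f, hf, hfC, rfl⟩).trans hfw)
  · rintro τ hbτ - ⟨hF, -, hgood, hans⟩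
    refine ⟨fun h => ?_, hgood⟩
    rcases hans h with h' | ⟨-, h'⟩
    · exact h'
    · omega

end Search

/-! ### Powers of the radix and packing of the generators -/

section Preparation

/-- Compute the radix and its powers. -/
def powers : RamProg :=
  .seq (.assign 5 1) <|
  .seq (loop 14 (.reg 2 + 1) (.assign 5 (.reg 5 * 256))) <|
  .seq (st 0 0 1) <|
  loop 14 (.reg 6) (st 0 (.reg 14 + 1) (ld 0 (.reg 14) * .reg 5))

/-- Pack the generators. -/
def readGenerators : RamProg :=
  loop 14 (.reg 3) <|
    .seq (.assign 15 0) <|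
    .seq (loop 16 (.reg 2) <|
      .seq (.assign 17 (.load (2 + .reg 14 * .reg 2 + .reg 16))) <|
      .assign 15 (.reg 15 + ((reg 17).mod 2 * ld 0 (.reg 16)
        + .reg 17 / 2 * ld 0 (.reg 6 - 1 - .reg 16)))) <|
    st 1 (.reg 14) (.reg 15)

/-- Copy array `3` into array `2`. -/
def copyUnits : RamProg := loop 14 (.reg 6) (st 2 (.reg 14) (ld 3 (.reg 14)))

/-- Everything that is computed once. -/
def setup : RamProg :=
  .seq (.assign 2 (.load 0)) <|
  .seq (.assign 3 (.reg 2 - .load 1)) <|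
  .seq (.assign 4 (.reg 2 * (.reg 2 + .load 1) / (3 * .reg 2 + .load 1))) <|
  .seq (.assign 6 (2 * .reg 2)) <|
  .seq (.assign 1 ((.reg 2 + 2) * (.reg 2 + 2))) <|
  .seq powers <|
  .seq readGenerators <|
  .seq initUnits <|
  .seq eliminate <|
  .seq copyUnits <|
  .assign 13 (4 * .reg 4)

/-- The cells below the array area are unchanged. -/
def LowKept (σ τ : RamState) : Prop := ∀ a < 8 * σ.reg 1, τ.mem a = σ.mem a

theorem LowKept.set {σ τ : RamState} (h : LowKept σ τ) (i v : ℕ) : LowKept σ (τ.set i v) := h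

theorem LowKept.put {σ τ : RamState} (h : LowKept σ τ) (h1 : τ.reg 1 = σ.reg 1) (q a v : ℕ) :
    LowKept σ (τ.put q a v) := fun b hb => by
  rw [← h b hb]
  simp only [RamState.put, Function.update_apply]
  rw [if_neg (by omega)]

variable {n r m : ℕ} {g : Fin r → Fin n → F4}

theorem pow_lt_digits {j : ℕ} (hj : j ≤ 2 * n) : radix n ^ j < 2 ^ digits n := by
  have h1 : 1 < radix n := Nat.one_lt_pow (by omega) (by norm_num)
  exact lt_two_pow_digits (Nat.pow_lt_pow_right h1 (by omega))

theorem wp_powers {σ : RamState} (hb : Bounded (digits n) σ) (h2 : σ.reg 2 = n)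
    (h6 : σ.reg 6 = 2 * n) :
    Wp (digits n) powers (20 * (n + 1)) (fun τ => Frame [5, 14] [0] σ τ ∧ LowKept σ τ ∧
      τ.reg 5 = radix n ∧ ∀ j ≤ 2 * n, τ.arr 0 j = radix n ^ j) σ := by
  have hz := nine_le_digits n
  have hone : 1 < 2 ^ digits n := Nat.one_lt_two_pow (by omega)
  refine wp_assign_seq (N := 20 * n + 19) hz hb rfl 1 rfl hone fun hb1 => ?_
  refine wp_seq_le (3 * (n + 1) + 2) (6 * n + 4) (by omega)
    (fun τ => Frame [5, 14] [0] σ τ ∧ LowKept σ τ ∧ τ.reg 5 = radix n) ?_ ?_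
  · refine wp_loop_const hz hb1 rfl (n + 1) 1 (fun j τ => Frame [5, 14] [0] σ τ ∧ LowKept σ τ ∧
      τ.reg 5 = 256 ^ j) (lt_of_lt_radix ?_) (by omega) ⟨?_, ?_, ?_⟩ ?_ ?_ ?_
    · exact (lt_radix_of_le (by nlinarith)).le
    · exact ((Frame.refl _ _ _).set (by decide) (by decide) _).set (by decide) (by decide) _
    · exact fun _ _ => rfl
    · simp
    · rintro j hj τ - ⟨hF, -⟩
      simp [hF.reg 2 (by decide), h2]
    · rintro j hj τ hbτ h14 ⟨hF, hL, h5⟩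
      refine wp_assign hz hbτ rfl (v := 256 ^ (j + 1)) (by simp [h5, pow_succ]) ?_
        ⟨by simp [h14], ?_, hL, ?_⟩
      · exact lt_of_lt_radix (Nat.pow_le_pow_right (by norm_num) hj)
      · exact (hF.set (by decide) (by decide) _).set (by decide) (by decide) _
      · simp
    · rintro τ hbτ - h
      exact h
  · rintro τ hbτ ⟨hF, hL, h5⟩
    refine wp_st_seq (N := 6 * n + 3) hz hbτ rfl rfl 0 1 rfl rfl hone fun hb2 => ?_
    refine wp_loop_const hz hb2 rfl (2 * n) 1 (fun j υ => Frame [5, 14] [0] σ υ ∧ LowKept σ υ ∧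
      υ.reg 5 = radix n ∧ ∀ i ≤ j, υ.arr 0 i = radix n ^ i) (lt_of_lt_radix ?_) (by omega)
      ⟨?_, ?_, ?_, ?_⟩ ?_ ?_ ?_
    · exact (lt_radix_of_le (by nlinarith)).le
    · exact (hF.put (by decide) (by decide) _ _).set (by decide) (by decide) _
    · exact hL.put (hF.reg 1 (by decide)) _ _ _
    · simpa using h5
    · intro i hi
      rw [arr_set _ (by decide), arr_put _ (by decide) (by decide)]
      simp [Nat.le_zero.1 hi]
    · rintro j hj υ - ⟨hF, -⟩
      simp [hF.reg 6 (by decide), h6]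
    · rintro j hj υ hbυ h14 ⟨hF, hL, h5, hI⟩
      refine wp_st hz hbυ rfl rfl (b := j + 1) (v := radix n ^ (j + 1)) (by simp [h14])
        (by simp [h14, h5, hI j le_rfl, pow_succ]) (pow_lt_digits (by omega))
        ⟨by simp [h14], ?_, ?_, ?_, ?_⟩
      · exact (hF.put (by decide) (by decide) _ _).set (by decide) (by decide) _
      · exact (hL.put (hF.reg 1 (by decide)) _ _ _)
      · simpa using h5
      · intro i hi
        rw [arr_set _ (by decide), arr_put _ (by decide) (by decide)]
        split_ifs with h
        · rw [h.2]
        · exact hI i (by simp at h; omega)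
    · rintro υ hbυ - ⟨hF, hL, h5, hI⟩
      exact ⟨hF, hL, h5, hI⟩

/-- The value of the first `j` symbols of `f`. -/
def packUpTo (f : Fin n → F4) : ℕ → ℕ
  | 0 => 0
  | j + 1 => packUpTo f j + if h : j < n then
      (f ⟨j, h⟩).1.val * radix n ^ j + (f ⟨j, h⟩).2.val * radix n ^ (2 * n - 1 - j) else 0

theorem packs_packUpTo (f : Fin n → F4) : Packs 1 (packUpTo f n) f := by
  let ξ : ℕ → ℕ := fun l => if h : l < n then (f ⟨l, h⟩).1.val else
    if h : 2 * n - 1 - l < n then (f ⟨2 * n - 1 - l, h⟩).2.val else 0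
  have hval : ∀ x : ZMod 2, x.val ≤ 1 := by decide
  have hsum : ∀ j ≤ n, packUpTo f j = ∑ i ∈ Finset.range j,
      (ξ i * radix n ^ i + ξ (2 * n - 1 - i) * radix n ^ (2 * n - 1 - i)) := by
    intro j
    induction j with
    | zero => intro _; rfl
    | succ j ih =>
      intro hj
      have h1 : ¬ 2 * n - 1 - j < n := by omega
      have h2 : 2 * n - 1 - (2 * n - 1 - j) = j := by omega
      have h3 : j < n := hj
      rw [packUpTo, ih (by omega), Finset.sum_range_succ, dif_pos h3]
      simp only [ξ, h1, h2, h3, dif_pos, dif_neg, not_false_eq_true]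
  refine ⟨ξ, fun l => ?_, ?_, fun i => ?_⟩
  · simp only [ξ]
    split_ifs
    exacts [hval _, hval _, by omega]
  · have h1 : ∑ x ∈ Finset.range n, ξ (n + x) * radix n ^ (n + x)
        = ∑ x ∈ Finset.range n, ξ (2 * n - 1 - x) * radix n ^ (2 * n - 1 - x) := by
      rw [← Finset.sum_range_reflect]
      refine Finset.sum_congr rfl fun x hx => ?_
      simp only [Finset.mem_range] at hx
      rw [show n + (n - 1 - x) = 2 * n - 1 - x by omega]
    rw [hsum n le_rfl, two_mul n, Finset.sum_range_add, h1, ← Finset.sum_add_distrib, two_mul]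
  · have hi := i.2
    have h1 : ¬ 2 * n - 1 - (i : ℕ) < n := by omega
    have h2 : 2 * n - 1 - (2 * n - 1 - (i : ℕ)) = i := by omega
    simp only [ξ, h1, h2, hi, dif_pos, dif_neg, not_false_eq_true, Fin.eta]
    simp

theorem packUpTo_mono (f : Fin n → F4) {j : ℕ} (hj : j ≤ n) : packUpTo f j ≤ packUpTo f n :=
  monotone_nat_of_le_succ (f := packUpTo f) (fun j => by simp [packUpTo]) hj

theorem F4.code_mod_two : ∀ x : F4, x.code % 2 = x.1.val := by decide

theorem F4.code_div_two : ∀ x : F4, x.code / 2 = x.2.val := by decide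

theorem F4.code_le : ∀ x : F4, x.code ≤ 3 := by decide

theorem wp_readGenerators (hr : r ≤ n) {σ : RamState} (hb : Bounded (digits n) σ)
    (h1 : 2 + r * n ≤ 8 * σ.reg 1)
    (h2 : σ.reg 2 = n) (h3 : σ.reg 3 = r) (h6 : σ.reg 6 = 2 * n)
    (hpow : ∀ j ≤ 2 * n, σ.arr 0 j = radix n ^ j)
    (hin : ∀ (i : Fin r) (j : Fin n), σ.mem (2 + i * n + j) = (g i j).code) :
    Wp (digits n) readGenerators (20 * (n + 1) ^ 2) (fun τ => Frame [14, 15, 16, 17] [1] σ τ ∧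
      ∀ i : Fin r, Packs 1 (τ.arr 1 i) (g i)) σ := by
  have hz := nine_le_digits n
  have hlt : ∀ x ≤ 5 * n + 3, x < 2 ^ digits n := fun x hx =>
    lt_of_lt_radix (lt_radix_of_le (by nlinarith)).le
  have h1r : 1 < radix n := Nat.one_lt_pow (by omega) (by norm_num)
  refine wp_loop_const hz hb rfl r (4 * n + 4) (fun j τ => Frame [14, 15, 16, 17] [1] σ τ ∧
    LowKept σ τ ∧ ∀ i : Fin r, (i : ℕ) < j → τ.arr 1 i = packUpTo (g i) n)
    (hlt _ (by omega)) ?_ ⟨?_, ?_, ?_⟩ ?_ ?_ ?_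
  · nlinarith
  · exact (Frame.refl _ _ _).set (by decide) (by decide) _
  · exact fun _ _ => rfl
  · intro i hi; omega
  · rintro j hj τ - ⟨hF, -⟩
    simp [hF.reg 3 (by decide), h3]
  · rintro i hi τ hbτ h14 ⟨hF, hL, hI⟩
    refine wp_assign_seq (N := 4 * n + 3) hz hbτ rfl 0 rfl (by positivity) fun hb1 => ?_
    refine wp_seq_le (4 * n + 2) 1 le_rfl (fun υ => Frame [15, 16, 17] [] τ υ ∧ LowKept σ υ ∧
      υ.reg 15 = packUpTo (g ⟨i, hi⟩) n) ?_ ?_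
    · refine wp_loop_const hz hb1 rfl n 2 (fun j υ => Frame [15, 16, 17] [] τ υ ∧ LowKept σ υ ∧
        υ.reg 15 = packUpTo (g ⟨i, hi⟩) j) (hlt _ (by omega)) (by omega) ⟨?_, hL, ?_⟩ ?_ ?_ ?_
      · exact ((Frame.refl _ _ _).set (by decide) (by decide) _).set (by decide) (by decide) _
      · simp [packUpTo]
      · rintro j hj υ - ⟨hF', -⟩
        simp [hF'.reg 2 (by decide), hF.reg 2 (by decide), h2]
      · rintro j hj υ hbυ h16 ⟨hF', hL', h15⟩
        have e2 : υ.reg 2 = n := by rw [hF'.reg 2 (by decide), hF.reg 2 (by decide), h2]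
        have e6 : υ.reg 6 = 2 * n := by rw [hF'.reg 6 (by decide), hF.reg 6 (by decide), h6]
        have e14 : υ.reg 14 = i := by rw [hF'.reg 14 (by decide), h14]
        have epow : ∀ j ≤ 2 * n, υ.arr 0 j = radix n ^ j := fun j hj => by
          rw [hF'.arr 0 (by decide) (by decide), hF.arr 0 (by decide) (by decide), hpow j hj]
        have ein : υ.mem (2 + i * n + j) = (g ⟨i, hi⟩ ⟨j, hj⟩).code := by
          rw [hL' _ ?_]
          · exact hin ⟨i, hi⟩ ⟨j, hj⟩
          · have : (i + 1) * n ≤ r * n := Nat.mul_le_mul_right _ hi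
            rw [add_mul, one_mul] at this
            omega
        refine wp_assign_seq (N := 1) hz hbυ rfl (g ⟨i, hi⟩ ⟨j, hj⟩).code ?_
          (hlt _ ((F4.code_le _).trans (by omega))) fun hb2 => ?_
        · rw [← ein, ← h16, ← e14, ← e2]
          rfl
        · have hstep : packUpTo (g ⟨i, hi⟩) (j + 1) = packUpTo (g ⟨i, hi⟩) j +
              ((g ⟨i, hi⟩ ⟨j, hj⟩).1.val * radix n ^ j
                + (g ⟨i, hi⟩ ⟨j, hj⟩).2.val * radix n ^ (2 * n - 1 - j)) := by
            rw [packUpTo, dif_pos hj]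
          refine wp_assign hz hb2 rfl (v := packUpTo (g ⟨i, hi⟩) (j + 1)) ?_ ?_
            ⟨by simp [h16], ?_, hL', ?_⟩
          · simp [arr_set, h15, h16, hstep, epow j (by omega), epow (2 * n - 1 - j) (by omega), e6,
              F4.code_mod_two, F4.code_div_two]
          · exact (packUpTo_mono _ hj).trans_lt ((packs_packUpTo _).lt_digits h1r)
          · exact ((hF'.set (by decide) (by decide) _).set (by decide) (by decide) _).set
              (by decide) (by decide) _
          · simp
      · rintro υ hbυ - h
        exact h
    · rintro υ hbυ ⟨hF', hL', h15⟩
      have e14 : υ.reg 14 = i := by rw [hF'.reg 14 (by decide), h14]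
      have hFF := hF.trans (hF'.mono (by decide) (by decide))
      refine wp_st hz hbυ rfl rfl (b := i) (v := packUpTo (g ⟨i, hi⟩) n) (by simp [e14])
        (by simp [h15]) ((packs_packUpTo _).lt_digits h1r) ⟨by simp [e14], ?_, ?_, ?_⟩
      · exact (hFF.put (by decide) (by decide) _ _).set (by decide) (by decide) _
      · exact hL'.put (hFF.reg 1 (by decide)) _ _ _
      · intro i' hi'
        rw [arr_set _ (by decide), arr_put _ (by decide) (by decide)]
        split_ifs with h
        · obtain rfl : i' = ⟨i, hi⟩ := Fin.ext h.2
          rfl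
        · rw [hF'.arr 1 (by decide) (by decide)]
          exact hI i' (by simp at h; omega)
  · rintro τ hbτ - ⟨hF, -, hI⟩
    exact ⟨hF, fun i => by rw [hI i i.2]; exact packs_packUpTo _⟩

theorem wp_copyUnits {σ : RamState} (hb : Bounded (digits n) σ) (h6 : σ.reg 6 = 2 * n) :
    Wp (digits n) copyUnits (6 * n + 2) (fun τ => Frame [14] [2] σ τ ∧
      ∀ l < 2 * n, τ.arr 2 l = σ.arr 3 l) σ := by
  have hz := nine_le_digits n
  refine wp_loop_const hz hb rfl (2 * n) 1 (fun j τ => Frame [14] [2] σ τ ∧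
    ∀ l < j, τ.arr 2 l = σ.arr 3 l) (lt_of_lt_radix ?_) (by omega) ⟨?_, ?_⟩ ?_ ?_ ?_
  · exact (lt_radix_of_le (by nlinarith)).le
  · exact (Frame.refl _ _ _).set (by decide) (by decide) _
  · intro l hl; omega
  · rintro j hj τ - ⟨hF, -⟩
    simp [hF.reg 6 (by decide), h6]
  · rintro j hj τ hbτ h14 ⟨hF, hI⟩
    refine wp_st hz hbτ rfl rfl (b := j) (v := σ.arr 3 j) (by simp [h14])
      (by simp [h14, hF.arr 3 (by decide) (by decide)]) (hb.arr _ _) ⟨by simp [h14], ?_, ?_⟩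
    · exact (hF.put (by decide) (by decide) _ _).set (by decide) (by decide) _
    · intro l hl
      rw [arr_set _ (by decide), arr_put _ (by decide) (by decide)]
      split_ifs with h
      · rw [h.2]
      · exact hI l (by simp at h; omega)
  · rintro τ hbτ - h
    exact h

end Preparation

/-! ### The input word and the setup phase -/

section Input

variable {n k : ℕ} (g : Fin (n - k) → Fin n → F4)

theorem List.getD_flatMap_map {α β : Type*} {N : ℕ} (F : β → Fin N → α) (d : α) (l : List β)
    (i : ℕ) (hi : i < l.length) (j : Fin N) :
    (l.flatMap fun a => (List.finRange N).map (F a)).getD (i * N + j) d = F l[i] j := by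
  have hj := j.2
  induction l generalizing i with
  | nil => simp at hi
  | cons a l ih =>
    rw [List.flatMap_cons]
    cases i with
    | zero =>
      rw [List.getD_append _ _ _ _ (by simp)]
      simp
    | succ i =>
      have hs : (i + 1) * N = i * N + N := by ring
      rw [List.getD_append_right _ _ _ _ (by simp; omega)]
      have : (i + 1) * N + ↑j - (List.map (F a) (List.finRange N)).length = i * N + j := by
        simp; omega
      rw [this, ih i (by simpa using hi)]
      simp

theorem initState_symbol (i : Fin (n - k)) (j : Fin n) :
    (initState n k g).mem (2 + i * n + j) = (g i j).code := by
  have h : 2 + (i : ℕ) * n + j = i * n + j + 1 + 1 := by ring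
  simp only [initState, inputWord, h, List.getD_cons_succ]
  rw [List.getD_flatMap_map (fun i j => (g i j).code) 0 _ (i : ℕ) (by simp) j]
  simp

theorem initState_beyond {a : ℕ} (ha : 2 + (n - k) * n ≤ a) : (initState n k g).mem a = 0 := by
  simp only [initState]
  refine List.getD_eq_default _ _ (le_trans (le_of_eq ?_) ha)
  simp [inputWord, List.length_flatMap]
  ring

theorem bounded_initState (hk : k ≤ n) : Bounded (digits n) (initState n k g) := by
  have hlt : ∀ x ≤ n + 3, x < 2 ^ digits n := fun x hx =>
    lt_of_lt_radix (lt_radix_of_le (by nlinarith)).le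
  refine ⟨fun r => hlt _ (Nat.zero_le _), fun a => hlt _ ?_⟩
  rcases lt_or_ge a (inputWord n k g).length with h | h
  · have hmem := List.getElem_mem h
    simp only [initState]
    rw [List.getD_eq_getElem _ _ h]
    generalize (inputWord n k g)[a] = x at hmem ⊢
    simp only [inputWord, List.mem_cons, List.mem_flatMap, List.mem_map] at hmem
    rcases hmem with rfl | rfl | ⟨i, -, j, -, rfl⟩
    · omega
    · omega
    · exact (F4.code_le _).trans (by omega)
  · simp only [initState]
    rw [List.getD_eq_default _ _ h]
    omega

/-- The half length of the window. -/
def halfWindow (n k : ℕ) : ℕ := n * (n + k) / (3 * n + k)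

theorem two_mul_halfWindow_le (hk : k ≤ n) : 2 * halfWindow n k ≤ n := by
  have h1 := Nat.div_mul_le_self (n * (n + k)) (3 * n + k)
  rw [← halfWindow] at h1
  by_contra! h
  rcases Nat.eq_zero_or_pos n with rfl | hn
  · simp [halfWindow] at h
  · nlinarith

theorem wp_setup (hn : 1 ≤ n) (hk : k ≤ n) :
    Wp (digits n) setup (100 * (n + 1) ^ 2) (fun τ => Env (halfWindow n k) g τ ∧ τ.reg 0 = 0 ∧
      τ.reg 7 = 0 ∧ τ.reg 13 = 4 * halfWindow n k ∧ (∀ b, τ.arr 5 b = 0) ∧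
      ∃ Φ, IsReduction g (order hn (halfWindow n k) 0 0) 0 (n - k) Φ ∧
        ∀ l < 2 * n, Packs (2 ^ (n - k)) (τ.arr 2 l)
          (Φ (unitVec (order hn (halfWindow n k) 0 0) l))) (initState n k g) := by
  have hz := nine_le_digits n
  have hlt : ∀ x ≤ 16 * (n + 1) ^ 2, x < 2 ^ digits n := fun x hx =>
    lt_of_lt_radix (lt_radix_of_le hx).le
  have hm := two_mul_halfWindow_le hk
  have hb := bounded_initState g hk
  have m0 : (initState n k g).mem 0 = n := rfl
  have m1 : (initState n k g).mem 1 = k := rfl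
  have hr : n - k ≤ n := Nat.sub_le _ _
  set m := halfWindow n k with hmdef
  refine Wp.mono (N := 20 * (n + 1) + (20 * (n + 1) ^ 2 + ((10 * n + 2) + ((n * (16 * n + 18) + 2)
    + ((6 * n + 2) + 1)))) + 1 + 1 + 1 + 1 + 1) ?_ (by nlinarith) fun _ _ h => h
  refine wp_assign_seq hz hb rfl n rfl (hlt _ (by nlinarith)) fun hb => ?_
  refine wp_assign_seq hz hb rfl (n - k) ?_ (hlt _ (by nlinarith)) fun hb => ?_
  · simp [RamExpr.eval, m1]
  refine wp_assign_seq hz hb rfl m ?_ (hlt _ (by nlinarith)) fun hb => ?_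
  · simp [RamExpr.eval, RamOp.eval, m1, hmdef, halfWindow]
  refine wp_assign_seq hz hb rfl (2 * n) (by simp) (hlt _ (by nlinarith)) fun hb => ?_
  refine wp_assign_seq hz hb rfl ((n + 2) * (n + 2)) (by simp) (hlt _ (by nlinarith)) fun hb => ?_
  set σ := ((((((initState n k g).set 2 n).set 3 (n - k)).set 4 m).set 6 (2 * n)).set 1
    ((n + 2) * (n + 2))) with hσ
  -- The array area starts behind the input, so all arrays are zero at first and the input survives
  -- until it has been packed.
  have hsize : 2 + (n - k) * n ≤ 8 * ((n + 2) * (n + 2)) := by nlinarith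
  have hreg : ∀ i, i ∉ [1, 2, 3, 4, 6] → σ.reg i = 0 := by
    intro i hi
    simp only [List.mem_cons, List.not_mem_nil, or_false, not_or] at hi
    simp [hσ, hi, initState]
  have harr : ∀ q b, σ.arr q b = 0 := fun q b =>
    initState_beyond g (by simp only [hσ, reg_set, if_true]; omega)
  refine wp_seq_le _ _ le_rfl _ (wp_powers hb (by simp [hσ]) (by simp [hσ])) ?_
  rintro τ hbτ ⟨hF, hL, h5, hpow⟩
  refine wp_seq_le _ _ le_rfl _ (wp_readGenerators (g := g) hr hbτ ?_
    (by rw [hF.reg 2 (by decide)]; simp [hσ]) (by rw [hF.reg 3 (by decide)]; simp [hσ])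
    (by rw [hF.reg 6 (by decide)]; simp [hσ]) hpow ?_) ?_
  · rw [hF.reg 1 (by decide)]
    simpa [hσ] using hsize
  · intro i j
    rw [hL _ ?_]
    · exact initState_symbol g i j
    · have h1 : ((i : ℕ) + 1) * n ≤ (n - k) * n := Nat.mul_le_mul_right _ i.2
      have h2 := j.2
      rw [add_mul, one_mul] at h1
      simp only [hσ, reg_set, if_true]
      omega
  rintro υ hbυ ⟨hF', hG⟩
  have hFυ : Frame [5, 14, 15, 16, 17] [0, 1] σ υ :=
    (hF.mono (by decide) (by decide)).trans (hF'.mono (by decide) (by decide))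
  have hE : Env m g υ := by
    refine ⟨?_, ?_, ?_, ?_, ?_, fun j hj => ?_, hG⟩
    · rw [hFυ.reg 2 (by decide)]; simp [hσ]
    · rw [hFυ.reg 3 (by decide)]; simp [hσ]
    · rw [hFυ.reg 4 (by decide)]; simp [hσ]
    · rw [hF'.reg 5 (by decide), h5]
    · rw [hFυ.reg 6 (by decide)]; simp [hσ]
    · rw [hF'.arr 0 (by decide) (by decide), hpow j hj]
  have hπ := order_bijective hn hm (p := 0) (i := 0) (Nat.zero_le _)
  refine wp_seq_le _ _ le_rfl _ (wp_initUnits hn (by omega) (Nat.zero_le _) (Nat.zero_le _)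
    (π := order hn m 0 0) (fun t => rfl) hbυ hE
    (by rw [hFυ.reg 11 (by decide), hreg 11 (by decide)])
    (by rw [hFυ.reg 12 (by decide), hreg 12 (by decide)])) ?_
  rintro ω hbω ⟨hF1, hX⟩
  have hE1 := hE.frame hF1 (by decide) (by decide)
  -- With the empty window every vector may serve as pivot, and `Φ` maps onto the dual code. The
  -- images of the unit vectors, copied to array `2`, are used for testing membership in `C`.
  refine wp_seq_le _ _ le_rfl _ (wp_eliminate hn hr hπ (a := 0) (Nat.zero_le _) hbω hE1
    (by rw [hF1.reg 13 (by decide), hFυ.reg 13 (by decide), hreg 13 (by decide)]) hX) ?_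
  rintro ω' hbω' ⟨hF2, Φ, hΦ, hX'⟩
  have hE2 := hE1.frame hF2 (by decide) (by decide)
  refine wp_seq_le _ _ le_rfl _ (wp_copyUnits hbω' hE2.reg6) ?_
  rintro χ hbχ ⟨hF3, hcopy⟩
  have hE3 := hE2.frame hF3 (by decide) (by decide)
  have hFall : Frame [5, 14, 15, 16, 17] [0, 1, 2, 3] σ χ :=
    (((hFυ.mono (by decide) (by decide)).trans (hF1.mono (by decide) (by decide))).trans
      (hF2.mono (by decide) (by decide))).trans (hF3.mono (by decide) (by decide))
  refine wp_assign hz hbχ rfl (v := 4 * m) (by simp [hE3.reg4]) (hlt _ (by nlinarith))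
    ⟨?_, ?_, ?_, by simp, ?_, Φ, hΦ, ?_⟩
  · exact hE3.frame ((Frame.refl [13] [] χ).set (by decide) (by decide) _) (by decide) (by decide)
  · simp [hFall.reg 0 (by decide), hreg]
  · simp [hFall.reg 7 (by decide), hreg]
  · intro b
    rw [arr_set _ (by decide), hFall.arr 5 (by decide) (by decide), harr]
  · intro l hl
    rw [arr_set _ (by decide), hcopy l hl]
    exact hX' l hl

end Input

/-! ### Symplectic duality of additive codes -/

section Codes

variable {n k : ℕ}

/-- The symplectic form as a bilinear form. -/
def sympForm (n : ℕ) : LinearMap.BilinForm (ZMod 2) (Fin n → F4) :=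
  LinearMap.mk₂ (ZMod 2) symp (fun e e' f => symp_add_left e e' f)
    (fun c e f => symp_smul_left e f c) (fun e f f' => symp_add_right e f f')
    (fun c e f => symp_smul_right c e f)

theorem sympForm_apply (e f : Fin n → F4) : sympForm n e f = symp e f := rfl

theorem eq_zero_of_symp {f : Fin n → F4} (h : ∀ e, symp e f = 0) : f = 0 := by
  funext i
  exact Prod.ext ((symp_single_snd f i).symm.trans (h _)) ((symp_single_fst f i).symm.trans (h _))

theorem sympForm_isRefl (n : ℕ) : (sympForm n).IsRefl := fun e f h => by
  rw [sympForm_apply] at h ⊢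
  rw [symp_comm, h]

theorem sympForm_nondegenerate (n : ℕ) : (sympForm n).Nondegenerate :=
  ⟨fun e h => eq_zero_of_symp fun f => by rw [symp_comm]; exact h f,
    fun _ h => eq_zero_of_symp fun e => h e⟩

/-- The dual code as a subgroup. -/
def perp (C : AddSubgroup (Fin n → F4)) : AddSubgroup (Fin n → F4) where
  carrier := {e | ∀ f ∈ C, symp e f = 0}
  zero_mem' := fun f _ => symp_zero_left f
  add_mem' := fun ha hb f hf => by rw [symp_add_left, ha f hf, hb f hf, add_zero]
  neg_mem' := fun {a} ha f hf => by
    have : -a = a := neg_eq_of_add_eq_zero_left (add_self_vec a)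
    rw [this, ha f hf]

theorem mem_perp {C : AddSubgroup (Fin n → F4)} {e : Fin n → F4} :
    e ∈ perp C ↔ ∀ f ∈ C, symp e f = 0 := Iff.rfl

theorem mem_dualCode {C : AddSubgroup (Fin n → F4)} {e : Fin n → F4} :
    e ∈ dualCode C ↔ e ∈ perp C :=
  forall₂_congr fun _ _ => traceInner_eq_zero_iff _ _

theorem toZModSubmodule_perp (C : AddSubgroup (Fin n → F4)) :
    AddSubgroup.toZModSubmodule 2 (perp C)
      = (sympForm n).orthogonal (AddSubgroup.toZModSubmodule 2 C) := by
  ext e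
  rw [AddSubgroup.mem_toZModSubmodule, LinearMap.BilinForm.mem_orthogonal_iff, mem_perp]
  refine forall₂_congr fun f _ => ?_
  rw [sympForm_apply, symp_comm]

theorem perp_perp (C : AddSubgroup (Fin n → F4)) : perp (perp C) = C := by
  apply (AddSubgroup.toZModSubmodule 2).injective
  rw [toZModSubmodule_perp, toZModSubmodule_perp,
    LinearMap.BilinForm.orthogonal_orthogonal (sympForm_nondegenerate n) (sympForm_isRefl n)]

theorem card_mul_card_perp (C : AddSubgroup (Fin n → F4)) :
    Nat.card C * Nat.card (perp C) = 2 ^ n * 2 ^ n := by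
  have h1 : ∀ D : AddSubgroup (Fin n → F4), Nat.card D
      = 2 ^ Module.finrank (ZMod 2) (AddSubgroup.toZModSubmodule 2 D) := fun D => by
    have := Module.natCard_eq_pow_finrank (K := ZMod 2) (V := AddSubgroup.toZModSubmodule 2 D)
    rw [Nat.card_zmod] at this
    rw [← this]
    rfl
  have h2 : Nat.card (Fin n → F4) = 2 ^ Module.finrank (ZMod 2) (Fin n → F4) := by
    rw [Module.natCard_eq_pow_finrank (K := ZMod 2), Nat.card_zmod]
  have h3 : Nat.card (Fin n → F4) = 2 ^ n * 2 ^ n := by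
    simp [← mul_pow]
  rw [← h3, h2, h1 C, h1 (perp C), toZModSubmodule_perp,
    LinearMap.BilinForm.finrank_orthogonal (sympForm_nondegenerate n), ← pow_add,
    Nat.add_sub_cancel' (Submodule.finrank_le _)]

theorem mem_stabCodes {C : AddSubgroup (Fin n → F4)} :
    C ∈ stabCodes n k ↔ Nat.card C * 2 ^ k = 2 ^ n ∧ C ≤ perp C := by
  rw [stabCodes, Set.mem_ofPred_eq]
  refine and_congr_right fun _ => forall₂_congr fun e _ => ?_
  rw [mem_perp]
  exact forall₂_congr fun f _ => traceInner_eq_zero_iff _ _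

theorem card_perp {C : AddSubgroup (Fin n → F4)} (hC : C ∈ stabCodes n k) :
    Nat.card (perp C) = 2 ^ (n + k) := by
  have h1 := (mem_stabCodes.1 hC).1
  have h2 := card_mul_card_perp C
  have h3 : 0 < Nat.card C := Nat.card_pos
  refine Nat.eq_of_mul_eq_mul_left h3 ?_
  rw [h2, pow_add, mul_left_comm, h1]

theorem le_of_mem_stabCodes {C : AddSubgroup (Fin n → F4)} (hC : C ∈ stabCodes n k) : k ≤ n := by
  have h1 := (mem_stabCodes.1 hC).1
  exact (Nat.pow_dvd_pow_iff_le_right (by norm_num)).1 (Dvd.intro_left _ h1)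

theorem exists_mem_perp_notMem {C : AddSubgroup (Fin n → F4)} (hC : C ∈ stabCodes n k)
    (hk : 1 ≤ k) : ∃ e ∈ perp C, e ∉ C := by
  by_contra! h
  have h1 := Nat.card_mono (Set.toFinite (C : Set (Fin n → F4)))
    (show (perp C : Set (Fin n → F4)) ⊆ C from h)
  have h2 : Nat.card (perp C) ≤ Nat.card C := h1
  have h3 := (mem_stabCodes.1 hC).1
  rw [card_perp hC, pow_add, ← h3] at h2
  have h4 : 0 < Nat.card C := Nat.card_pos
  have h5 : 2 ^ 1 ≤ 2 ^ k := Nat.pow_le_pow_right (by norm_num) hk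
  nlinarith [Nat.mul_le_mul_left (Nat.card C) h5]

theorem isLeast_stabDist {C : AddSubgroup (Fin n → F4)} (hC : C ∈ stabCodes n k) (hk : 1 ≤ k) :
    IsLeast {w | ∃ e ∈ perp C, e ∉ C ∧ hammingNorm e = w} (stabDist C) := by
  have h : stabDist C = sInf {w | ∃ e ∈ perp C, e ∉ C ∧ hammingNorm e = w} := by
    simp only [stabDist, mem_dualCode]
  rw [h]
  obtain ⟨e, he, heC⟩ := exists_mem_perp_notMem hC hk
  exact ⟨Nat.sInf_mem ⟨_, e, he, heC, rfl⟩, fun w hw => Nat.sInf_le hw⟩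

theorem dual_iff_mem_perp {g : Fin (n - k) → Fin n → F4} {C : AddSubgroup (Fin n → F4)}
    (hg : IsGenerating g C) {f : Fin n → F4} : Dual g f ↔ f ∈ perp C := by
  constructor
  · intro h e he
    rw [← hg] at he
    rw [symp_comm]
    induction he using AddSubgroup.closure_induction with
    | mem x hx => obtain ⟨j, rfl⟩ := hx; exact h j
    | zero => simp
    | add x y _ _ hx hy => rw [symp_add_left, hx, hy, add_zero]
    | neg x _ hx =>
      have : -x = x := neg_eq_of_add_eq_zero_left (add_self_vec x)
      rw [this, hx]
  · intro h j
    rw [symp_comm]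
    exact h _ (hg ▸ AddSubgroup.subset_closure ⟨j, rfl⟩)

/-- For the empty window the vectors `Φ (unitVec π l)` span `perp C`, so orthogonality to all of
them means membership in `perp (perp C) = C`. -/
theorem IsReduction.notMem_iff {g : Fin (n - k) → Fin n → F4} {C : AddSubgroup (Fin n → F4)}
    (hg : IsGenerating g C) {π : Fin n → Fin n} (hπ : Function.Bijective π)
    {Φ : (Fin n → F4) →+ (Fin n → F4)} (hΦ : IsReduction g π 0 (n - k) Φ) {f : Fin n → F4} :
    (∃ l < 2 * n, symp (Φ (unitVec π l)) f ≠ 0) ↔ f ∉ C := by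
  have hv : ∀ f, Vanishes π 0 f := fun f t ht => absurd ht (Nat.not_lt_zero _)
  have hdual : ∀ z, Φ z ∈ perp C := fun z =>
    (dual_iff_mem_perp hg).1 fun j => hΦ.orth j j.2 _ (hv z)
  constructor
  · rintro ⟨l, -, hl⟩ hf
    exact hl (hdual _ f hf)
  · intro hf
    by_contra! h
    refine hf ?_
    rw [← perp_perp C]
    intro e he
    rw [symp_comm, ← hΦ.fixes e ((dual_iff_mem_perp hg).2 he), symp_comm]
    exact hom_eq_zero_of_unitVec hπ (sympHom f Φ) (a := 0)
      (fun l _ hl => (symp_comm _ _).trans (h l hl)) (hv e)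

end Codes

/-! ### Correctness of the complete program -/

section Correctness

variable {n k : ℕ}

/-- The program that finds the distance. -/
def distProgram : RamProg := .seq setup (.seq search (.while (.reg 7) .skip))

theorem exec_search {W : ℕ} (hk : 1 ≤ k) {C : AddSubgroup (Fin n → F4)} (hC : C ∈ stabCodes n k)
    {g : Fin (n - k) → Fin n → F4} (hg : IsGenerating g C) (hn : 1 ≤ n)
    (hW : n ≤ W ∨ stabDist C ≤ W ∧
      ∀ q, NoDefect g (stageOrder hn (halfWindow n k) q) (2 * halfWindow n k)) :
    Wp (digits n) (.seq setup search)
      (100 * (n + 1) ^ 2 + searchSteps g hn (halfWindow n k) W) (fun τ =>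
        (τ.reg 7 = 0 → τ.reg 0 = stabDist C) ∧
        ((∀ q, NoDefect g (stageOrder hn (halfWindow n k) q) (2 * halfWindow n k)) →
          τ.reg 7 = 0)) (initState n k g) := by
  have hkn := le_of_mem_stabCodes hC
  have hm := two_mul_halfWindow_le hkn
  refine wp_seq_le _ _ le_rfl _ (wp_setup g hn hkn) ?_
  rintro τ hbτ ⟨hE, h0, h7, h13, hfresh, Φ, hΦ, hX⟩
  refine wp_search hn (Nat.sub_le _ _) hm hbτ hE h0 h7 h13 hX hfresh ?_ hW
  have hset : {w | ∃ f, Dual g f ∧ (∃ l < 2 * n,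
        symp (Φ (unitVec (order hn (halfWindow n k) 0 0) l)) f ≠ 0) ∧ hammingNorm f = w}
      = {w | ∃ e ∈ perp C, e ∉ C ∧ hammingNorm e = w} := by
    ext w
    simp only [Set.mem_ofPred_eq, dual_iff_mem_perp hg,
      hΦ.notMem_iff hg (order_bijective hn hm (Nat.zero_le _))]
  rw [hset]
  exact isLeast_stabDist hC hk

/-- The search halts on every code if the weights are unrestricted, and by determinism it is part of
the given run. The final loop ends only if the flag is zero, and then the answer is right. -/
theorem distProgram_correct (hk : 1 ≤ k) {C : AddSubgroup (Fin n → F4)} (hC : C ∈ stabCodes n k)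
    {g : Fin (n - k) → Fin n → F4} (hg : IsGenerating g C) {t : ℕ} {τ : RamState}
    (h : distProgram.Exec (initState n k g) t τ) : τ.reg 0 = stabDist C := by
  have hn : 1 ≤ n := hk.trans (le_of_mem_stabCodes hC)
  obtain ⟨s, υ, h1, -, -, h2, -⟩ := exec_search hk hC hg hn (Or.inl (le_refl n))
  cases h with
  | seq e1 e2 =>
    cases e2 with
    | seq e2 e3 =>
      obtain ⟨-, rfl⟩ := Exec.det h1 (.seq e1 e2)
      obtain ⟨e4, rfl⟩ := Exec.while_skip e3
      exact h2 e4

theorem distProgram_halts (hk : 1 ≤ k) {C : AddSubgroup (Fin n → F4)} (hC : C ∈ stabCodes n k)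
    {g : Fin (n - k) → Fin n → F4} (hg : IsGenerating g C) (hn : 1 ≤ n)
    (hgood : ∀ q, NoDefect g (stageOrder hn (halfWindow n k) q) (2 * halfWindow n k)) :
    ∃ t τ, distProgram.Exec (initState n k g) t τ ∧ τ.reg 0 = stabDist C ∧
      t ≤ (100 * (n + 1) ^ 2 + searchSteps g hn (halfWindow n k) (stabDist C) + 1)
        * unitCost (digits n) := by
  obtain ⟨s, υ, h1, h2, h3, h4, h5⟩ := exec_search hk hC hg hn (Or.inr ⟨le_rfl, hgood⟩)
  have h7 := h5 hgood
  cases h1 with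
  | @seq _ _ _ _ _ s₁ s₂ e1 e2 =>
    refine ⟨_, υ, .seq e1 (.seq e2 (.while_false h7)), h4 h7, ?_⟩
    have hc := RamExpr.cost_le (nine_le_digits n) h3 (e := .reg 7) rfl
    have hl : 1 ≤ logCost ((reg 7).eval υ) := by simp [logCost]
    rw [add_mul _ 1, one_mul]
    omega

end Correctness

/-! ### Transitivity of the symplectic group -/

section Isometries

variable {n k : ℕ}

/-- Isometries of the symplectic form. -/
def IsSymplectic (T : (Fin n → F4) ≃+ (Fin n → F4)) : Prop :=
  ∀ x y, symp (T x) (T y) = symp x y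

theorem transvect_transvect (h x : Fin n → F4) : transvect h h (transvect h h x) = x := by
  simp only [transvect_apply, symp_add_right, symp_smul_right, symp_self, mul_zero, add_zero]
  rw [add_assoc, add_self_vec, add_zero]

/-- The symplectic transvection `x ↦ x + ⟨h, x⟩ h`. -/
def transvection (h : Fin n → F4) : (Fin n → F4) ≃+ (Fin n → F4) :=
  { transvect h h with
    invFun := transvect h h
    left_inv := transvect_transvect h
    right_inv := transvect_transvect h }

theorem transvection_apply (h x : Fin n → F4) : transvection h x = x + symp h x • h := rfl

theorem isSymplectic_transvection (h : Fin n → F4) : IsSymplectic (transvection h) := by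
  intro x y
  simp only [transvection_apply, symp_add_left, symp_add_right, symp_smul_left, symp_smul_right,
    symp_self, mul_zero, add_zero, symp_comm x h]
  rw [mul_comm (symp h y), add_assoc, CharTwo.add_self_eq_zero, add_zero]

theorem IsSymplectic.trans {T U : (Fin n → F4) ≃+ (Fin n → F4)} (hT : IsSymplectic T)
    (hU : IsSymplectic U) : IsSymplectic (T.trans U) := fun x y => (hU _ _).trans (hT x y)

theorem transvection_add_apply {e f : Fin n → F4} (h : symp e f = 1) :
    transvection (e + f) e = f := by
  rw [transvection_apply, symp_add_left, symp_self, zero_add, symp_comm, h, one_smul, ← add_assoc,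
    add_self_vec, zero_add]

/-- Functionals can be separated from the span of two others. -/
theorem exists_symp_eq_one {x a b : Fin n → F4} (h0 : x ≠ 0) (ha : x ≠ a) (hb : x ≠ b)
    (hab : x ≠ a + b) : ∃ w, symp x w = 1 ∧ symp a w = 0 ∧ symp b w = 0 := by
  let D : AddSubgroup (Fin n → F4) :=
    { carrier := {z | ∃ s t : ZMod 2, z = s • a + t • b}
      zero_mem' := ⟨0, 0, by simp⟩
      add_mem' := by
        rintro _ _ ⟨s, t, rfl⟩ ⟨s', t', rfl⟩
        exact ⟨s + s', t + t', by rw [add_smul, add_smul]; abel⟩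
      neg_mem' := by
        rintro _ ⟨s, t, rfl⟩
        exact ⟨-s, -t, by rw [neg_smul, neg_smul]; abel⟩ }
  have hx : x ∉ perp (perp D) := by
    rw [perp_perp]
    rintro ⟨s, t, rfl⟩
    rcases ZMod.two_cases s with rfl | rfl <;> rcases ZMod.two_cases t with rfl | rfl <;>
      simp_all
  rw [mem_perp] at hx
  push Not at hx
  obtain ⟨w, hw, hxw⟩ := hx
  refine ⟨w, ZMod.eq_one_of_ne_zero hxw, ?_, ?_⟩
  · rw [symp_comm]; exact hw a ⟨1, 0, by simp⟩
  · rw [symp_comm]; exact hw b ⟨0, 1, by simp⟩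

/-- Choose `w` with `⟨e, w⟩ = ⟨w, f⟩ = 1`. The transvections along `e + w` and `w + f` then carry
`e` to `w` and `w` to `f`. -/
theorem exists_isSymplectic {e f : Fin n → F4} (he : e ≠ 0) (hf : f ≠ 0) :
    ∃ T, IsSymplectic T ∧ T e = f := by
  obtain ⟨w, h1, h2, -⟩ := exists_symp_eq_one (x := e) (a := e + f) (b := 0) he
    (by simpa using hf) he (by simpa using hf)
  have h3 : symp w f = 1 := by
    rw [symp_add_left, h1] at h2
    rw [symp_comm]
    exact (CharTwo.add_eq_zero.1 h2).symm
  refine ⟨_, (isSymplectic_transvection (e + w)).trans (isSymplectic_transvection (w + f)), ?_⟩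
  rw [AddEquiv.trans_apply, transvection_add_apply h1, transvection_add_apply h3]

/-- A case of Witt's theorem. The transvection along `f + w` fixes `e` if `⟨e, w⟩ = ⟨e, f⟩`, so it
is enough to go from `f` to `f'`, directly or through an intermediate `w` with the same product with
`e`. -/
theorem exists_isSymplectic_fixing {e f f' : Fin n → F4} (he : e ≠ 0) (hf : f ≠ 0) (hfe : f ≠ e)
    (hf' : f' ≠ 0) (hfe' : f' ≠ e) (h : symp e f = symp e f') :
    ∃ T, IsSymplectic T ∧ T e = e ∧ T f = f' := by
  have hfix : ∀ w, symp e w = symp e f → transvection (f + w) e = e := by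
    intro w hw
    rw [transvection_apply, symp_comm, symp_add_right, hw, CharTwo.add_self_eq_zero, zero_smul,
      add_zero]
  have hfix' : ∀ w, symp e w = symp e f → transvection (w + f') e = e := by
    intro w hw
    rw [transvection_apply, symp_comm, symp_add_right, hw, ← h, CharTwo.add_self_eq_zero,
      zero_smul, add_zero]
  rcases ZMod.two_cases (symp f f') with h0 | h1
  · obtain ⟨w, hw, hw1, hw2⟩ : ∃ w, symp e w = symp e f ∧ symp f w = 1 ∧ symp w f' = 1 := by
      -- The conditions on `w` are linear. They are solvable if `f` avoids the span of `f + f'` and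
      -- of `e` or `e + f`, according to the value of `⟨e, f⟩`.
      rcases ZMod.two_cases (symp e f) with hc | hc
      · have h0 : f ≠ e + (f + f') := fun h4 => hfe' <| by
          have h5 : e + f' = 0 := by
            have := congrArg (f + ·) h4
            rw [add_self_vec, add_left_comm, ← add_assoc f, add_self_vec, zero_add] at this
            exact this.symm
          calc f' = e + (e + f') := by rw [← add_assoc, add_self_vec, zero_add]
            _ = e := by rw [h5, add_zero]
        obtain ⟨w, h1, h2, h3⟩ := exists_symp_eq_one (x := f) (a := e) (b := f + f') hf hfe
          (by simpa using hf') h0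
        refine ⟨w, by rw [h2, hc], h1, ?_⟩
        rw [symp_add_left, h1] at h3
        rw [symp_comm]
        exact (CharTwo.add_eq_zero.1 h3).symm
      -- Equality would mean `f = e + f'` and hence `⟨f, f'⟩ = ⟨e, f'⟩ = 1`.
      · have h0' : f ≠ e + f + (f + f') := fun h4 => by
          have h5 : f = e + f' := by
            conv_lhs => rw [h4]
            rw [add_assoc, ← add_assoc f, add_self_vec, zero_add]
          have h6 : symp f f' = symp e f' := by
            conv_lhs => rw [h5]
            rw [symp_add_left, symp_self, add_zero]
          rw [h6, ← h, hc] at h0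
          exact one_ne_zero h0
        obtain ⟨w, h1, h2, h3⟩ := exists_symp_eq_one (x := f) (a := e + f) (b := f + f') hf
          (by simpa using he) (by simpa using hf') h0'
        rw [symp_add_left, h1] at h2 h3
        refine ⟨w, by rw [CharTwo.add_eq_zero.1 h2, hc], h1, ?_⟩
        rw [symp_comm]
        exact (CharTwo.add_eq_zero.1 h3).symm
    refine ⟨_, (isSymplectic_transvection (f + w)).trans (isSymplectic_transvection (w + f')),
      ?_, ?_⟩
    · rw [AddEquiv.trans_apply, hfix w hw, hfix' w hw]
    · rw [AddEquiv.trans_apply, transvection_add_apply hw1, transvection_add_apply hw2]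
  · exact ⟨_, isSymplectic_transvection (f + f'), hfix f' h.symm, transvection_add_apply h1⟩

theorem perp_map {T : (Fin n → F4) ≃+ (Fin n → F4)} (hT : IsSymplectic T)
    (C : AddSubgroup (Fin n → F4)) {e : Fin n → F4} :
    T e ∈ perp (C.map (T : (Fin n → F4) →+ (Fin n → F4))) ↔ e ∈ perp C := by
  simp only [mem_perp, AddSubgroup.mem_map, forall_exists_index, and_imp,
    forall_apply_eq_imp_iff₂]
  exact forall₂_congr fun f _ => by rw [AddMonoidHom.coe_coe, hT]

theorem map_mem_stabCodes {T : (Fin n → F4) ≃+ (Fin n → F4)} (hT : IsSymplectic T)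
    {C : AddSubgroup (Fin n → F4)} (hC : C ∈ stabCodes n k) :
    C.map (T : (Fin n → F4) →+ (Fin n → F4)) ∈ stabCodes n k := by
  rw [mem_stabCodes] at hC ⊢
  refine ⟨?_, ?_⟩
  · rw [← hC.1]
    congr 1
    exact (Nat.card_congr (C.equivMapOfInjective _ T.injective).toEquiv).symm
  · rintro _ ⟨e, he, rfl⟩
    exact (perp_map hT C).2 (hC.2 he)

end Isometries

/-! ### Counting stabilizer codes by transitivity -/

section Counting

open Classical in
/-- The `[[n, k]]` codes with the property `A`. -/
noncomputable def codesWith (n k : ℕ) (A : AddSubgroup (Fin n → F4) → Prop) :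
    Finset (AddSubgroup (Fin n → F4)) := Finset.univ.filter fun C => C ∈ stabCodes n k ∧ A C

variable {n k : ℕ} {A B : AddSubgroup (Fin n → F4) → Prop}

theorem mem_codesWith {C : AddSubgroup (Fin n → F4)} :
    C ∈ codesWith n k A ↔ C ∈ stabCodes n k ∧ A C := by simp [codesWith]

theorem stabProb_eq : stabProb n k A
    = ((codesWith n k A).card : ℝ) / (codesWith n k fun _ => True).card := by
  have h : ∀ A, (codesWith n k A).card = {C ∈ stabCodes n k | A C}.ncard := fun A => by
    rw [← Set.ncard_coe_finset]
    congr 1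
    ext C
    simp [mem_codesWith]
  rw [stabProb, h, h]
  simp

/-- An isometry acts injectively on the `[[n, k]]` codes. This symmetry is all that is used about
their distribution beyond the sizes of `C` and `C^⊥`. -/
theorem card_codesWith_le_of_map {T : (Fin n → F4) ≃+ (Fin n → F4)} (hT : IsSymplectic T)
    (h : ∀ C, A C → B (C.map (T : (Fin n → F4) →+ (Fin n → F4)))) :
    (codesWith n k A).card ≤ (codesWith n k B).card := by
  refine Finset.card_le_card_of_injOn (fun C => C.map (T : (Fin n → F4) →+ (Fin n → F4))) ?_ ?_
  · intro C hC
    have hC' := mem_codesWith.1 hC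
    exact mem_codesWith.2 ⟨map_mem_stabCodes hT hC'.1, h C hC'.2⟩
  · exact (AddSubgroup.map_injective T.injective).injOn

theorem map_mem_iff {T : (Fin n → F4) ≃+ (Fin n → F4)} (C : AddSubgroup (Fin n → F4))
    {e : Fin n → F4} : T e ∈ C.map (T : (Fin n → F4) →+ (Fin n → F4)) ↔ e ∈ C := by
  exact AddSubgroup.mem_map_equiv.trans (by simp)

/-- The undetectable nontrivial errors of the code. -/
def Logical (C : AddSubgroup (Fin n → F4)) (e : Fin n → F4) : Prop := e ∈ perp C ∧ e ∉ C

theorem Logical.map {T : (Fin n → F4) ≃+ (Fin n → F4)} (hT : IsSymplectic T)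
    {C : AddSubgroup (Fin n → F4)} {e : Fin n → F4} (h : Logical C e) :
    Logical (C.map (T : (Fin n → F4) →+ (Fin n → F4))) (T e) :=
  ⟨(perp_map hT C).2 h.1, fun h' => h.2 ((map_mem_iff C).1 h')⟩

theorem Logical.ne_zero {C : AddSubgroup (Fin n → F4)} {e : Fin n → F4} (h : Logical C e) :
    e ≠ 0 := by
  rintro rfl
  exact h.2 C.zero_mem

open Classical in
theorem card_filter_mem (D : AddSubgroup (Fin n → F4)) :
    (Finset.univ.filter (· ∈ D)).card = Nat.card D := by
  rw [Nat.card_eq_fintype_card, Fintype.card_subtype]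

open Classical in
/-- Exchange of the order of summation. -/
theorem sum_card_codesWith (s : Finset (Fin n → F4))
    (A : AddSubgroup (Fin n → F4) → Prop) (P : AddSubgroup (Fin n → F4) → (Fin n → F4) → Prop) :
    ∑ e ∈ s, (codesWith n k fun C => A C ∧ P C e).card
      = ∑ C ∈ codesWith n k A, (s.filter (P C)).card := by
  have h : ∀ e, (codesWith n k fun C => A C ∧ P C e)
      = (codesWith n k A).filter fun C => P C e := fun e => by
    ext C; simp [mem_codesWith, and_assoc]
  simp only [h, Finset.card_filter]
  exact Finset.sum_comm

open Classical in
theorem card_filter_ne_zero (n : ℕ) :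
    (Finset.univ.filter fun e : Fin n → F4 => e ≠ 0).card + 1 = 2 ^ n * 2 ^ n := by
  rw [Finset.filter_ne', Finset.card_erase_of_mem (Finset.mem_univ _), Finset.card_univ,
    Nat.sub_add_cancel Fintype.card_pos]
  simp [← mul_pow]

/-- All nonzero vectors lie in equally many dual codes, and each dual code has `2 ^ (n + k) - 1`
nonzero elements. Double counting gives the bound. The terms `-1` on both sides do no harm, since a
vector lies in at most all of the dual codes. -/
theorem card_codesWith_perp {e : Fin n → F4} (he : e ≠ 0) :
    (codesWith n k fun C => e ∈ perp C).card * (2 ^ n * 2 ^ n)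
      ≤ (codesWith n k fun _ => True).card * 2 ^ (n + k) := by
  classical
  have h1 := sum_card_codesWith (k := k) (Finset.univ.filter fun e : Fin n → F4 => e ≠ 0)
    (fun _ => True) (fun C e => e ∈ perp C)
  simp only [true_and] at h1
  have h2 : ∀ f ∈ Finset.univ.filter (fun e : Fin n → F4 => e ≠ 0),
      (codesWith n k fun C => e ∈ perp C).card ≤ (codesWith n k fun C => f ∈ perp C).card := by
    intro f hf
    obtain ⟨T, hT, rfl⟩ := exists_isSymplectic he (by simpa using hf)
    exact card_codesWith_le_of_map hT fun C => (perp_map hT C).2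
  have h3 := Finset.card_nsmul_le_sum _ _ _ h2
  have h4 : ∀ C ∈ codesWith n k fun _ => True,
      ((Finset.univ.filter fun e : Fin n → F4 => e ≠ 0).filter (· ∈ perp C)).card + 1
        = 2 ^ (n + k) := by
    intro C hC
    rw [← card_perp (mem_codesWith.1 hC).1, ← card_filter_mem, Finset.filter_filter]
    rw [← Finset.card_erase_add_one (a := 0) (s := Finset.univ.filter (· ∈ perp C))
      (by simp [(perp C).zero_mem])]
    congr 2
    ext f
    simp
  have h5 := Finset.sum_congr rfl h4
  rw [Finset.sum_add_distrib, Finset.sum_const, Finset.sum_const, smul_eq_mul, smul_eq_mul,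
    mul_one] at h5
  have h6 : (codesWith n k fun C => e ∈ perp C).card ≤ (codesWith n k fun _ => True).card :=
    Finset.card_le_card fun C hC => mem_codesWith.2 ⟨(mem_codesWith.1 hC).1, trivial⟩
  rw [← card_filter_ne_zero n, smul_eq_mul] at *
  rw [h1] at h3
  nlinarith

/-- Double counting as for `card_codesWith_perp`, now with the `2 ^ (n + k) - 2 ^ (n - k)` elements
of `perp C` outside `C`, all of which are nonzero. -/
theorem card_codesWith_logical {e : Fin n → F4} (he : e ≠ 0) :
    (codesWith n k fun _ => True).card * 2 ^ (n + k) ≤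
      (codesWith n k fun C => Logical C e).card * (2 ^ n * 2 ^ n) +
        (codesWith n k fun _ => True).card * 2 ^ (n - k) := by
  classical
  have h1 := sum_card_codesWith (k := k) (Finset.univ.filter fun e : Fin n → F4 => e ≠ 0)
    (fun _ => True) (fun C e => Logical C e)
  simp only [true_and] at h1
  have h2 : ∀ f ∈ Finset.univ.filter (fun e : Fin n → F4 => e ≠ 0),
      (codesWith n k fun C => Logical C f).card ≤ (codesWith n k fun C => Logical C e).card := by
    intro f hf
    obtain ⟨T, hT, rfl⟩ := exists_isSymplectic (f := e) (e := f) (by simpa using hf) he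
    exact card_codesWith_le_of_map hT fun C => Logical.map hT
  have h3 := Finset.sum_le_card_nsmul _ _ _ h2
  have h4 : ∀ C ∈ codesWith n k fun _ => True,
      ((Finset.univ.filter fun e : Fin n → F4 => e ≠ 0).filter (Logical C)).card + 2 ^ (n - k)
        = 2 ^ (n + k) := by
    intro C hC
    have hC' := (mem_codesWith.1 hC).1
    have hcard : Nat.card C = 2 ^ (n - k) := by
      have h1 := (mem_stabCodes.1 hC').1
      have h2 : 2 ^ n = 2 ^ (n - k) * 2 ^ k := by
        rw [← pow_add, Nat.sub_add_cancel (le_of_mem_stabCodes hC')]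
      rw [h2] at h1
      exact Nat.eq_of_mul_eq_mul_right (by positivity) h1
    rw [← card_perp hC', ← hcard, ← card_filter_mem, ← card_filter_mem (perp C)]
    rw [← Finset.card_union_of_disjoint]
    · congr 1
      ext f
      simp only [Finset.mem_union, Finset.mem_filter, Finset.mem_univ, true_and]
      constructor
      · rintro (h | h)
        exacts [h.2.1, (mem_stabCodes.1 hC').2 h]
      · intro h
        by_cases hf : f ∈ C
        exacts [Or.inr hf, Or.inl ⟨Logical.ne_zero ⟨h, hf⟩, h, hf⟩]
    · rw [Finset.disjoint_left]
      intro f hf hf'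
      simp only [Finset.mem_filter, Finset.mem_univ, true_and] at hf hf'
      exact hf.2.2 hf'
  have h5 := Finset.sum_congr rfl h4
  rw [Finset.sum_add_distrib, Finset.sum_const, Finset.sum_const, smul_eq_mul, smul_eq_mul] at h5
  rw [← h5, ← card_filter_ne_zero n, ← h1]
  rw [smul_eq_mul] at h3
  nlinarith

-- Translation by `d` exchanges the two values of `⟨e, ·⟩` on `D`.
open Classical in
theorem card_filter_symp (D : AddSubgroup (Fin n → F4)) {e d : Fin n → F4} (hd : d ∈ D)
    (hed : symp e d = 1) (c : ZMod 2) :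
    2 * (Finset.univ.filter fun f => f ∈ D ∧ symp e f = c).card = Nat.card D := by
  have h1 : (Finset.univ.filter fun f => f ∈ D ∧ symp e f = c).card
      = (Finset.univ.filter fun f => f ∈ D ∧ symp e f ≠ c).card := by
    refine Finset.card_bij (fun f _ => f + d) ?_ (fun _ _ _ _ h => add_right_cancel h) ?_
    · intro f hf
      simp only [Finset.mem_filter, Finset.mem_univ, true_and] at hf ⊢
      refine ⟨D.add_mem hf.1 hd, ?_⟩
      rw [symp_add_right, hf.2, hed]
      simp
    · intro f hf
      simp only [Finset.mem_filter, Finset.mem_univ, true_and] at hf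
      refine ⟨f + d, ?_, by rw [add_assoc, add_self_vec, add_zero]⟩
      simp only [Finset.mem_filter, Finset.mem_univ, true_and]
      refine ⟨D.add_mem hf.1 hd, ?_⟩
      rw [symp_add_right, hed]
      have : ∀ a b : ZMod 2, a ≠ b → a + 1 = b := by decide
      exact this _ _ hf.2
  rw [two_mul]
  conv_lhs => rw [h1]
  rw [← card_filter_mem, ← Finset.card_filter_add_card_filter_not
    (s := Finset.univ.filter (· ∈ D)) (fun f => symp e f = c), Finset.filter_filter,
    Finset.filter_filter, ← h1]

/-- By transitivity `f` may be replaced by any vector other than `0`, `e` with the same product `c`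
with `e`; these are almost half of all vectors. If `e` is logical, then `e ∉ C = perp (perp C)`, so
exactly half of `perp C` has product `c` with `e`. The two halves cancel. The term with factor `4`
accounts for the excluded vectors `0` and `e`. -/
theorem card_codesWith_logical_pair {e f : Fin n → F4} (he : e ≠ 0) (hf : f ≠ 0) (hfe : f ≠ e) :
    (codesWith n k fun C => Logical C e ∧ Logical C f).card * (2 ^ n * 2 ^ n) ≤
      (codesWith n k fun C => Logical C e).card * 2 ^ (n + k)
        + 4 * (codesWith n k fun C => Logical C e ∧ Logical C f).card := by
  classical
  set c := symp e f with hc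
  set s : Finset (Fin n → F4) :=
    Finset.univ.filter fun f' => symp e f' = c ∧ f' ≠ 0 ∧ f' ≠ e with hs
  have h1 := sum_card_codesWith (k := k) s (fun C => Logical C e) (fun C f => Logical C f)
  have h2 : ∀ f' ∈ s, (codesWith n k fun C => Logical C e ∧ Logical C f).card
      ≤ (codesWith n k fun C => Logical C e ∧ Logical C f').card := by
    intro f' hf'
    simp only [hs, Finset.mem_filter, Finset.mem_univ, true_and] at hf'
    obtain ⟨T, hT, hTe, hTf⟩ := exists_isSymplectic_fixing he hf hfe hf'.2.1 hf'.2.2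
      (hc.symm.trans hf'.1.symm)
    refine card_codesWith_le_of_map hT fun C hC => ?_
    rw [← hTf]
    conv => arg 1; arg 2; rw [← hTe]
    exact ⟨hC.1.map hT, hC.2.map hT⟩
  have h3 := Finset.card_nsmul_le_sum _ _ _ h2
  have h4 : ∀ C ∈ codesWith n k fun C => Logical C e,
      2 * (s.filter (Logical C)).card ≤ 2 ^ (n + k) := by
    intro C hC
    obtain ⟨hC, hCe⟩ := mem_codesWith.1 hC
    have h5 := hCe.2
    rw [← perp_perp C, mem_perp] at h5
    push Not at h5
    obtain ⟨d, hd, hed⟩ := h5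
    rw [← card_perp hC, ← card_filter_symp (perp C) hd (ZMod.eq_one_of_ne_zero hed) c]
    refine Nat.mul_le_mul_left _ (Finset.card_le_card fun f' hf' => ?_)
    simp only [hs, Finset.mem_filter, Finset.mem_univ, true_and] at hf' ⊢
    exact ⟨hf'.2.1, hf'.1.1⟩
  have h6 := Finset.sum_le_card_nsmul _ _ _ h4
  rw [← Finset.mul_sum, ← h1] at h6
  -- Half of all vectors have product `c` with `e`, and at most `0` and `e` are missing from `s`.
  have h7 : 2 ^ n * 2 ^ n ≤ 2 * s.card + 4 := by
    obtain ⟨d, hed, -⟩ := exists_symp_eq_one (x := e) (a := 0) (b := 0) he he he (by simpa using he)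
    have h8 := card_filter_symp ⊤ (AddSubgroup.mem_top d) hed c
    have h9 : Nat.card (⊤ : AddSubgroup (Fin n → F4)) = 2 ^ n * 2 ^ n := by
      rw [AddSubgroup.card_top]; simp [← mul_pow]
    rw [h9] at h8
    rw [← h8]
    have h10 : (Finset.univ.filter fun f => f ∈ (⊤ : AddSubgroup (Fin n → F4)) ∧ symp e f = c)
        ⊆ s ∪ {0, e} := by
      intro f' hf'
      simp only [hs, Finset.mem_filter, Finset.mem_univ, true_and, AddSubgroup.mem_top,
        Finset.mem_union, Finset.mem_insert, Finset.mem_singleton] at hf' ⊢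
      tauto
    have h11 := (Finset.card_le_card h10).trans (Finset.card_union_le _ _)
    have h12 : ({0, e} : Finset (Fin n → F4)).card ≤ 2 := Finset.card_le_two
    omega
  simp only [smul_eq_mul] at h3 h6
  set X := (codesWith n k fun C => Logical C e ∧ Logical C f).card
  have h8 : X * (2 ^ n * 2 ^ n) ≤ X * (2 * s.card + 4) := Nat.mul_le_mul_left _ h7
  nlinarith

/-- Vectors whose second coordinates vanish are orthogonal to each other. Those supported on `n - k`
positions form a code. -/
theorem stabCodes_nonempty (hk : k ≤ n) : (stabCodes n k).Nonempty := by
  let F : (Fin (n - k) → ZMod 2) →+ (Fin n → F4) :=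
    { toFun := fun x i => (if h : (i : ℕ) < n - k then x ⟨i, h⟩ else 0, 0)
      map_zero' := by funext i; simp
      map_add' := fun x y => by
        funext i
        simp only [Pi.add_apply]
        split_ifs <;> simp }
  have hF : Function.Injective F := by
    intro x y hxy
    funext i
    have h1 := congrArg Prod.fst (congrFun hxy ⟨i, by omega⟩)
    simpa [F] using h1
  refine ⟨F.range, ?_⟩
  rw [mem_stabCodes]
  constructor
  · have h1 : Nat.card F.range = 2 ^ (n - k) := by
      rw [← Nat.card_congr (AddMonoidHom.ofInjective hF).toEquiv]
      simp
    rw [h1, ← pow_add, Nat.sub_add_cancel hk]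
  · rintro _ ⟨x, rfl⟩ _ ⟨y, rfl⟩
    simp [symp, F]

end Counting

/-! ### First and second moments -/

section Probability

variable {n k : ℕ} {A B : AddSubgroup (Fin n → F4) → Prop}

theorem card_codesWith_pos (hk : k ≤ n) : 0 < (codesWith n k fun _ => True).card := by
  obtain ⟨C, hC⟩ := stabCodes_nonempty hk
  exact Finset.card_pos.2 ⟨C, mem_codesWith.2 ⟨hC, trivial⟩⟩

theorem codesWith_subset (h : ∀ C ∈ stabCodes n k, A C → B C) :
    codesWith n k A ⊆ codesWith n k B := fun C hC => by
  rw [mem_codesWith] at hC ⊢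
  exact ⟨hC.1, h C hC.1 hC.2⟩

theorem stabProb_mono (h : ∀ C ∈ stabCodes n k, A C → B C) :
    stabProb n k A ≤ stabProb n k B := by
  rw [stabProb_eq, stabProb_eq]
  gcongr
  exact codesWith_subset h

theorem stabProb_le_one : stabProb n k A ≤ 1 := by
  rw [stabProb_eq]
  refine div_le_one_of_le₀ ?_ (by positivity)
  exact_mod_cast Finset.card_le_card (codesWith_subset fun _ _ _ => trivial)

theorem stabProb_or_le :
    stabProb n k (fun C => A C ∨ B C) ≤ stabProb n k A + stabProb n k B := by
  classical
  simp only [stabProb_eq]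
  rw [← add_div]
  gcongr
  have h : codesWith n k (fun C => A C ∨ B C) ⊆ codesWith n k A ∪ codesWith n k B := fun C hC => by
    rw [Finset.mem_union]
    simp only [mem_codesWith] at hC ⊢
    tauto
  exact_mod_cast (Finset.card_le_card h).trans (Finset.card_union_le _ _)

theorem stabProb_add_not (hk : k ≤ n) :
    stabProb n k A + stabProb n k (fun C => ¬ A C) = 1 := by
  classical
  have hpos : (0 : ℝ) < (codesWith n k fun _ => True).card := by
    exact_mod_cast card_codesWith_pos hk
  simp only [stabProb_eq]
  rw [← add_div, div_eq_one_iff_eq hpos.ne']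
  rw [← Nat.cast_add, ← Finset.card_union_of_disjoint]
  · congr 2
    ext C
    simp only [Finset.mem_union, mem_codesWith]
    tauto
  · rw [Finset.disjoint_left]
    intro C hC hC'
    exact (mem_codesWith.1 hC').2 (mem_codesWith.1 hC).2

open Classical in
/-- The number of nonzero elements of the dual code in a family of sets. -/
noncomputable def hits (N : ℕ) (s : ℕ → Finset (Fin n → F4)) (C : AddSubgroup (Fin n → F4)) : ℕ :=
  ∑ q ∈ Finset.range N, ((s q).filter fun e => e ≠ 0 ∧ e ∈ perp C).card

/-- Markov's inequality for the number of hits. -/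
theorem stabProb_le_hits (hk : k ≤ n) (N : ℕ) (s : ℕ → Finset (Fin n → F4)) (a : ℝ) :
    stabProb n k (fun C => a ≤ hits N s C) * a
      ≤ (∑ q ∈ Finset.range N, ((s q).card : ℝ)) * (2 ^ k / 2 ^ n) := by
  classical
  have hpos : (0 : ℝ) < (codesWith n k fun _ => True).card := by
    exact_mod_cast card_codesWith_pos hk
  have h1 : ((codesWith n k fun C => a ≤ hits N s C).card : ℝ) * a
      ≤ ∑ C ∈ codesWith n k fun _ => True, (hits N s C : ℝ) := by
    calc _ = ∑ C ∈ codesWith n k fun C => a ≤ hits N s C, a := by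
          rw [Finset.sum_const, nsmul_eq_mul]
      _ ≤ ∑ C ∈ codesWith n k fun C => a ≤ hits N s C, (hits N s C : ℝ) :=
          Finset.sum_le_sum fun C hC => (mem_codesWith.1 hC).2
      _ ≤ _ := Finset.sum_le_sum_of_subset_of_nonneg (codesWith_subset fun _ _ _ => trivial)
          fun _ _ _ => by positivity
  have h2 : ∑ C ∈ codesWith n k (fun _ => True), hits N s C
      = ∑ q ∈ Finset.range N, ∑ e ∈ (s q).filter (· ≠ 0),
        (codesWith n k fun C => e ∈ perp C).card := by
    simp only [hits]
    rw [Finset.sum_comm]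
    refine Finset.sum_congr rfl fun q _ => ?_
    have := sum_card_codesWith (k := k) ((s q).filter (· ≠ 0)) (fun _ => True)
      (fun C e => e ∈ perp C)
    simp only [true_and, Finset.filter_filter] at this
    exact this.symm
  have h3 : (∑ C ∈ codesWith n k (fun _ => True), hits N s C) * (2 ^ n * 2 ^ n)
      ≤ (∑ q ∈ Finset.range N, (s q).card) * ((codesWith n k fun _ => True).card * 2 ^ (n + k)) := by
    rw [h2, Finset.sum_mul, Finset.sum_mul]
    refine Finset.sum_le_sum fun q _ => ?_
    rw [Finset.sum_mul]
    refine (Finset.sum_le_card_nsmul _ _ _ fun e he =>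
      card_codesWith_perp (Finset.mem_filter.1 he).2).trans ?_
    rw [smul_eq_mul]
    exact Nat.mul_le_mul_right _ (Finset.card_filter_le _ _)
  have h4 : (∑ C ∈ codesWith n k (fun _ => True), (hits N s C : ℝ)) * (2 ^ n * 2 ^ n)
      ≤ (∑ q ∈ Finset.range N, ((s q).card : ℝ)) *
        ((codesWith n k fun _ => True).card * 2 ^ (n + k)) := by exact_mod_cast h3
  rw [stabProb_eq, div_mul_eq_mul_div, div_le_iff₀ hpos]
  refine h1.trans ?_
  have h5 : (0 : ℝ) < 2 ^ n * 2 ^ n := by positivity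
  refine le_of_mul_le_mul_right (h4.trans (le_of_eq ?_)) h5
  rw [pow_add]
  field_simp

/-- Cauchy–Schwarz for the number `Z` of logical operators in `s`, summed over the codes with `Z ≠
0`. In the second moment the diagonal contributes `s.card * p`, and every pair at most `u`. -/
theorem sum_sq_le_of_logical (s : Finset (Fin n → F4)) {p u : ℝ}
    (hp : ∀ e ∈ s, ((codesWith n k fun C => Logical C e).card : ℝ) = p)
    (hu : ∀ e ∈ s, ∀ f ∈ s, f ≠ e →
      ((codesWith n k fun C => Logical C e ∧ Logical C f).card : ℝ) ≤ u) (hu0 : 0 ≤ u) :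
    (s.card * p) ^ 2 ≤ (codesWith n k fun C => ∃ e ∈ s, Logical C e).card *
      (s.card * p + s.card ^ 2 * u) := by
  classical
  set Z : AddSubgroup (Fin n → F4) → ℝ := fun C => ((s.filter (Logical C)).card : ℝ) with hZ
  set T := codesWith n k fun C => ∃ e ∈ s, Logical C e with hT
  have hZ0 : ∀ C, C ∈ codesWith n k (fun _ => True) → C ∉ T → Z C = 0 := by
    intro C hC hCT
    rw [hZ]
    simp only [Nat.cast_eq_zero, Finset.card_eq_zero, Finset.filter_eq_empty_iff]
    intro e he hl
    exact hCT (mem_codesWith.2 ⟨(mem_codesWith.1 hC).1, e, he, hl⟩)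
  have hsub : T ⊆ codesWith n k fun _ => True := codesWith_subset fun _ _ _ => trivial
  have h1 : ∑ C ∈ T, Z C = s.card * p := by
    rw [Finset.sum_subset hsub hZ0]
    have h := sum_card_codesWith (k := k) s (fun _ => True) Logical
    simp only [true_and] at h
    have h' : ∑ C ∈ codesWith n k (fun _ => True), Z C
        = ∑ e ∈ s, ((codesWith n k fun C => Logical C e).card : ℝ) := by
      simp only [hZ]
      exact_mod_cast h.symm
    rw [h', Finset.sum_congr rfl hp, Finset.sum_const, nsmul_eq_mul]
  have h2 : ∑ C ∈ T, Z C ^ 2 ≤ s.card * p + s.card ^ 2 * u := by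
    have e1 : ∀ C, Z C ^ 2 = ∑ e ∈ s, if Logical C e then Z C else 0 := by
      intro C
      rw [← Finset.sum_filter, Finset.sum_const, nsmul_eq_mul, sq]
    calc ∑ C ∈ T, Z C ^ 2 ≤ ∑ C ∈ codesWith n k fun _ => True, Z C ^ 2 :=
          Finset.sum_le_sum_of_subset_of_nonneg hsub fun _ _ _ => by positivity
      _ = ∑ e ∈ s, ∑ C ∈ codesWith n k fun C => Logical C e, Z C := by
          simp only [e1]
          rw [Finset.sum_comm]
          refine Finset.sum_congr rfl fun e _ => ?_
          rw [← Finset.sum_filter]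
          refine Finset.sum_congr ?_ fun _ _ => rfl
          ext C; simp [mem_codesWith]
      _ = ∑ e ∈ s, ∑ f ∈ s,
            ((codesWith n k fun C => Logical C e ∧ Logical C f).card : ℝ) := by
          refine Finset.sum_congr rfl fun e _ => ?_
          simp only [hZ]
          exact_mod_cast (sum_card_codesWith s (fun C => Logical C e) Logical).symm
      _ ≤ ∑ e ∈ s, ∑ f ∈ s, ((if f = e then p else 0) + u) := by
          refine Finset.sum_le_sum fun e he => Finset.sum_le_sum fun f hf => ?_
          split_ifs with h
          · subst h
            simp only [and_self]
            rw [hp f hf]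
            linarith
          · rw [zero_add]
            exact hu e he f hf h
      _ = s.card * p + s.card ^ 2 * u := by
          simp only [Finset.sum_add_distrib, Finset.sum_ite_eq', Finset.sum_const, nsmul_eq_mul]
          rw [Finset.sum_congr rfl fun e he => if_pos he, Finset.sum_const, nsmul_eq_mul]
          ring
  calc (s.card * p) ^ 2 = (∑ C ∈ T, Z C) ^ 2 := by rw [h1]
    _ ≤ T.card * ∑ C ∈ T, Z C ^ 2 := sq_sum_le_card_mul_sum_sq
    _ ≤ _ := by gcongr

/-- Second moment bound for the existence of a logical operator in a given set. -/
theorem le_stabProb_logical (hk1 : 1 ≤ k) (hk : k ≤ n) (hn : 2 ≤ n) (s : Finset (Fin n → F4))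
    (hs0 : s.Nonempty) (hs : ∀ e ∈ s, e ≠ 0) :
    (1 - 1 / 4 ^ k) / (2 ^ n / (2 ^ k * s.card) + 1 / (1 - 4 / (2 ^ n * 2 ^ n)))
      ≤ stabProb n k fun C => ∃ e ∈ s, Logical C e := by
  have hpos : (0 : ℝ) < (codesWith n k fun _ => True).card := by
    exact_mod_cast card_codesWith_pos hk
  obtain ⟨e₀, he₀⟩ := hs0
  set p : ℝ := ((codesWith n k fun C => Logical C e₀).card : ℝ) with hpdef
  have hp : ∀ e ∈ s, ((codesWith n k fun C => Logical C e).card : ℝ) = p := by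
    intro e he
    rw [hpdef]
    norm_cast
    obtain ⟨T, hT, hTe⟩ := exists_isSymplectic (hs e he) (hs e₀ he₀)
    obtain ⟨U, hU, hUe⟩ := exists_isSymplectic (hs e₀ he₀) (hs e he)
    refine le_antisymm (card_codesWith_le_of_map hT fun C hC => hTe ▸ hC.map hT)
      (card_codesWith_le_of_map hU fun C hC => hUe ▸ hC.map hU)
  set N : ℝ := ((codesWith n k fun _ => True).card : ℝ)
  set a : ℝ := 2 ^ n with ha
  set b : ℝ := 2 ^ k with hb
  have ha4 : 4 ≤ a := by
    rw [ha]
    calc (4 : ℝ) = 2 ^ 2 := by norm_num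
      _ ≤ 2 ^ n := pow_le_pow_right₀ (by norm_num) hn
  have hb2 : 2 ≤ b := by
    rw [hb]
    calc (2 : ℝ) = 2 ^ 1 := by norm_num
      _ ≤ 2 ^ k := pow_le_pow_right₀ (by norm_num) hk1
  have hbb : (4 : ℝ) ^ k = b * b := by rw [hb, ← mul_pow]; norm_num
  have hp1 : N * (1 - 1 / (b * b)) * b ≤ p * a := by
    have h1 := card_codesWith_logical (k := k) (hs e₀ he₀)
    have h2 : N * 2 ^ (n + k) ≤ p * (2 ^ n * 2 ^ n) + N * 2 ^ (n - k) := by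
      have := (Nat.cast_le (α := ℝ)).2 h1
      push_cast at this
      exact this
    have h3 : (2 : ℝ) ^ (n - k) = a / b := by
      rw [eq_div_iff (by positivity), ha, hb, ← pow_add, Nat.sub_add_cancel hk]
    rw [h3, pow_add, ← ha, ← hb] at h2
    have h4 : N * (a * b) - N * (a / b) = N * (1 - 1 / (b * b)) * b * a := by
      field_simp
    have h5 : N * (1 - 1 / (b * b)) * b * a ≤ p * a * a := by
      rw [← h4]; linarith
    exact le_of_mul_le_mul_right h5 (by positivity)
  have hden : 0 < 1 - 4 / (a * a) := by
    rw [sub_pos, div_lt_one (by positivity)]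
    nlinarith
  have hpp : 0 < p := by
    have : 0 < 1 - 1 / (b * b) := by
      rw [sub_pos, div_lt_one (by positivity)]
      nlinarith
    have h2 : 0 < N * (1 - 1 / (b * b)) * b := by positivity
    by_contra! h
    nlinarith
  -- Given one logical operator, another vector is logical with probability at most `b / a`, up to
  -- the correction for `0` and `e` in `card_codesWith_logical_pair`.
  set u : ℝ := p * (b / a) / (1 - 4 / (a * a)) with hudef
  have hu : ∀ e ∈ s, ∀ f ∈ s, f ≠ e →
      ((codesWith n k fun C => Logical C e ∧ Logical C f).card : ℝ) ≤ u := by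
    intro e he f hf hfe
    have h1 := card_codesWith_logical_pair (k := k) (hs e he) (hs f hf) hfe
    set X : ℝ := ((codesWith n k fun C => Logical C e ∧ Logical C f).card : ℝ)
    have h2 : X * (2 ^ n * 2 ^ n) ≤
        (codesWith n k fun C => Logical C e).card * 2 ^ (n + k) + 4 * X := by
      have := (Nat.cast_le (α := ℝ)).2 h1
      push_cast at this
      exact this
    rw [hp e he, pow_add, ← ha, ← hb] at h2
    rw [hudef, le_div_iff₀ hden]
    have h3 : X * (1 - 4 / (a * a)) * (a * a) ≤ p * (b / a) * (a * a) := by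
      have e1 : X * (1 - 4 / (a * a)) * (a * a) = X * (a * a) - 4 * X := by field_simp
      have e2 : p * (b / a) * (a * a) = p * (a * b) := by field_simp
      rw [e1, e2]; linarith
    exact le_of_mul_le_mul_right h3 (by positivity)
  have hmain := sum_sq_le_of_logical s hp hu (by positivity)
  set Y : ℝ := ((codesWith n k fun C => ∃ e ∈ s, Logical C e).card : ℝ)
  have hc : (0 : ℝ) < s.card := by exact_mod_cast Finset.card_pos.2 ⟨e₀, he₀⟩
  set c : ℝ := (s.card : ℝ)
  rw [stabProb_eq, div_le_iff₀ (by positivity), div_mul_eq_mul_div, le_div_iff₀ hpos, hbb]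
  have h6 : c * p + c ^ 2 * u = c ^ 2 * p * (b / a) * (a / (b * c) + 1 / (1 - 4 / (a * a))) := by
    rw [hudef]
    field_simp
  rw [h6] at hmain
  have h7 : p ≤ Y * (b / a) * (a / (b * c) + 1 / (1 - 4 / (a * a))) := by
    have h8 : p * (c ^ 2 * p) ≤
        Y * (b / a) * (a / (b * c) + 1 / (1 - 4 / (a * a))) * (c ^ 2 * p) := by
      calc p * (c ^ 2 * p) = (c * p) ^ 2 := by ring
        _ ≤ _ := hmain
        _ = _ := by ring
    exact le_of_mul_le_mul_right h8 (by positivity)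
  have h9 : (1 - 1 / (b * b)) * N * (b / a) ≤ p := by
    rw [← mul_div_assoc, div_le_iff₀ (by positivity)]
    linarith
  have h10 : (0 : ℝ) < b / a := by positivity
  refine le_of_mul_le_mul_right ((h9.trans h7).trans (le_of_eq ?_)) h10
  ring

end Probability

/-! ### Weight enumerators -/

section Enumerators

variable {n : ℕ}

theorem sum_prod_symbols {R : Type*} [CommSemiring R] (φ : Fin n → F4 → R) :
    ∑ f : Fin n → F4, ∏ i, φ i (f i) = ∏ i, ∑ x, φ i x := by
  rw [Finset.prod_univ_sum, Fintype.piFinset_univ]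

theorem sum_pow_symbol {R : Type*} [CommSemiring R] (a : R) :
    ∑ x : F4, a ^ (if x ≠ 0 then 1 else 0) = 1 + 3 * a := by
  have h : (Finset.univ : Finset F4) = {0, (1, 0), (0, 1), (1, 1)} := by decide
  rw [h, Finset.sum_insert (by decide), Finset.sum_insert (by decide),
    Finset.sum_insert (by decide), Finset.sum_singleton]
  rw [if_neg (by decide), if_pos (by decide), if_pos (by decide), if_pos (by decide)]
  ring

/-- The summand is a product over the positions, so the sum factors. With `c = 1` all vectors are
counted, and with `c` the indicator of zero only those supported in the interval. -/
theorem sum_enumerator {π : Fin n → Fin n} (hπ : Function.Bijective π) {t₀ j : ℕ}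
    (hj : t₀ + j ≤ n) (a : ℝ) (c : F4 → ℝ) :
    ∑ f : Fin n → F4, a ^ weightOn π t₀ j f *
        ∏ t : Fin n, (if t₀ ≤ (t : ℕ) ∧ (t : ℕ) < t₀ + j then 1 else c (f (π t)))
      = (1 + 3 * a) ^ j * (∑ x, c x) ^ (n - j) := by
  classical
  let e := Equiv.ofBijective π hπ
  obtain ⟨φ, hφ⟩ : ∃ φ : Fin n → F4 → ℝ, φ = fun (t : Fin n) x =>
    if t₀ ≤ (t : ℕ) ∧ (t : ℕ) < t₀ + j then a ^ (if x ≠ 0 then 1 else 0) else c x := ⟨_, rfl⟩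
  have h1 : ∀ f : Fin n → F4, a ^ weightOn π t₀ j f *
        ∏ t : Fin n, (if t₀ ≤ (t : ℕ) ∧ (t : ℕ) < t₀ + j then 1 else c (f (π t)))
      = ∏ t : Fin n, φ t (f (π t)) := by
    intro f
    have h2 : a ^ weightOn π t₀ j f = ∏ t : Fin n, if t₀ ≤ (t : ℕ) ∧ (t : ℕ) < t₀ + j
        then a ^ (if f (π t) ≠ 0 then 1 else 0) else 1 := by
      rw [weightOn, ← Finset.filter_filter, Finset.card_filter, ← Finset.prod_pow_eq_pow_sum,
        Finset.prod_filter]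
    rw [h2, ← Finset.prod_mul_distrib]
    refine Finset.prod_congr rfl fun t _ => ?_
    rw [hφ]
    dsimp only
    split_ifs <;> simp
  simp only [h1]
  rw [← Equiv.sum_comp (Equiv.arrowCongr e (Equiv.refl F4))]
  have h3 : ∀ (f : Fin n → F4) (t : Fin n),
      (Equiv.arrowCongr e (Equiv.refl F4)) f (π t) = f t := fun f t => by
    have : e.symm (π t) = t := by rw [Equiv.symm_apply_eq]; rfl
    simp [this]
  simp only [h3]
  rw [sum_prod_symbols]
  have h4 : ∀ t : Fin n, ∑ x, φ t x
      = if t₀ ≤ (t : ℕ) ∧ (t : ℕ) < t₀ + j then 1 + 3 * a else ∑ x, c x := by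
    intro t
    rw [hφ]
    dsimp only
    split_ifs
    exacts [sum_pow_symbol a, rfl]
  rw [Finset.prod_congr rfl fun t _ => h4 t, Finset.prod_ite, Finset.prod_const,
    Finset.prod_const]
  have h5 : (Finset.univ.filter fun t : Fin n => t₀ ≤ (t : ℕ) ∧ (t : ℕ) < t₀ + j).card = j := by
    rw [← Finset.card_map Fin.valEmbedding]
    have : (Finset.univ.filter fun t : Fin n => t₀ ≤ (t : ℕ) ∧ (t : ℕ) < t₀ + j).map
        Fin.valEmbedding = Finset.Ico t₀ (t₀ + j) := by
      ext u
      simp only [Finset.mem_map, Finset.mem_filter, Finset.mem_univ, true_and,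
        Fin.valEmbedding_apply, Finset.mem_Ico]
      constructor
      · rintro ⟨t, ht, rfl⟩; exact ht
      · intro hu; exact ⟨⟨u, by omega⟩, hu, rfl⟩
    rw [this, Nat.card_Ico]; omega
  have h6 := Finset.card_filter_add_card_filter_not (s := (Finset.univ : Finset (Fin n)))
    (fun t : Fin n => t₀ ≤ (t : ℕ) ∧ (t : ℕ) < t₀ + j)
  rw [h5, Finset.card_univ, Fintype.card_fin] at h6
  rw [h5, show (Finset.univ.filter fun t : Fin n => ¬(t₀ ≤ (t : ℕ) ∧ (t : ℕ) < t₀ + j)).card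
    = n - j by omega]

/-- Chernoff's method: as `0 ≤ a ≤ 1`, each vector of weight at most `v` contributes at least `a ^
v` to the enumerator. -/
theorem card_mul_pow_le {π : Fin n → Fin n} (hπ : Function.Bijective π) {t₀ j v : ℕ}
    (hj : t₀ + j ≤ n) {a : ℝ} (ha0 : 0 ≤ a) (ha1 : a ≤ 1) {s : Finset (Fin n → F4)}
    (hs : ∀ f ∈ s, weightOn π t₀ j f ≤ v) :
    s.card * a ^ v ≤ (1 + 3 * a) ^ j * 4 ^ (n - j) := by
  have h := sum_enumerator hπ hj a (fun _ => 1)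
  simp only [ite_self, Finset.prod_const_one, mul_one] at h
  have h4 : (∑ _ : F4, (1 : ℝ)) = 4 := by simp
  rw [h4] at h
  rw [← h]
  calc s.card * a ^ v = ∑ f ∈ s, a ^ v := by rw [Finset.sum_const, nsmul_eq_mul]
    _ ≤ ∑ f ∈ s, a ^ weightOn π t₀ j f :=
        Finset.sum_le_sum fun f hf => pow_le_pow_of_le_one ha0 ha1 (hs f hf)
    _ ≤ _ := Finset.sum_le_sum_of_subset_of_nonneg (Finset.subset_univ _)
        fun _ _ _ => by positivity

theorem length_lowWeight_mul_pow_le {π : Fin n → Fin n} (hπ : Function.Bijective π) {t₀ j v : ℕ}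
    (hj : t₀ + j ≤ n) {a : ℝ} (ha0 : 0 ≤ a) (ha1 : a ≤ 1) :
    (lowWeight π v t₀ j).length * a ^ v ≤ (1 + 3 * a) ^ j := by
  classical
  have h := sum_enumerator hπ hj a (fun x => if x = 0 then 1 else 0)
  rw [Finset.sum_ite_eq' Finset.univ, if_pos (Finset.mem_univ _), one_pow, mul_one] at h
  rw [← h, ← List.toFinset_card_of_nodup (nodup_lowWeight hπ hj)]
  calc _ = ∑ f ∈ (lowWeight π v t₀ j).toFinset, a ^ v := by rw [Finset.sum_const, nsmul_eq_mul]
    _ ≤ ∑ f ∈ (lowWeight π v t₀ j).toFinset, a ^ weightOn π t₀ j f *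
        ∏ t : Fin n, (if t₀ ≤ (t : ℕ) ∧ (t : ℕ) < t₀ + j then 1
          else (fun x : F4 => if x = 0 then (1 : ℝ) else 0) (f (π t))) := by
        refine Finset.sum_le_sum fun f hf => ?_
        rw [List.mem_toFinset, mem_lowWeight hπ hj] at hf
        rw [Finset.prod_eq_one, mul_one]
        · rw [hammingNorm_eq_weightOn hπ hf.2] at hf
          exact pow_le_pow_of_le_one ha0 ha1 hf.1
        · intro t _
          split_ifs with h1
          · rfl
          · exact if_pos (hf.2 t h1)
    _ ≤ _ := by
        refine Finset.sum_le_sum_of_subset_of_nonneg (Finset.subset_univ _) fun f _ _ => ?_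
        refine mul_nonneg (by positivity) (Finset.prod_nonneg fun t _ => ?_)
        dsimp only
        split_ifs <;> norm_num

/-- This is the coefficient of `X ^ w` in the weight enumerator `(1 + 3X) ^ n`. -/
theorem card_sphere (n w : ℕ) :
    (Finset.univ.filter fun f : Fin n → F4 => hammingNorm f = w).card = n.choose w * 3 ^ w := by
  have h1 : ∑ f : Fin n → F4, (Polynomial.X : Polynomial ℕ) ^ hammingNorm f
      = (1 + 3 * Polynomial.X) ^ n := by
    have h2 := sum_prod_symbols (n := n)
      (fun _ x => (Polynomial.X : Polynomial ℕ) ^ (if x ≠ 0 then 1 else 0))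
    simp only [Finset.prod_pow_eq_pow_sum, ← Finset.card_filter, sum_pow_symbol,
      Finset.prod_const, Finset.card_univ, Fintype.card_fin] at h2
    exact h2
  have h3 := congrArg (fun p => Polynomial.coeff p w) h1
  simp only [Polynomial.finsetSum_coeff, Polynomial.coeff_X_pow] at h3
  have h4 : ((1 + 3 * Polynomial.X : Polynomial ℕ) ^ n).coeff w = n.choose w * 3 ^ w := by
    have h5 : (1 + 3 * Polynomial.X : Polynomial ℕ) ^ n
        = ((1 + Polynomial.X : Polynomial ℕ) ^ n).comp (3 * Polynomial.X) := by
      simp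
    rw [h5]
    have := Polynomial.comp_C_mul_X_coeff (p := (1 + Polynomial.X : Polynomial ℕ) ^ n) (r := 3)
      (n := w)
    rw [Polynomial.coeff_one_add_X_pow] at this
    simpa using this
  rw [h4] at h3
  rw [Finset.card_filter, ← h3]
  exact Finset.sum_congr rfl fun f _ => by simp [eq_comm]

/-- The binomial expansion of `(w + (n - w)) ^ n` has `n + 1` terms, and the term with index `w` is
the largest. -/
theorem pow_self_le {w : ℕ} (hw : w < n) :
    n ^ n ≤ (n + 1) * (n.choose w * w ^ w * (n - w) ^ (n - w)) := by
  let t : ℕ → ℕ := fun j => n.choose j * w ^ j * (n - w) ^ (n - j)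
  obtain ⟨d, rfl⟩ : ∃ d, n = w + d := ⟨n - w, by omega⟩
  have hd : 0 < d := by omega
  have hsub : w + d - w = d := by omega
  -- The quotient of consecutive terms is `(n - j) w / ((j + 1) (n - w))`, at least one for `j < w`
  -- and at most one for `j ≥ w`.
  have hrec : ∀ j < w + d, t (j + 1) * ((j + 1) * d) = t j * ((w + d - j) * w) := by
    intro j hj
    have h1 := Nat.choose_succ_right_eq (w + d) j
    have h2 : d ^ (w + d - j) = d ^ (w + d - (j + 1)) * d := by
      rw [← pow_succ]; congr 1; omega
    simp only [t, hsub, h2, pow_succ]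
    calc _ = ((w + d).choose (j + 1) * (j + 1)) * (w ^ j * w * d ^ (w + d - (j + 1)) * d) := by ring
      _ = _ := by rw [h1]; ring
  have hup : ∀ j < w, t j ≤ t (j + 1) := by
    intro j hj
    have h1 : (j + 1) * d ≤ (w + d - j) * w := by
      obtain ⟨e, rfl⟩ : ∃ e, w = j + 1 + e := ⟨w - (j + 1), by omega⟩
      rw [show j + 1 + e + d - j = 1 + e + d by omega]
      nlinarith
    refine Nat.le_of_mul_le_mul_right (?_ : t j * ((j + 1) * d) ≤ t (j + 1) * ((j + 1) * d))
      (by positivity)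
    rw [hrec j (by omega)]
    exact Nat.mul_le_mul_left _ h1
  have hdown : ∀ j, w ≤ j → j < w + d → t (j + 1) ≤ t j := by
    intro j hj hj'
    have h1 : (w + d - j) * w ≤ (j + 1) * d := by
      calc (w + d - j) * w ≤ d * (j + 1) := Nat.mul_le_mul (by omega) (by omega)
        _ = _ := mul_comm _ _
    refine Nat.le_of_mul_le_mul_right (?_ : t (j + 1) * ((j + 1) * d) ≤ t j * ((j + 1) * d))
      (by positivity)
    rw [hrec j hj']
    exact Nat.mul_le_mul_left _ h1
  have hmax : ∀ j ≤ w + d, t j ≤ t w := by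
    intro j hj
    rcases le_total j w with h | h
    · induction h using Nat.decreasingInduction with
      | self => exact le_rfl
      | of_succ i hi ih => exact (hup i hi).trans (ih (by omega))
    · induction j, h using Nat.le_induction with
      | base => exact le_rfl
      | succ i hi ih => exact (hdown i hi (by omega)).trans (ih (by omega))
  calc (w + d) ^ (w + d) = ∑ j ∈ Finset.range (w + d + 1), t j := by
        rw [add_pow]
        refine Finset.sum_congr rfl fun j _ => ?_
        simp only [t, hsub, Nat.cast_id]
        ring
    _ ≤ ∑ j ∈ Finset.range (w + d + 1), t w :=
        Finset.sum_le_sum fun j hj => hmax j (by simp at hj; omega)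
    _ = _ := by rw [Finset.sum_const, Finset.card_range, smul_eq_mul]

end Enumerators

/-! ### The quaternary entropy function -/

section Entropy

theorem entropyQ_four_mul_log (x : ℝ) : entropyQ 4 x * Real.log 4
    = x * Real.log 3 - x * Real.log x - (1 - x) * Real.log (1 - x) := by
  have h4 : Real.log 4 ≠ 0 := (Real.log_pos (by norm_num)).ne'
  simp only [entropyQ, Real.logb, Nat.cast_ofNat]
  rw [show (4 : ℝ) - 1 = 3 by norm_num]
  field_simp

theorem entropyQ_four_eq (x : ℝ) : entropyQ 4 x = Real.qaryEntropy 4 x / Real.log 4 := by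
  rw [eq_div_iff (Real.log_pos (by norm_num)).ne', entropyQ_four_mul_log, Real.qaryEntropy,
    Real.binEntropy_eq_negMulLog_add_negMulLog_one_sub, Real.negMulLog, Real.negMulLog]
  norm_num
  ring

theorem continuous_entropyQ_four : Continuous (entropyQ 4) := by
  have : entropyQ 4 = fun x => Real.qaryEntropy 4 x / Real.log 4 := funext entropyQ_four_eq
  rw [this]
  fun_prop

theorem strictMonoOn_entropyQ_four : StrictMonoOn (entropyQ 4) (Set.Icc 0 (3 / 4)) := by
  have h := Real.qaryEntropy_strictMonoOn (q := 4) (by norm_num)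
  rw [show (1 : ℝ) - 1 / (4 : ℕ) = 3 / 4 by norm_num] at h
  intro x hx y hy hxy
  rw [entropyQ_four_eq, entropyQ_four_eq]
  exact div_lt_div_of_pos_right (h hx hy hxy) (Real.log_pos (by norm_num))

theorem entropyQ_four_zero : entropyQ 4 0 = 0 := by simp [entropyQ]

theorem entropyQ_four_max : entropyQ 4 (3 / 4) = 1 := by
  have h := entropyQ_four_mul_log (3 / 4)
  have h1 : Real.log (3 / 4) = Real.log 3 - Real.log 4 :=
    Real.log_div (by norm_num) (by norm_num)
  have h2 : Real.log (1 - 3 / 4) = - Real.log 4 := by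
    rw [show (1 : ℝ) - 3 / 4 = 4⁻¹ by norm_num, Real.log_inv]
  rw [h1, h2] at h
  have h4 : Real.log 4 ≠ 0 := (Real.log_pos (by norm_num)).ne'
  refine mul_right_cancel₀ h4 (h.trans ?_)
  ring

theorem exists_entropyQ_four_eq {y : ℝ} (h0 : 0 < y) (h1 : y < 1) :
    ∃ x, 0 < x ∧ x < 3 / 4 ∧ entropyQ 4 x = y := by
  have h := intermediate_value_Ioo (show (0 : ℝ) ≤ 3 / 4 by norm_num)
    continuous_entropyQ_four.continuousOn
  rw [entropyQ_four_zero, entropyQ_four_max] at h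
  obtain ⟨x, hx, hxy⟩ := h ⟨h0, h1⟩
  exact ⟨x, hx.1, hx.2, hxy⟩

theorem log_four : Real.log 4 = 2 * Real.log 2 := by
  rw [show (4 : ℝ) = 2 ^ 2 by norm_num, Real.log_pow]
  norm_num

/-- The tilting parameter belonging to the relative weight `x`. -/
noncomputable def tilt (x : ℝ) : ℝ := x / (3 * (1 - x))

theorem tilt_pos {x : ℝ} (h0 : 0 < x) (h1 : x ≤ 3 / 4) : 0 < tilt x := by
  have : 0 < 1 - x := by linarith
  rw [tilt]; positivity

theorem tilt_le_one {x : ℝ} (h1 : x ≤ 3 / 4) : tilt x ≤ 1 := by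
  rw [tilt, div_le_one (by linarith)]
  linarith

/-- At the optimal point `1 + 3 * tilt x = 1 / (1 - x)`, and `(1 + 3 * tilt x) ^ j` equals `tilt x ^
(x * j) * 2 ^ (2 * j * entropyQ 4 x)`. Exceeding the weight `x * j` by `c` costs a factor `tilt x ^
(-c)`, since `tilt x ≤ 1`. -/
theorem one_add_tilt_pow_le {x c : ℝ} (h0 : 0 < x) (h1 : x ≤ 3 / 4) {j v : ℕ}
    (hv : (v : ℝ) ≤ x * j + c) :
    (1 + 3 * tilt x) ^ j ≤ (tilt x) ^ v * (tilt x ^ (-c) * 2 ^ (2 * j * entropyQ 4 x)) := by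
  have ht := tilt_pos h0 h1
  have hx : 0 < 1 - x := by linarith
  have e1 : 1 + 3 * tilt x = (1 - x)⁻¹ := by
    rw [tilt]; field_simp; ring
  have e2 : (1 + 3 * tilt x) ^ j = tilt x ^ (x * j) * 2 ^ (2 * j * entropyQ 4 x) := by
    have hl : (2 * j * entropyQ 4 x) * Real.log 2 = j * (entropyQ 4 x * Real.log 4) := by
      rw [log_four]; ring
    rw [e1, ← Real.exp_log (show 0 < (1 - x)⁻¹ ^ j by positivity),
      Real.rpow_def_of_pos ht, Real.rpow_def_of_pos (by norm_num : (0 : ℝ) < 2), ← Real.exp_add,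
      mul_comm (Real.log 2), hl, entropyQ_four_mul_log, Real.log_pow, Real.log_inv, tilt,
      Real.log_div h0.ne' (by positivity), Real.log_mul (by norm_num) hx.ne']
    congr 1
    ring
  rw [e2, ← mul_assoc]
  gcongr
  rw [← Real.rpow_natCast, ← Real.rpow_add ht]
  exact Real.rpow_le_rpow_of_exponent_ge ht (tilt_le_one h1) (by linarith)

theorem rpow_entropy_le_card {n w : ℕ} (hw1 : 1 ≤ w) (hw : w < n) :
    (2 : ℝ) ^ (2 * n * entropyQ 4 (w / n)) ≤ (n + 1) * (n.choose w * 3 ^ w : ℕ) := by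
  obtain ⟨d, rfl⟩ : ∃ d, n = w + d := ⟨n - w, by omega⟩
  have h := pow_self_le hw
  have hd : (0 : ℝ) < d := by
    have : 0 < d := by omega
    exact_mod_cast this
  have hw0 : (0 : ℝ) < w := by exact_mod_cast hw1
  rw [Nat.add_sub_cancel_left] at h
  have h' : ((w : ℝ) + d) ^ (w + d) ≤
      (w + d + 1) * ((w + d).choose w * w ^ w * d ^ d) := by exact_mod_cast h
  have e : (2 : ℝ) ^ (2 * ((w + d : ℕ) : ℝ) * entropyQ 4 (w / (w + d : ℕ)))
      = 3 ^ w * (w + d) ^ (w + d) / (w ^ w * d ^ d) := by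
    have hl : (2 * ((w + d : ℕ) : ℝ) * entropyQ 4 (w / (w + d : ℕ))) * Real.log 2
        = (w + d) * (entropyQ 4 (w / (w + d)) * Real.log 4) := by
      rw [log_four]; push_cast; ring
    have hx : 1 - (w : ℝ) / (w + d) = d / (w + d) := by field_simp; ring
    rw [← Real.exp_log (show (0 : ℝ) < 3 ^ w * (w + d) ^ (w + d) / (w ^ w * d ^ d) by positivity),
      Real.rpow_def_of_pos (by norm_num : (0 : ℝ) < 2), mul_comm (Real.log 2), hl,
      entropyQ_four_mul_log, hx, Real.log_div (by positivity) (by positivity),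
      Real.log_div (by positivity) (by positivity), Real.log_div (by positivity) (by positivity),
      Real.log_mul (by positivity) (by positivity), Real.log_mul (by positivity) (by positivity),
      Real.log_pow, Real.log_pow, Real.log_pow, Real.log_pow]
    congr 1
    push_cast
    field_simp
    ring
  rw [e, div_le_iff₀ (by positivity)]
  push_cast
  calc 3 ^ w * ((w : ℝ) + d) ^ (w + d)
      ≤ 3 ^ w * ((w + d + 1) * ((w + d).choose w * w ^ w * d ^ d)) := by gcongr
    _ = _ := by ring

end Entropy

/-! ### Running time in terms of hits of the dual code -/

section RunningTime

variable {n k : ℕ}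

open Classical in
/-- The vectors with light halves in stage `q`. -/
noncomputable def lightSet (hn : 1 ≤ n) (m v q : ℕ) : Finset (Fin n → F4) :=
  Finset.univ.filter (HalvesLight (stageOrder hn m q) m v)

open Classical in
/-- The vectors that vanish on the window in stage `q`. -/
noncomputable def vanishingSet (hn : 1 ≤ n) (m q : ℕ) : Finset (Fin n → F4) :=
  Finset.univ.filter (Vanishes (stageOrder hn m q) (2 * m))

theorem stageOrder_bijective (hn : 1 ≤ n) {m : ℕ} (hm : 2 * m ≤ n) (q : ℕ) :
    Function.Bijective (stageOrder hn m q) :=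
  order_bijective hn hm (Nat.le_of_lt_succ (Nat.mod_lt _ (Nat.succ_pos m)))

/-- The order depends on `p` and `i` but not on the weight, so only `n * (m + 1)` windows and splits
have to be free of defects. -/
theorem stageOrder_mod (hn : 1 ≤ n) (m q : ℕ) :
    stageOrder hn m (q % (n * (m + 1))) = stageOrder hn m q := by
  rw [stageOrder, stageOrder, mul_comm n, Nat.mod_mul_right_div_self, Nat.mod_mod,
    Nat.mod_mul_right_mod]

open Classical in
theorem noDefect_of_hits (hn : 1 ≤ n) {m : ℕ} {C : AddSubgroup (Fin n → F4)}
    {g : Fin (n - k) → Fin n → F4} (hg : IsGenerating g C)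
    (h : hits (n * (m + 1)) (vanishingSet hn m) C = 0) (q : ℕ) :
    NoDefect g (stageOrder hn m q) (2 * m) := by
  intro f hf hv
  by_contra hne
  rw [hits, Finset.sum_eq_zero_iff] at h
  have h1 := h (q % (n * (m + 1))) (Finset.mem_range.2 (Nat.mod_lt _ (by positivity)))
  rw [Finset.card_eq_zero, Finset.filter_eq_empty_iff] at h1
  refine h1 (x := f) ?_ ⟨hne, (dual_iff_mem_perp hg).1 hf⟩
  rw [vanishingSet, Finset.mem_filter, stageOrder_mod]
  exact ⟨Finset.mem_univ _, hv⟩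

-- The additional one is for the zero vector, which is dual and light but is not counted by `hits`.
open Classical in
theorem pairCount_le (hn : 1 ≤ n) {m v v' : ℕ} (hv : v ≤ v') {C : AddSubgroup (Fin n → F4)}
    {g : Fin (n - k) → Fin n → F4} (hg : IsGenerating g C) (q : ℕ) :
    pairCount g (stageOrder hn m q) m v
      ≤ ((lightSet hn m v' q).filter fun e => e ≠ 0 ∧ e ∈ perp C).card + 1 := by
  rw [pairCount]
  refine (Finset.card_le_card (t := insert 0 ((lightSet hn m v' q).filter
    fun e => e ≠ 0 ∧ e ∈ perp C)) fun f hf => ?_).trans (Finset.card_insert_le _ _)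
  simp only [Finset.mem_filter, Finset.mem_univ, true_and] at hf
  rw [Finset.mem_insert, Finset.mem_filter, lightSet, Finset.mem_filter]
  by_cases h : f = 0
  · exact Or.inl h
  · exact Or.inr ⟨⟨Finset.mem_univ _, hf.2.1.trans hv, hf.2.2.trans hv⟩, h,
      (dual_iff_mem_perp hg).1 hf.1⟩

-- Only stages of weight at most `d ≤ w` are run, and `halfWeight` is monotone, so each of them is
-- dominated by the data for weight `w`.
open Classical in
theorem searchSteps_le (hn : 1 ≤ n) {m d w L : ℕ} (hd : d ≤ w) {C : AddSubgroup (Fin n → F4)}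
    {g : Fin (n - k) → Fin n → F4} (hg : IsGenerating g C)
    (hL : ∀ q, ∀ v ≤ halfWeight n m w, (lowWeight (stageOrder hn m q) v 0 m).length ≤ L ∧
      (lowWeight (stageOrder hn m q) v m m).length ≤ L) :
    searchSteps g hn m d ≤ n * n * (m + 1) * (100 * (n + 1) ^ 2 * (2 + 2 * L) + 4)
      + 100 * (n + 1) ^ 2 * hits (n * n * (m + 1)) (lightSet hn m (halfWeight n m w)) C + 2 := by
  rw [searchSteps, hits, Finset.mul_sum]
  refine Nat.add_le_add_right ?_ 2
  calc _ ≤ ∑ q ∈ Finset.range (n * n * (m + 1)), ((100 * (n + 1) ^ 2 * (2 + 2 * L) + 4) +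
        100 * (n + 1) ^ 2 * ((lightSet hn m (halfWeight n m w) q).filter
          fun e => e ≠ 0 ∧ e ∈ perp C).card) := ?_
    _ = _ := by
      rw [Finset.sum_add_distrib, Finset.sum_const, Finset.card_range, smul_eq_mul]
  refine Finset.sum_le_sum fun q _ => ?_
  split_ifs with h
  · have hv : halfWeight n m (stageWeight n m q) ≤ halfWeight n m w := by
      unfold halfWeight
      have := h.trans hd
      gcongr
    have h1 := pairCount_le hn (m := m) hv hg q
    obtain ⟨h2, h3⟩ := hL q _ hv
    rw [stageSteps]
    set X := ((lightSet hn m (halfWeight n m w) q).filter fun e => e ≠ 0 ∧ e ∈ perp C).card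
    calc _ ≤ 100 * (n + 1) ^ 2 * (1 + L + L + (X + 1)) + 4 := by gcongr
      _ = _ := by ring
  · omega

/-- The deterministic part of the estimate: without defects the time is a polynomial times the sum
of the list length and the number of hits. -/
theorem findsDistWithin_distProgram (hk : 1 ≤ k) (hn : 1 ≤ n) {C : AddSubgroup (Fin n → F4)}
    (hC : C ∈ stabCodes n k) {w : ℕ} {L a T : ℝ} (hd : stabDist C ≤ w)
    (hgood : hits (n * (halfWindow n k + 1)) (vanishingSet hn (halfWindow n k)) C = 0)
    (hL : ∀ q, ∀ v ≤ halfWeight n (halfWindow n k) w,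
      ((lowWeight (stageOrder hn (halfWindow n k) q) v 0 (halfWindow n k)).length : ℝ) ≤ L ∧
      ((lowWeight (stageOrder hn (halfWindow n k) q) v (halfWindow n k)
        (halfWindow n k)).length : ℝ) ≤ L)
    (ha : (hits (n * n * (halfWindow n k + 1))
      (lightSet hn (halfWindow n k) (halfWeight n (halfWindow n k) w)) C : ℝ) ≤ a)
    (hT : 1000000000 * ((n : ℝ) + 1) ^ 7 * (1 + L + a) ≤ T) :
    FindsDistWithin distProgram n k C T := by
  intro g hg
  set m := halfWindow n k with hmdef
  have hm : 2 * m ≤ n := two_mul_halfWindow_le (le_of_mem_stabCodes hC)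
  obtain ⟨t, τ, h1, h2, h3⟩ := distProgram_halts hk hC hg hn (noDefect_of_hits hn hg hgood)
  refine ⟨t, τ, h1, h2, le_trans ?_ hT⟩
  have hL0 : 0 ≤ L := le_trans (by positivity) (hL 0 0 (Nat.zero_le _)).1
  have h4 := searchSteps_le hn (L := ⌊L⌋₊) hd hg fun q v hv =>
    ⟨Nat.le_floor (hL q v hv).1, Nat.le_floor (hL q v hv).2⟩
  set H := hits (n * n * (m + 1)) (lightSet hn m (halfWeight n m w)) C
  set N := n + 1 with hN
  have h5 : t ≤ 1000000000 * N ^ 7 * (1 + ⌊L⌋₊ + H) := by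
    refine h3.trans ?_
    have e1 : unitCost (digits n) = 1600000 * N ^ 2 := by
      simp only [unitCost, digits, hN]; ring
    have e2 : n * n * (m + 1) ≤ N ^ 3 := by
      calc n * n * (m + 1) ≤ N * N * N := by gcongr <;> omega
        _ = _ := by ring
    have e3 : 1 ≤ N := by omega
    -- The constant is `100 + 200 + 4 + 3`. Multiplied by the factor `1600000` of the unit cost it
    -- stays below `1000000000`.
    have e4 : 100 * N ^ 2 + searchSteps g hn m (stabDist C) + 1
        ≤ 307 * N ^ 5 * (1 + ⌊L⌋₊ + H) := by
      have e5 : N ^ 2 ≤ N ^ 5 := Nat.pow_le_pow_right e3 (by norm_num)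
      have e6 : N ^ 3 ≤ N ^ 5 := Nat.pow_le_pow_right e3 (by norm_num)
      have e7 : 1 ≤ N ^ 5 := Nat.one_le_pow _ _ e3
      calc _ ≤ 100 * N ^ 2 + (N ^ 3 * (100 * N ^ 2 * (2 + 2 * ⌊L⌋₊) + 4) + 100 * N ^ 2 * H + 2)
            + 1 := by
              gcongr
              refine h4.trans ?_
              gcongr
        _ = 100 * N ^ 2 + 200 * N ^ 5 * (1 + ⌊L⌋₊) + 4 * N ^ 3 + 100 * N ^ 2 * H + 3 := by ring
        _ ≤ 100 * N ^ 5 + 200 * N ^ 5 * (1 + ⌊L⌋₊) + 4 * N ^ 5 + 100 * N ^ 5 * H + 3 * N ^ 5 := by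
              gcongr
              omega
        _ = N ^ 5 * (307 + 200 * ⌊L⌋₊ + 100 * H) := by ring
        _ ≤ N ^ 5 * (307 * (1 + ⌊L⌋₊ + H)) := Nat.mul_le_mul_left _ (by omega)
        _ = _ := by ring
    have e8 : ∀ x y z : ℕ, x * y * z * (1600000 * N ^ 2) = 1600000 * x * (y * N ^ 2 * z) :=
      fun x y z => by ring
    rw [e1]
    refine (Nat.mul_le_mul_right _ e4).trans ?_
    rw [e8, ← pow_add, mul_assoc 1000000000]
    exact Nat.mul_le_mul_right _ (by norm_num)
  have h6 : (t : ℝ) ≤ 1000000000 * ((n : ℝ) + 1) ^ 7 * (1 + ⌊L⌋₊ + H) := by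
    have := (Nat.cast_le (α := ℝ)).2 h5
    push_cast [hN] at this
    exact this
  refine h6.trans ?_
  gcongr
  exact Nat.floor_le hL0

end RunningTime

/-! ### Exponential growth rates -/

/-- `f` grows at most like `2 ^ (n a)` up to subexponential factors. -/
def ExpLE (f : ℕ → ℝ) (a : ℝ) : Prop :=
  ∀ b, a < b → ∀ᶠ n : ℕ in atTop, f n ≤ 2 ^ ((n : ℝ) * b)

namespace ExpLE

variable {f g : ℕ → ℝ} {a b : ℝ}

theorem of_le (hg : ExpLE g a) (h : ∀ᶠ n in atTop, f n ≤ g n) : ExpLE f a := fun b hb => by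
  filter_upwards [hg b hb, h] with n h1 h2 using h2.trans h1

theorem weaken (hf : ExpLE f a) (h : a ≤ b) : ExpLE f b := fun c hc => hf c (h.trans_lt hc)

theorem mul (hf : ExpLE f a) (hg : ExpLE g b) (hg0 : ∀ n, 0 ≤ g n) :
    ExpLE (fun n => f n * g n) (a + b) := fun c hc => by
  filter_upwards [hf (a + (c - a - b) / 2) (by linarith),
    hg (b + (c - a - b) / 2) (by linarith)] with n h1 h2
  refine (mul_le_mul h1 h2 (hg0 n) (by positivity)).trans (le_of_eq ?_)
  rw [← Real.rpow_add (by norm_num)]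
  congr 1
  ring

theorem tendsto_rpow_zero (hb : b < 0) :
    Tendsto (fun n : ℕ => (2 : ℝ) ^ ((n : ℝ) * b)) atTop (𝓝 0) := by
  have h1 : (2 : ℝ) ^ b < 1 := Real.rpow_lt_one_of_one_lt_of_neg (by norm_num) hb
  refine (tendsto_pow_atTop_nhds_zero_of_lt_one (by positivity) h1).congr fun n => ?_
  rw [mul_comm, Real.rpow_mul (by norm_num), Real.rpow_natCast]

theorem tendsto_zero (hf : ExpLE f a) (ha : a < 0) (hf0 : ∀ n, 0 ≤ f n) :
    Tendsto f atTop (𝓝 0) :=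
  tendsto_of_tendsto_of_tendsto_of_le_of_le' tendsto_const_nhds
    (tendsto_rpow_zero (show a / 2 < 0 by linarith)) (Eventually.of_forall hf0)
    (hf (a / 2) (by linarith))

theorem const (c : ℝ) : ExpLE (fun _ => c) 0 := fun b hb => by
  have h := (tendsto_rpow_zero (neg_lt_zero.2 hb)).const_mul (max c 0)
  rw [mul_zero] at h
  filter_upwards [h.eventually (gt_mem_nhds one_pos)] with n hn
  rw [mul_neg, Real.rpow_neg (by norm_num), ← div_eq_mul_inv,
    div_lt_one (by positivity)] at hn
  exact (le_max_left _ _).trans hn.le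

theorem add (hf : ExpLE f a) (hg : ExpLE g a) : ExpLE (fun n => f n + g n) a := fun b hb => by
  filter_upwards [hf (a + (b - a) / 2) (by linarith), hg (a + (b - a) / 2) (by linarith),
    const 2 ((b - a) / 2) (by linarith)] with n h1 h2 h3
  calc f n + g n ≤ 2 * 2 ^ ((n : ℝ) * (a + (b - a) / 2)) := by linarith
    _ ≤ 2 ^ ((n : ℝ) * ((b - a) / 2)) * 2 ^ ((n : ℝ) * (a + (b - a) / 2)) := by gcongr
    _ = _ := by
      rw [← Real.rpow_add (by norm_num)]
      congr 1
      ring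

theorem natCast_add_one : ExpLE (fun n => (n : ℝ) + 1) 0 := by
  refine add (fun b hb => ?_) (const 1)
  have h1 : 1 < (2 : ℝ) ^ b := Real.one_lt_rpow (by norm_num) hb
  have h := tendsto_pow_const_div_const_pow_of_one_lt 1 h1
  filter_upwards [h.eventually (gt_mem_nhds one_pos)] with n hn
  rw [div_lt_one (by positivity), pow_one] at hn
  rw [mul_comm, Real.rpow_mul (by norm_num), Real.rpow_natCast]
  exact hn.le

theorem natCast_add_one_pow (j : ℕ) : ExpLE (fun n => ((n : ℝ) + 1) ^ j) 0 := by
  induction j with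
  | zero => simpa using const 1
  | succ j ih =>
    have := ih.mul natCast_add_one fun n => by positivity
    simpa [pow_succ] using this

theorem rpow {θ : ℕ → ℝ} (h : Tendsto θ atTop (𝓝 a)) :
    ExpLE (fun n => 2 ^ ((n : ℝ) * θ n)) a := fun b hb => by
  filter_upwards [h.eventually (gt_mem_nhds hb)] with n hn
  have := hn.le
  gcongr
  norm_num

end ExpLE

/-! ### Union bound and sizes of the relevant sets -/

section GoodCodes

variable {n k : ℕ}

theorem FindsDistWithin.mono {P : RamProg} {C : AddSubgroup (Fin n → F4)} {S T : ℝ}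
    (h : FindsDistWithin P n k C S) (hST : S ≤ T) : FindsDistWithin P n k C T := fun g hg => by
  obtain ⟨t, τ, h1, h2, h3⟩ := h g hg
  exact ⟨t, τ, h1, h2, h3.trans hST⟩

/-- Lower bound for the probability of a logical operator in a set of size `c`. -/
noncomputable def logicalBound (n k : ℕ) (c : ℝ) : ℝ :=
  (1 - 1 / 4 ^ k) / (2 ^ n / (2 ^ k * c) + 1 / (1 - 4 / (2 ^ n * 2 ^ n)))

-- Four bad events are excluded: a nonzero dual vector of weight at most `w₁`, the absence of
-- logical operators of weight exactly `w₂`, a nonzero dual vector vanishing on some window, and `a`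
-- or more hits by light vectors over all stages. Otherwise the distance lies in `(w₁, w₂]` and
-- `findsDistWithin_distProgram` applies.
open Classical in
theorem one_sub_le_stabProb (hk1 : 1 ≤ k) (hk : k ≤ n) (hn1 : 1 ≤ n) (hn : 2 ≤ n)
    {w₁ w₂ : ℕ} (hw : 1 ≤ w₂)
    (hwn : w₂ ≤ n) {L a T : ℝ} (ha : 0 < a)
    (hL : ∀ q, ∀ v ≤ halfWeight n (halfWindow n k) w₂,
      ((lowWeight (stageOrder hn1 (halfWindow n k) q) v 0
        (halfWindow n k)).length : ℝ) ≤ L ∧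
      ((lowWeight (stageOrder hn1 (halfWindow n k) q) v (halfWindow n k)
        (halfWindow n k)).length : ℝ) ≤ L)
    (hT : 1000000000 * ((n : ℝ) + 1) ^ 7 * (1 + L + a) ≤ T) {b₁ b₂ b₃ : ℝ}
    (h₁ : ((Finset.univ.filter fun f : Fin n → F4 => hammingNorm f ≤ w₁).card : ℝ) ≤ b₁)
    (h₂ : ∀ q, ((vanishingSet hn1 (halfWindow n k) q).card : ℝ) ≤ b₂)
    (h₃ : ∀ q, ((lightSet hn1 (halfWindow n k)
      (halfWeight n (halfWindow n k) w₂) q).card : ℝ) ≤ b₃) :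
    1 - (b₁ * (2 ^ k / 2 ^ n) + (1 - logicalBound n k (n.choose w₂ * 3 ^ w₂ : ℕ))
      + ((n : ℝ) + 1) ^ 2 * b₂ * (2 ^ k / 2 ^ n)
      + ((n : ℝ) + 1) ^ 3 * b₃ * (2 ^ k / 2 ^ n) / a)
      ≤ stabProb n k fun C => (w₁ < stabDist C ∧ stabDist C ≤ w₂) ∧
        FindsDistWithin distProgram n k C T := by
  set m := halfWindow n k
  have hm : 2 * m ≤ n := two_mul_halfWindow_le hk
  set s₁ : ℕ → Finset (Fin n → F4) := fun _ => Finset.univ.filter fun f => hammingNorm f ≤ w₁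
  set s₂ := Finset.univ.filter fun f : Fin n → F4 => hammingNorm f = w₂ with hs₂
  set s₄ := lightSet hn1 m (halfWeight n m w₂)
  have p1 : stabProb n k (fun C => (1 : ℝ) ≤ hits 1 s₁ C) ≤ b₁ * (2 ^ k / 2 ^ n) := by
    have := stabProb_le_hits hk 1 s₁ 1
    rw [mul_one, Finset.sum_range_one] at this
    exact this.trans (by gcongr)
  have p2 : stabProb n k (fun C => ¬ ∃ e ∈ s₂, Logical C e)
      ≤ 1 - logicalBound n k (n.choose w₂ * 3 ^ w₂ : ℕ) := by
    have h := stabProb_add_not hk (A := fun C => ∃ e ∈ s₂, Logical C e)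
    have hne : s₂.Nonempty := by
      rw [← Finset.card_pos, hs₂, card_sphere]
      have := Nat.choose_pos hwn
      positivity
    have h' := le_stabProb_logical hk1 hk hn s₂ hne fun e he h0 => by
      simp only [hs₂, Finset.mem_filter, Finset.mem_univ, true_and] at he
      rw [h0, hammingNorm_zero] at he
      omega
    rw [hs₂, card_sphere, ← hs₂] at h'
    rw [logicalBound]
    linarith
  have p3 : stabProb n k (fun C => (1 : ℝ) ≤ hits (n * (m + 1)) (vanishingSet hn1 m) C)
      ≤ ((n : ℝ) + 1) ^ 2 * b₂ * (2 ^ k / 2 ^ n) := by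
    have := stabProb_le_hits hk (n * (m + 1)) (vanishingSet hn1 m) 1
    rw [mul_one] at this
    refine this.trans ?_
    gcongr
    have hb : 0 ≤ b₂ := le_trans (by positivity) (h₂ 0)
    calc _ ≤ ∑ q ∈ Finset.range (n * (m + 1)), b₂ := Finset.sum_le_sum fun q _ => h₂ q
      _ = (n * (m + 1) : ℕ) * b₂ := by rw [Finset.sum_const, Finset.card_range, nsmul_eq_mul]
      _ ≤ _ := by
        gcongr
        have : n * (m + 1) ≤ (n + 1) ^ 2 := by nlinarith
        exact_mod_cast this
  have p4 : stabProb n k (fun C => a ≤ hits (n * n * (m + 1)) s₄ C)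
      ≤ ((n : ℝ) + 1) ^ 3 * b₃ * (2 ^ k / 2 ^ n) / a := by
    rw [le_div_iff₀ ha]
    refine (stabProb_le_hits hk _ _ _).trans ?_
    gcongr
    have hb : 0 ≤ b₃ := le_trans (by positivity) (h₃ 0)
    calc _ ≤ ∑ q ∈ Finset.range (n * n * (m + 1)), b₃ := Finset.sum_le_sum fun q _ => h₃ q
      _ = (n * n * (m + 1) : ℕ) * b₃ := by
        rw [Finset.sum_const, Finset.card_range, nsmul_eq_mul]
      _ ≤ _ := by
        gcongr
        have : n * n * (m + 1) ≤ (n + 1) ^ 3 := by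
          calc n * n * (m + 1) ≤ (n + 1) * (n + 1) * (n + 1) := by gcongr <;> omega
            _ = _ := by ring
        exact_mod_cast this
  have hcover : ∀ C ∈ stabCodes n k, ¬ ((w₁ < stabDist C ∧ stabDist C ≤ w₂) ∧
        FindsDistWithin distProgram n k C T) →
      ((1 : ℝ) ≤ hits 1 s₁ C ∨ ¬ ∃ e ∈ s₂, Logical C e) ∨
      ((1 : ℝ) ≤ hits (n * (m + 1)) (vanishingSet hn1 m) C ∨
        a ≤ hits (n * n * (m + 1)) s₄ C) := by
    intro C hC hbad
    by_contra! h
    obtain ⟨⟨g1, ⟨e, he, hCe⟩⟩, g3, g4⟩ := h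
    obtain ⟨⟨f, hf, hCf, hw'⟩, hmin⟩ := isLeast_stabDist hC hk1
    have hle : stabDist C ≤ w₂ := by
      simp only [hs₂, Finset.mem_filter, Finset.mem_univ, true_and] at he
      exact hmin ⟨e, hCe.1, hCe.2, he⟩
    refine hbad ⟨⟨?_, hle⟩, ?_⟩
    · by_contra! hlt
      have g1' : hits 1 s₁ C = 0 := by
        have : hits 1 s₁ C < 1 := by exact_mod_cast g1
        omega
      rw [hits, Finset.sum_range_one, Finset.card_eq_zero, Finset.filter_eq_empty_iff] at g1'
      refine g1' (x := f) ?_ ⟨Logical.ne_zero ⟨hf, hCf⟩, hf⟩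
      simp only [s₁, Finset.mem_filter, Finset.mem_univ, true_and]
      rw [hw']
      exact hlt
    · refine findsDistWithin_distProgram hk1 hn1 hC hle ?_ hL g4.le hT
      have : hits (n * (m + 1)) (vanishingSet hn1 m) C < 1 := by exact_mod_cast g3
      exact Nat.lt_one_iff.1 this
  have hsum := stabProb_mono hcover
  have u1 := stabProb_or_le (n := n) (k := k)
    (A := fun C => (1 : ℝ) ≤ hits 1 s₁ C ∨ ¬ ∃ e ∈ s₂, Logical C e)
    (B := fun C => (1 : ℝ) ≤ hits (n * (m + 1)) (vanishingSet hn1 m) C ∨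
        a ≤ hits (n * n * (m + 1)) s₄ C)
  have u2 := stabProb_or_le (n := n) (k := k)
    (A := fun C => (1 : ℝ) ≤ hits 1 s₁ C) (B := fun C => ¬ ∃ e ∈ s₂, Logical C e)
  have u3 := stabProb_or_le (n := n) (k := k)
    (A := fun C => (1 : ℝ) ≤ hits (n * (m + 1)) (vanishingSet hn1 m) C)
    (B := fun C => a ≤ hits (n * n * (m + 1)) s₄ C)
  have htot := stabProb_add_not hk (A := fun C => (w₁ < stabDist C ∧ stabDist C ≤ w₂) ∧
        FindsDistWithin distProgram n k C T)
  linarith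

theorem card_ball_le {x : ℝ} (h0 : 0 < x) (h1 : x ≤ 3 / 4) {w : ℕ} (hw : (w : ℝ) ≤ x * n) :
    ((Finset.univ.filter fun f : Fin n → F4 => hammingNorm f ≤ w).card : ℝ)
      ≤ 2 ^ (2 * n * entropyQ 4 x) := by
  have ht := tilt_pos h0 h1
  have h2 := card_mul_pow_le (π := id) (t₀ := 0) (j := n) (v := w) Function.bijective_id
    (by omega) ht.le (tilt_le_one h1)
    (s := Finset.univ.filter fun f : Fin n → F4 => hammingNorm f ≤ w) fun f hf => by
      rw [← hammingNorm_eq_weightOn Function.bijective_id fun t h => absurd t.2 (by omega)]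
      simpa using hf
  have h3 := one_add_tilt_pow_le (c := 0) h0 h1 (show (w : ℝ) ≤ x * n + 0 by linarith)
  rw [Nat.sub_self, pow_zero, mul_one] at h2
  rw [neg_zero, Real.rpow_zero, one_mul] at h3
  refine le_of_mul_le_mul_right (h2.trans (h3.trans (le_of_eq (mul_comm _ _)))) (by positivity)

open Classical in
theorem card_vanishingSet_le (hn : 1 ≤ n) {m : ℕ} (hm : 2 * m ≤ n) (q : ℕ) :
    ((vanishingSet hn m q).card : ℝ) ≤ 4 ^ (n - 2 * m) := by
  -- Chernoff's bound with `a = 0` and `v = 0`, where `0 ^ 0 = 1`.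
  have h2 := card_mul_pow_le (stageOrder_bijective hn hm q) (t₀ := 0) (j := 2 * m) (v := 0)
    (by omega) le_rfl zero_le_one (s := vanishingSet hn m q) fun f hf => by
      rw [vanishingSet, Finset.mem_filter] at hf
      rw [Nat.le_zero, weightOn, Finset.card_eq_zero, Finset.filter_eq_empty_iff]
      rintro t - ⟨ht, hft⟩
      exact hft (hf.2 t (by omega))
  simpa using h2

theorem halfWeight_le {x : ℝ} (hn : 1 ≤ n) {m w : ℕ} (hw : (w : ℝ) ≤ x * n) :
    (halfWeight n m w : ℝ) ≤ x * m + 1 := by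
  rw [halfWeight]
  push_cast
  have hn0 : (0 : ℝ) < n := by exact_mod_cast hn
  have h1 : ((w * m / n : ℕ) : ℝ) ≤ (w * m : ℕ) / n := Nat.cast_div_le
  have h2 : ((w * m : ℕ) : ℝ) / n ≤ x * m := by
    rw [div_le_iff₀ hn0]
    push_cast
    calc (w : ℝ) * m ≤ x * n * m := by gcongr
      _ = _ := by ring
  linarith

-- The window carries weight at most `2 * halfWeight n m w ≤ 2xm + 2`, and the excess of two costs
-- the constant `tilt x ^ (-2)`. The positions outside the window are free.
open Classical in
theorem card_lightSet_le {x : ℝ} (h0 : 0 < x) (h1 : x ≤ 3 / 4) (hn : 1 ≤ n) {m w : ℕ}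
    (hm : 2 * m ≤ n) (hw : (w : ℝ) ≤ x * n) (q : ℕ) :
    ((lightSet hn m (halfWeight n m w) q).card : ℝ)
      ≤ tilt x ^ (-2 : ℝ) * 2 ^ (4 * m * entropyQ 4 x) * 4 ^ (n - 2 * m) := by
  have ht := tilt_pos h0 h1
  have h2 := card_mul_pow_le (stageOrder_bijective hn hm q) (t₀ := 0) (j := 2 * m)
    (v := 2 * halfWeight n m w) (by omega) ht.le (tilt_le_one h1)
    (s := lightSet hn m (halfWeight n m w) q) fun f hf => by
      rw [lightSet, Finset.mem_filter] at hf
      obtain ⟨-, g1, g2⟩ := hf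
      have : weightOn (stageOrder hn m q) 0 (2 * m) f
          ≤ weightOn (stageOrder hn m q) 0 m f + weightOn (stageOrder hn m q) m m f := by
        refine (Finset.card_le_card fun t ht => ?_).trans (Finset.card_union_le _ _)
        simp only [Finset.mem_union, Finset.mem_filter, Finset.mem_univ, true_and] at ht ⊢
        by_cases h : (t : ℕ) < m
        · exact Or.inl ⟨by omega, ht.2⟩
        · exact Or.inr ⟨by omega, ht.2⟩
      omega
  have h3 := halfWeight_le hn (m := m) hw
  have h4 := one_add_tilt_pow_le (c := 2) (j := 2 * m) (v := 2 * halfWeight n m w) h0 h1 (by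
    push_cast; linarith)
  have e : (2 : ℝ) * (2 * m : ℕ) * entropyQ 4 x = 4 * m * entropyQ 4 x := by push_cast; ring
  rw [e] at h4
  have h5 : (0 : ℝ) < tilt x ^ (2 * halfWeight n m w) := by positivity
  refine le_of_mul_le_mul_right (h2.trans ?_) h5
  calc _ ≤ tilt x ^ (2 * halfWeight n m w) * (tilt x ^ (-2 : ℝ) * 2 ^ (4 * m * entropyQ 4 x))
        * 4 ^ (n - 2 * m) := by gcongr
    _ = _ := by ring

theorem length_lowWeight_le_rpow {x : ℝ} (h0 : 0 < x) (h1 : x ≤ 3 / 4) {π : Fin n → Fin n}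
    (hπ : Function.Bijective π) {t₀ m v : ℕ} (hm : t₀ + m ≤ n) (hv : (v : ℝ) ≤ x * m + 1) :
    ((lowWeight π v t₀ m).length : ℝ) ≤ tilt x ^ (-1 : ℝ) * 2 ^ (2 * m * entropyQ 4 x) := by
  have ht := tilt_pos h0 h1
  have h2 := length_lowWeight_mul_pow_le hπ (v := v) hm ht.le (tilt_le_one h1)
  have h4 := one_add_tilt_pow_le h0 h1 hv
  refine le_of_mul_le_mul_right (h2.trans (h4.trans (le_of_eq (mul_comm _ _)))) (by positivity)

end GoodCodes

/-! ### Exponents for codes of rate tending to `R` -/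

section Asymptotics

variable {R : ℝ} {k : ℕ → ℕ}

theorem eventually_le_of_rate (hR : R < 1)
    (hk : Tendsto (fun n : ℕ => (k n : ℝ) / (n : ℝ)) atTop (𝓝 R)) : ∀ᶠ n in atTop, k n ≤ n := by
  filter_upwards [hk.eventually (gt_mem_nhds hR), eventually_gt_atTop 0] with n h1 h2
  have hn : (0 : ℝ) < n := by exact_mod_cast h2
  rw [div_lt_one hn] at h1
  exact_mod_cast h1.le

theorem tendsto_atTop_of_rate (hR : 0 < R)
    (hk : Tendsto (fun n : ℕ => (k n : ℝ) / (n : ℝ)) atTop (𝓝 R)) : Tendsto k atTop atTop := by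
  have h := hk.pos_mul_atTop hR tendsto_natCast_atTop_atTop
  rw [← tendsto_natCast_atTop_iff (R := ℝ)]
  refine h.congr' ?_
  filter_upwards [eventually_gt_atTop 0] with n hn
  have hn : (n : ℝ) ≠ 0 := by exact_mod_cast hn.ne'
  field_simp

theorem tendsto_halfWindow (hR0 : 0 < R)
    (hk : Tendsto (fun n : ℕ => (k n : ℝ) / (n : ℝ)) atTop (𝓝 R)) :
    Tendsto (fun n => (halfWindow n (k n) : ℝ) / n) atTop (𝓝 ((1 + R) / (3 + R))) := by
  have h1 : Tendsto (fun n : ℕ => (1 + (k n : ℝ) / n) / (3 + (k n : ℝ) / n)) atTop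
      (𝓝 ((1 + R) / (3 + R))) :=
    (tendsto_const_nhds.add hk).div (tendsto_const_nhds.add hk) (by linarith)
  have h2 : Tendsto (fun n : ℕ => (1 + (k n : ℝ) / n) / (3 + (k n : ℝ) / n) - 1 / (n : ℝ)) atTop
      (𝓝 ((1 + R) / (3 + R))) := by
    simpa using h1.sub tendsto_one_div_atTop_nhds_zero_nat
  have h3 : ∀ n : ℕ, 0 < n → (1 + (k n : ℝ) / n) / (3 + (k n : ℝ) / n)
      = ((n * (n + k n) : ℕ) / (3 * n + k n : ℕ) : ℝ) / n := fun n hn => by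
    have hn : (0 : ℝ) < n := by exact_mod_cast hn
    push_cast
    field_simp
  refine tendsto_of_tendsto_of_tendsto_of_le_of_le' h2 h1 ?_ ?_
  · filter_upwards [eventually_gt_atTop 0] with n hn
    rw [h3 n hn, ← sub_div]
    gcongr
    rw [halfWindow, ← Nat.floor_div_eq_div (K := ℝ)]
    exact (Nat.sub_one_lt_floor _).le
  · filter_upwards [eventually_gt_atTop 0] with n hn
    rw [h3 n hn]
    gcongr
    exact Nat.cast_div_le

theorem expLE_rate (hk : Tendsto (fun n : ℕ => (k n : ℝ) / (n : ℝ)) atTop (𝓝 R)) :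
    ExpLE (fun n => 2 ^ k n / 2 ^ n) (R - 1) := by
  refine (ExpLE.rpow (hk.sub_const 1)).of_le ?_
  filter_upwards [eventually_gt_atTop 0] with n hn
  have hn : (n : ℝ) ≠ 0 := by exact_mod_cast hn.ne'
  rw [mul_sub, mul_div_cancel₀ _ hn, mul_one, Real.rpow_sub (by norm_num), Real.rpow_natCast,
    Real.rpow_natCast]

theorem expLE_rate_inv (hk : Tendsto (fun n : ℕ => (k n : ℝ) / (n : ℝ)) atTop (𝓝 R)) :
    ExpLE (fun n => 2 ^ n / 2 ^ k n) (1 - R) := by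
  refine (ExpLE.rpow (tendsto_const_nhds.sub hk)).of_le ?_
  filter_upwards [eventually_gt_atTop 0] with n hn
  have hn : (n : ℝ) ≠ 0 := by exact_mod_cast hn.ne'
  rw [mul_sub, mul_div_cancel₀ _ hn, mul_one, Real.rpow_sub (by norm_num), Real.rpow_natCast,
    Real.rpow_natCast]

theorem expLE_outside (hR0 : 0 < R) (hR1 : R < 1)
    (hk : Tendsto (fun n : ℕ => (k n : ℝ) / (n : ℝ)) atTop (𝓝 R)) :
    ExpLE (fun n => 4 ^ (n - 2 * halfWindow n (k n))) (2 * (1 - 2 * ((1 + R) / (3 + R)))) := by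
  refine (ExpLE.rpow ((tendsto_const_nhds.sub ((tendsto_halfWindow hR0 hk).const_mul 2)).const_mul
    2)).of_le ?_
  filter_upwards [eventually_gt_atTop 0, eventually_le_of_rate hR1 hk] with n hn hkn
  have hn : (n : ℝ) ≠ 0 := by exact_mod_cast hn.ne'
  have hm := two_mul_halfWindow_le hkn
  have e : (n : ℝ) * (2 * (1 - 2 * ((halfWindow n (k n) : ℝ) / n)))
      = (2 * (n - 2 * halfWindow n (k n)) : ℕ) := by
    push_cast [Nat.cast_sub hm]
    field_simp
  rw [e, Real.rpow_natCast, pow_mul]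
  norm_num

theorem expLE_window (hR0 : 0 < R)
    (hk : Tendsto (fun n : ℕ => (k n : ℝ) / (n : ℝ)) atTop (𝓝 R)) (c h : ℝ) :
    ExpLE (fun n => 2 ^ (c * halfWindow n (k n) * h)) (c * ((1 + R) / (3 + R)) * h) := by
  refine (ExpLE.rpow (((tendsto_halfWindow hR0 hk).const_mul c).mul_const h)).of_le ?_
  filter_upwards [eventually_gt_atTop 0] with n hn
  have hn : (n : ℝ) ≠ 0 := by exact_mod_cast hn.ne'
  refine le_of_eq ?_
  congr 1
  field_simp

/-- The sphere of radius `⌊xn⌋` has about `2 ^ (2n h₄(x))` elements, so the expected number of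
logical operators on it grows exponentially and the second moment bound tends to one. -/
theorem tendsto_logicalBound (hR0 : 0 < R)
    (hk : Tendsto (fun n : ℕ => (k n : ℝ) / (n : ℝ)) atTop (𝓝 R)) {x : ℝ} (hx0 : 0 < x)
    (hx1 : x < 1) (hx : 1 - R < 2 * entropyQ 4 x) :
    Tendsto (fun n => logicalBound n (k n) (n.choose ⌊x * n⌋₊ * 3 ^ ⌊x * n⌋₊ : ℕ)) atTop
      (𝓝 1) := by
  have hx' : Tendsto (fun n : ℕ => (⌊x * n⌋₊ : ℝ) / n) atTop (𝓝 x) :=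
    (tendsto_nat_floor_mul_div_atTop hx0.le).comp tendsto_natCast_atTop_atTop
  have hH := (continuous_entropyQ_four.tendsto x).comp hx'
  have hw : Tendsto (fun n : ℕ => ⌊x * n⌋₊) atTop atTop :=
    tendsto_nat_floor_atTop.comp (tendsto_natCast_atTop_atTop.const_mul_atTop hx0)
  have h1 : Tendsto (fun n => (2 : ℝ) ^ n /
      (2 ^ k n * (n.choose ⌊x * n⌋₊ * 3 ^ ⌊x * n⌋₊ : ℕ))) atTop (𝓝 0) := by
    have hE := ((expLE_rate_inv hk).mul ExpLE.natCast_add_one fun n => by positivity).mul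
      (ExpLE.rpow (hH.const_mul (-2))) fun n => by positivity
    refine (hE.of_le ?_).tendsto_zero (by linarith) fun n => by positivity
    filter_upwards [hw.eventually_ge_atTop 1, eventually_gt_atTop 0] with n hn hn0
    have hn0 : (0 : ℝ) < n := by exact_mod_cast hn0
    have hlt : ⌊x * n⌋₊ < n := by
      rw [Nat.floor_lt (by positivity)]
      nlinarith
    have hcard := rpow_entropy_le_card hn hlt
    set S : ℝ := ((n.choose ⌊x * n⌋₊ * 3 ^ ⌊x * n⌋₊ : ℕ) : ℝ)
    have hS : 0 < S := by
      have := (Real.rpow_pos_of_pos (two_pos : (0 : ℝ) < 2)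
        (2 * n * entropyQ 4 (⌊x * n⌋₊ / n))).trans_le hcard
      exact pos_of_mul_pos_right this (by positivity)
    have e : (n : ℝ) * (-2 * (entropyQ 4 ∘ fun n : ℕ => (⌊x * n⌋₊ : ℝ) / n) n)
        = -(2 * n * entropyQ 4 (⌊x * n⌋₊ / n)) := by
      simp only [Function.comp_apply]; ring
    rw [e, Real.rpow_neg (by norm_num), ← div_eq_mul_inv, le_div_iff₀ (by positivity),
      ← div_div, div_mul_eq_mul_div, div_le_iff₀ hS]
    calc _ ≤ (2 : ℝ) ^ n / 2 ^ k n * ((n + 1) * S) := by gcongr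
      _ = _ := by ring
  have h2 : Tendsto (fun n : ℕ => (4 : ℝ) / (2 ^ n * 2 ^ n)) atTop (𝓝 0) := by
    have h3 : Tendsto (fun n : ℕ => (4 : ℝ) * ((1 / 2) ^ n * (1 / 2) ^ n)) atTop (𝓝 0) := by
      have h4 := tendsto_pow_atTop_nhds_zero_of_lt_one (r := (1 / 2 : ℝ)) (by norm_num)
        (by norm_num)
      simpa using (h4.mul h4).const_mul 4
    refine h3.congr fun n => ?_
    rw [one_div, inv_pow]
    field_simp
  have h5 : Tendsto (fun n : ℕ => (1 : ℝ) / 4 ^ k n) atTop (𝓝 0) := by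
    have h4 := tendsto_pow_atTop_nhds_zero_of_lt_one (r := (1 / 4 : ℝ)) (by norm_num)
        (by norm_num)
    refine (h4.comp (tendsto_atTop_of_rate hR0 hk)).congr fun n => ?_
    simp
  have h6 := (tendsto_const_nhds (x := (1 : ℝ)).sub h5).div
    (h1.add (tendsto_const_nhds (x := (1 : ℝ)).div (tendsto_const_nhds (x := (1 : ℝ)).sub h2)
      (by norm_num))) (by norm_num)
  simpa [logicalBound, Pi.div_def] using h6

/-- The relative weights `x₁ < x₂` enclose the Gilbert–Varshamov distance, their entropies being
`(1-R)/2 ∓ η`. Below `x₁` there is typically no nonzero dual vector, and at `x₂` there is a logical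
operator. All other exponents are evaluated at `x₂`. -/
theorem tendsto_stabProb_good (hR0 : 0 < R) (hR1 : R < 1)
    (hk : Tendsto (fun n : ℕ => (k n : ℝ) / (n : ℝ)) atTop (𝓝 R)) {ε : ℝ} (hε : 0 < ε) :
    Tendsto (fun n : ℕ => stabProb n (k n) fun C =>
      |R - (1 - 2 * entropyQ 4 (relDist C))| ≤ ε ∧
      FindsDistWithin distProgram n (k n) C
        ((2 : ℝ) ^ ((n : ℝ) * ((1 - R ^ 2) / (3 + R) + ε)))) atTop (𝓝 1) := by
  set F := (1 - R ^ 2) / (3 + R) with hF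
  set μ := (1 + R) / (3 + R) with hμ
  have h3R : 0 < 3 + R := by linarith
  -- The first bound keeps the loss in the exponents below `ε`, and the second keeps both entropies
  -- strictly between zero and one.
  obtain ⟨η, hη0, hη1, hη2⟩ : ∃ η, 0 < η ∧ η ≤ ε / 8 ∧ η ≤ (1 - R) / 4 :=
    ⟨min (ε / 8) ((1 - R) / 4), lt_min (by linarith) (by linarith), min_le_left _ _,
      min_le_right _ _⟩
  obtain ⟨x₁, hx₁0, hx₁1, hx₁⟩ := exists_entropyQ_four_eq (y := (1 - R) / 2 - η) (by linarith)
    (by linarith)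
  obtain ⟨x₂, hx₂0, hx₂1, hx₂⟩ := exists_entropyQ_four_eq (y := (1 - R) / 2 + η) (by linarith)
    (by linarith)
  have hμ0 : 0 < μ := by rw [hμ]; positivity
  have hμ1 : μ ≤ 1 / 2 := by rw [hμ, div_le_div_iff₀ h3R (by norm_num)]; linarith
  -- The exponent of the list length on the Gilbert–Varshamov bound.
  have hμF : μ * (1 - R) = F := by rw [hμ, hF]; field_simp; ring
  -- The exponent of the expected number of dual vectors that vanish on a window.
  have hF2 : 2 * (1 - 2 * μ) + (R - 1) = -F := by rw [hμ, hF]; field_simp; ring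
  have hF0 : 0 < F := by rw [← hμF]; exact mul_pos hμ0 (by linarith)
  have hμη : μ * η ≤ ε / 16 := by nlinarith
  have hμη0 : 0 < μ * η := by positivity
  have ht₂ := tilt_pos hx₂0 hx₂1.le
  have E1 := ((ExpLE.rpow (tendsto_const_nhds (x := 2 * entropyQ 4 x₁))).mul (expLE_rate hk)
    fun n => by positivity).tendsto_zero (by rw [hx₁]; linarith) fun n => by positivity
  have E2 := (tendsto_const_nhds (x := (1 : ℝ))).sub
    (tendsto_logicalBound hR0 hk hx₂0 (by linarith) (by rw [hx₂]; linarith))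
  have E3 := (((ExpLE.natCast_add_one_pow 2).mul (expLE_outside hR0 hR1 hk)
    fun n => by positivity).mul (expLE_rate hk) fun n => by positivity).tendsto_zero
    (by rw [← hμ]; linarith) fun n => by positivity
  -- The expected number of light dual vectors has exponent `4μ h₄(x₂) - F = F + 4μη`, where `4μη ≤
  -- ε/4`. Hence Markov's inequality with threshold `2 ^ (n(F + ε/2))` gives an exponentially small
  -- probability.
  have E4 := ((((ExpLE.natCast_add_one_pow 3).mul ((((ExpLE.const (tilt x₂ ^ (-2 : ℝ))).mul
    (expLE_window hR0 hk 4 (entropyQ 4 x₂)) fun n => by positivity)).mul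
    (expLE_outside hR0 hR1 hk) fun n => by positivity) fun n => by positivity).mul
    (expLE_rate hk) fun n => by positivity).mul
    (ExpLE.rpow (tendsto_const_nhds (x := -(F + ε / 2)))) fun n => by positivity).tendsto_zero
    (by rw [← hμ, hx₂]; nlinarith) fun n => by positivity
  -- The total time: the lists have exponent `2μ h₄(x₂) = F + 2μη`, which is below the exponent `F +
  -- ε/2` of the threshold.
  have E5 := (((ExpLE.const 1000000000).mul (ExpLE.natCast_add_one_pow 7)
    fun n => by positivity).mul ((((ExpLE.const 1).weaken (by linarith : 0 ≤ F + ε / 2)).add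
      ((((ExpLE.const (tilt x₂ ^ (-1 : ℝ))).mul (expLE_window hR0 hk 2 (entropyQ 4 x₂))
        fun n => by positivity)).weaken (by rw [← hμ, hx₂]; nlinarith : _ ≤ F + ε / 2))).add
      (ExpLE.rpow (tendsto_const_nhds (x := F + ε / 2)))) fun n => by positivity)
    (F + ε) (by linarith)
  have hlow := (tendsto_const_nhds (x := (1 : ℝ))).sub (((E1.add E2).add E3).add E4)
  rw [sub_self, add_zero, add_zero, add_zero, sub_zero] at hlow
  have hw : Tendsto (fun n : ℕ => ⌊x₂ * n⌋₊) atTop atTop :=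
    tendsto_nat_floor_atTop.comp (tendsto_natCast_atTop_atTop.const_mul_atTop hx₂0)
  refine tendsto_of_tendsto_of_tendsto_of_le_of_le' hlow tendsto_const_nhds ?_
    (Eventually.of_forall fun n => stabProb_le_one)
  filter_upwards [E5, hw.eventually_ge_atTop 1, eventually_ge_atTop 2,
    eventually_le_of_rate hR1 hk, (tendsto_atTop_of_rate hR0 hk).eventually_ge_atTop 1]
    with n hT hw1 hn hkn hk1
  have hn1 : 1 ≤ n := by omega
  have hn0 : (0 : ℝ) < n := by exact_mod_cast hn1
  have hfl₁ : (⌊x₁ * n⌋₊ : ℝ) ≤ x₁ * n := Nat.floor_le (by positivity)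
  have hfl₂ : (⌊x₂ * n⌋₊ : ℝ) ≤ x₂ * n := Nat.floor_le (by positivity)
  have hwn : ⌊x₂ * n⌋₊ ≤ n := by
    have : (⌊x₂ * n⌋₊ : ℝ) ≤ n := hfl₂.trans (by nlinarith)
    exact_mod_cast this
  have hm := two_mul_halfWindow_le hkn
  have hmain := one_sub_le_stabProb hk1 hkn hn1 hn (w₁ := ⌊x₁ * n⌋₊) hw1 hwn
    (a := 2 ^ ((n : ℝ) * (F + ε / 2))) (by positivity)
    (fun q v hv => by
      have hv' : (v : ℝ) ≤ x₂ * halfWindow n (k n) + 1 :=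
        le_trans (by exact_mod_cast hv) (halfWeight_le hn1 hfl₂)
      exact ⟨length_lowWeight_le_rpow hx₂0 hx₂1.le (stageOrder_bijective hn1 hm q) (by omega) hv',
        length_lowWeight_le_rpow hx₂0 hx₂1.le (stageOrder_bijective hn1 hm q) (by omega) hv'⟩)
    hT (card_ball_le hx₁0 hx₁1.le hfl₁) (card_vanishingSet_le hn1 hm)
    (card_lightSet_le hx₂0 hx₂1.le hn1 hm hfl₂)
  refine le_trans (le_of_eq ?_) (hmain.trans (stabProb_mono ?_))
  · have e1 : (2 : ℝ) ^ ((n : ℝ) * -(F + ε / 2)) = (2 ^ ((n : ℝ) * (F + ε / 2)))⁻¹ := by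
      rw [mul_neg, Real.rpow_neg (by norm_num)]
    have e2 : (n : ℝ) * (2 * entropyQ 4 x₁) = 2 * n * entropyQ 4 x₁ := by ring
    rw [e1, e2, ← div_eq_mul_inv]
  · rintro C hC ⟨⟨h1, h2⟩, h3⟩
    refine ⟨?_, h3⟩
    rw [Nat.floor_lt (by positivity)] at h1
    have h2' : (stabDist C : ℝ) ≤ x₂ * n := le_trans (by exact_mod_cast h2) hfl₂
    have r1 : x₁ ≤ relDist C := by
      rw [relDist, le_div_iff₀ hn0]; exact h1.le
    have r2 : relDist C ≤ x₂ := by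
      rw [relDist, div_le_iff₀ hn0]; exact h2'
    have hmono := strictMonoOn_entropyQ_four.monotoneOn
    have m1 := hmono ⟨hx₁0.le, hx₁1.le⟩ ⟨by linarith, by linarith⟩ r1
    have m2 := hmono ⟨by linarith, by linarith⟩ ⟨hx₂0.le, hx₂1.le⟩ r2
    rw [abs_le]
    constructor <;> linarith

end Asymptotics

/-! ### The main theorem -/

theorem mainTheorem10 :
    (∃ P : RamProg,
      -- the program never returns a wrong distance
      (∀ n k : ℕ, 1 ≤ k → ∀ C ∈ stabCodes n k, ∀ g : Fin (n - k) → Fin n → F4,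
        IsGenerating g C → ∀ (t : ℕ) (τ : RamState),
          P.Exec (initState n k g) t τ → τ.reg 0 = stabDist C) ∧
      -- complexity on random codes of rate `R`
      ∀ R : ℝ, 0 < R → R < 1 → ∀ k : ℕ → ℕ,
        Tendsto (fun n : ℕ => (k n : ℝ) / (n : ℝ)) atTop (𝓝 R) → ∀ ε : ℝ, 0 < ε →
          Tendsto (fun n : ℕ => stabProb n (k n) fun C =>
            FindsDistWithin P n (k n) C
              ((2 : ℝ) ^ ((n : ℝ) * (expPB R (relDist C) + ε)))) atTop (𝓝 1) ∧
          Tendsto (fun n : ℕ => stabProb n (k n) fun C =>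
            |R - (1 - 2 * entropyQ 4 (relDist C))| ≤ ε ∧
            FindsDistWithin P n (k n) C
              ((2 : ℝ) ^ ((n : ℝ) * ((1 - R ^ 2) / (3 + R) + ε)))) atTop (𝓝 1)) ∧
    -- the value of the exponent on the quantum Gilbert–Varshamov bound
    (∀ R δ : ℝ, 0 < R → R < 1 → 0 ≤ δ → δ ≤ 1 → R = 1 - 2 * entropyQ 4 δ →
      expPB R δ = (1 - R ^ 2) / (3 + R)) := by
  refine ⟨⟨distProgram, fun n k hk C hC g hg t τ h => distProgram_correct hk hC hg h,
    fun R hR0 hR1 k hk ε hε => ⟨?_, tendsto_stabProb_good hR0 hR1 hk hε⟩⟩, ?_⟩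
  -- The first claim follows from the second one with `ε/2`, since close to the Gilbert–Varshamov
  -- bound the two exponents are close.
  · refine tendsto_of_tendsto_of_tendsto_of_le_of_le
      (tendsto_stabProb_good hR0 hR1 hk (half_pos hε)) tendsto_const_nhds
      (fun n => stabProb_mono ?_) fun n => stabProb_le_one
    rintro C - ⟨h1, h2⟩
    refine h2.mono ?_
    refine Real.rpow_le_rpow_of_exponent_le (by norm_num)
      (mul_le_mul_of_nonneg_left ?_ (Nat.cast_nonneg n))
    have h3R : 0 < 3 + R := by linarith
    have h3 := (abs_le.1 h1).1
    -- From `2 h₄(δ) ≥ 1 - R - ε/2`; the loss is multiplied by `(1+R)/(3+R) ≤ 1`.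
    have h4 : (1 - R ^ 2) / (3 + R) ≤ expPB R (relDist C) + ε / 2 := by
      rw [expPB, div_le_iff₀ h3R, add_mul, div_mul_eq_mul_div, div_mul_cancel₀ _ h3R.ne']
      nlinarith
    linarith
  · intro R δ hR0 hR1 _ _ h
    have h3R : 3 + R ≠ 0 := by linarith
    have h1 : entropyQ 4 δ = (1 - R) / 2 := by linarith
    rw [expPB, h1]
    field_simp
    ring
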